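/- Let $N$ be a lattice of finite rank, $M=\mathrm{Hom}(N,\mathbb Z)$, $N_{\mathbb R}=N\otimes\mathbb R$. Let $\Delta=(n_e)_{e\in I}$ be a finite family of at least three non-zero vectors of $N$ with sum $0$, let $\omega\in\Lambda^2M$ be a $2$-form with $\omega(n_e,-)\neq0$ for all $e\in I$, fix $e_0\in I$, and let $\varphi_1,\dots,\varphi_p\in M$ be non-zero. A parametrized rational tropical curve $h:\Gamma\to N_{\mathbb R}$ of degree $\Delta$ is a finite metric tree $\Gamma$ without vertices of valence $2$, with unbounded ends labelled by $I$, and a map $h$ that is affine with slope in $N$ on each edge, is balanced at each vertex (the outgoing slopes have sum $0$) and has slope $n_e$ on the end $e$; curves are taken up to label-preserving isomorphism. The moment of the end $e$ is $\mu_\omega(e)=\omega(n_e,x)$ for any $x\in h(e)$. At a trivalent vertex $V$ with two outgoing slopes $a_V,b_V$ put $\pi_V=\pm a_V\wedge b_V\in\Lambda^2N$. Let $K_\omega\subset\Lambda^2N$ be the subgroup spanned by those $\pi_V$ with $\omega(\pi_V)=0$, over all trivalent vertices $V$ of curves of degree $\Delta$. *The $\omega$-problem.* Given $\mu\in\mathbb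 R^{I}$ with $\sum_e\mu_e=0$ and a line $D\subset N_{\mathbb R}/\langle n_{e_0}\rangle$ whose slope is the class of some $\delta\in N$ with $\omega(n_{e_0},\delta)\ne0$, consider the curves of degree $\Delta$ with family of moments $\mu$ and $h(e_0)\in D$. Count them with multiplicity $$B_\Gamma^{K_\omega}=\prod_V(q^{\pi_V}-q^{-\pi_V})\in\mathbb Z[\Lambda^2N/K_\omega],$$ where the sign of $\pi_V$ is chosen so that $\omega(\pi_V)>0$ (the factor is $0$ if $\omega(\pi_V)=0$). *The problem $\mathcal P(\omega,e_0,(\varphi_i))$.* Given moreover affine hyperplanes $\mathcal H_i\subset N_{\mathbb R}$ of slope $\ker\varphi_i$, consider the curves of degree $\Delta\sqcup\{0^p\}$, i.e. with $p$ additional ends $1,\dots,p$ of slope $0$ (marked points), such that the ends in $I$ have family of moments $\mu$, $h(e_0)\in D$, and $h(i)\in\mathcal H_i$ for $i=1,\dots,p$. Count them with multiplicity $\prod_{i=1}^p|\varphi_i(\delta_i^\Gamma)|\,B_\Gamma^{K_\omega}$, where $\delta_i^\Gamma$ is the slope (up to sign) of $\Gamma$ at the marked point $i$ and the product defining $B_\Gamma^{K_\omega}$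 is over the vertices that carry no marked point (equivalently, for the curves that are counted, the vertices of the curve obtained by forgetting the marked points). In both problems, constraints are called generic if every solution is trivalent and is the only solution of its combinatorial type (i.e. the constraints avoid the images, under the evaluation map, of the cones of the moduli space that are not top-dimensional or on which this map is not injective). Then, for every $\delta$ as above, the generic constraints contain the complement of finitely many proper linear subspaces of the space of constraints, and for generic constraints the number of solutions is finite. The refined count of the solutions of the $\omega$-problem takes the same value $\mathcal B_\Delta^{\omega,e_0}\in\mathbb Z[\Lambda^2N/K_\omega]$ for all $\delta$ and all generic $(\mu,D)$. The refined count of the solutions of $\mathcal P(\omega,e_0,(\varphi_i))$ takes the same value for all $\delta$ and all generic $(\mu,D,(\mathcal H_i))$, and this value is $$\Big(\prod_{i=1}^p\varphi_i\cdot\Delta\Big)\,\mathcal B_\Delta^{\omega,e_0},\qquad\text{where}\quad \varphi_i\cdot\Delta=\sum_{e\in I:\ \varphi_i(n_e)>0}\varphi_i(n_e).$$ -/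

import Mathlib

open scoped TensorProduct

noncomputable section

namespace Tropical9

/-! ### Linear algebra on the lattice `N` and on `N_ℝ = ℝ ⊗ N` -/

section Lattice

variable {N : Type*} [AddCommGroup N]

/-- The vector of `N_ℝ` defined by a lattice vector. -/
def toReal (n : N) : ℝ ⊗[ℤ] N := (1 : ℝ) ⊗ₜ[ℤ] n

/-- The real bilinear form on `N_ℝ` extending an integral form. -/
def formReal (ω : LinearMap.BilinForm ℤ N) : LinearMap.BilinForm ℝ (ℝ ⊗[ℤ] N) :=
  LinearMap.BilinForm.baseChange ℝ ω

/-- The real linear form on `N_ℝ` extending an integral linear form. -/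
def dualReal (φ : Module.Dual ℤ N) : Module.Dual ℝ (ℝ ⊗[ℤ] N) :=
  Module.Dual.baseChange ℝ φ

/-- The bivector `a ∧ b ∈ Λ² N`. -/
def wedge (a b : N) : ⋀[ℤ]^2 N := exteriorPower.ιMulti ℤ 2 ![a, b]

/-- The monomial `q ^ x` of `ℤ[Λ² N / K]`, the exponent `x ∈ Λ² N` being taken modulo `K`. -/
def qPow (K : Submodule ℤ (⋀[ℤ]^2 N)) (x : ⋀[ℤ]^2 N) :
    AddMonoidAlgebra ℤ ((⋀[ℤ]^2 N) ⧸ K) :=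
  AddMonoidAlgebra.single (Submodule.Quotient.mk x) 1

/-- The intersection index `φ · Δ = ∑_{n ∈ Δ, φ(n) > 0} φ(n)`. -/
def intersectionIndex {I : Type*} [Fintype I] (φ : Module.Dual ℤ N) (Δ : I → N) : ℤ :=
  ∑ e with 0 < φ (Δ e), φ (Δ e)

end Lattice

/-! ### Parametrized rational tropical curves -/

/-- The edges adjacent to a vertex `v`, each considered as leaving `v`: the bounded ones, and the
unbounded ends (`endVertex e` is the vertex adjacent to the unbounded end `e`). -/
def EdgeFlag {V E : Type*} (G : SimpleGraph V) (endVertex : E → V) (v : V) : Type _ :=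
  {d : G.Dart // d.fst = v} ⊕ {e : E // endVertex e = v}

/-- The outgoing slope on an edge adjacent to `v`. -/
def flagSlope {V E N : Type*} {G : SimpleGraph V} {endVertex : E → V}
    (slope : G.Dart → N) (deg : E → N) {v : V} : EdgeFlag G endVertex v → N
  | .inl d => slope d.1
  | .inr e => deg e.1

/-- A parametrized rational tropical curve `h : Γ → N_ℝ` of degree `deg`, whose unbounded ends are
labelled by `E`. The bounded part of `Γ` is a finite metric tree; `h` is affine on every edge, hence
it is given by the images of the vertices and the slopes of the edges. -/
structure Curve {N E : Type*} [AddCommGroup N] (deg : E → N) where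
  /-- the vertices (of valence different from one) -/
  V : Type
  finite_V : Finite V
  /-- the bounded edges -/
  graph : SimpleGraph V
  isTree : graph.IsTree
  /-- the vertex adjacent to an unbounded end -/
  endVertex : E → V
  three_le_valence : ∀ v, 3 ≤ Nat.card (EdgeFlag graph endVertex v)
  /-- the length function on the bounded edges -/
  length : graph.edgeSet → ℝ
  length_pos : ∀ a, 0 < length a
  /-- the map `h` on the vertices -/
  h : V → ℝ ⊗[ℤ] N
  /-- the slope of `h` on each oriented bounded edge -/
  slope : graph.Dart → N
  affine : ∀ d : graph.Dart, h d.snd - h d.fst = length ⟨d.edge, d.edge_mem⟩ • toReal (slope d)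
  balanced : ∀ v, ∑ᶠ f : EdgeFlag graph endVertex v, flagSlope slope deg f = 0

namespace Curve

section General

variable {N E : Type*} [AddCommGroup N] {deg : E → N}

/-- The edges adjacent to the vertex `v`, oriented away from `v`. -/
abbrev FlagAt (Γ : Curve deg) (v : Γ.V) : Type _ := EdgeFlag Γ.graph Γ.endVertex v

/-- The outgoing slope of `h` on an edge adjacent to `v`. -/
def out (Γ : Curve deg) {v : Γ.V} (f : Γ.FlagAt v) : N := flagSlope Γ.slope deg f

def IsTrivalentAt (Γ : Curve deg) (v : Γ.V) : Prop := Nat.card (Γ.FlagAt v) = 3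

def IsTrivalent (Γ : Curve deg) : Prop := ∀ v, Γ.IsTrivalentAt v

/-- Two curves have the same combinatorial type: their labelled graphs are isomorphic. -/
def SameType (Γ Γ' : Curve deg) : Prop :=
  ∃ f : Γ.graph ≃g Γ'.graph, ∀ e, f (Γ.endVertex e) = Γ'.endVertex e

/-- Isomorphism of parametrized tropical curves with labelled unbounded ends. -/
def Isom (Γ Γ' : Curve deg) : Prop :=
  ∃ f : Γ.graph ≃g Γ'.graph, (∀ e, f (Γ.endVertex e) = Γ'.endVertex e) ∧
    (∀ a, Γ'.length (f.mapEdgeSet a) = Γ.length a) ∧ ∀ v, Γ'.h (f v) = Γ.h v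

theorem Isom.refl (Γ : Curve deg) : Isom Γ Γ :=
  ⟨RelIso.refl _, fun _ => rfl, fun a => by
    congr 1
    ext1
    simp [SimpleGraph.Iso.mapEdgeSet, SimpleGraph.Hom.mapEdgeSet], fun _ => rfl⟩

theorem Isom.symm {Γ Γ' : Curve deg} : Isom Γ Γ' → Isom Γ' Γ := by
  rintro ⟨f, h1, h2, h3⟩
  refine ⟨f.symm, fun e => ?_, fun a => ?_, fun v => ?_⟩
  · rw [← h1 e]; exact f.symm_apply_apply _
  · have := h2 (f.symm.mapEdgeSet a)
    rw [← this]
    congr 1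
    exact (f.mapEdgeSet.apply_symm_apply a)
  · rw [← h3]; exact congrArg _ (f.apply_symm_apply v)

theorem Isom.trans {Γ Γ' Γ'' : Curve deg} : Isom Γ Γ' → Isom Γ' Γ'' → Isom Γ Γ'' := by
  rintro ⟨f, h1, h2, h3⟩ ⟨g, k1, k2, k3⟩
  refine ⟨f.trans g, fun e => ?_, fun a => ?_, fun v => ?_⟩
  · rw [← k1, ← h1]; rfl
  · rw [← h2, ← k2]
    congr 1
    ext1
    simp only [SimpleGraph.Iso.mapEdgeSet, SimpleGraph.Hom.mapEdgeSet, Equiv.coe_fn_mk,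
      Sym2.map_map]
    rfl
  · rw [← h3, ← k3]; rfl

instance setoid (deg : E → N) : Setoid (Curve deg) :=
  ⟨Isom, Isom.refl, Isom.symm, Isom.trans⟩

/-- The moduli space of parametrized rational tropical curves of degree `deg`. -/
def Moduli (deg : E → N) : Type _ := Quotient (setoid deg)

/-- The isomorphism classes of the curves belonging to `S`. -/
def classes (S : Set (Curve deg)) : Set (Moduli deg) := (Quotient.mk (setoid deg)) '' S

/-- The sum of the multiplicities `m` of the curves of `S`, counted up to isomorphism. -/
def count {R : Type*} [AddCommMonoid R] (S : Set (Curve deg)) (m : Curve deg → R) : R :=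
  ∑ᶠ c ∈ classes S, m (Quotient.out c)

/-- Let `S` be the set of solutions of an enumerative problem, i.e. a fibre of an evaluation map,
which is linear on the cone (open orthant times `N_ℝ`) of each combinatorial type. The constraints
are generic if they avoid the images of the cones that are not top-dimensional (i.e. of the types
that are not trivalent) and of the cones on which the evaluation map is not injective. By linearity,
the map is injective on a cone if and only if one nonempty fibre in this cone is a point. -/
def IsGenericFibre (S : Set (Curve deg)) : Prop :=
  ∀ Γ ∈ S, Γ.IsTrivalent ∧ ∀ Γ' ∈ S, SameType Γ Γ' → Isom Γ Γ'

theorem exists_flag_ne (Γ : Curve deg) (v : Γ.V) : ∃ f g : Γ.FlagAt v, f ≠ g := by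
  have h := Γ.three_le_valence v
  have : Finite (Γ.FlagAt v) := Nat.finite_of_card_ne_zero (by unfold FlagAt; omega)
  have : Nontrivial (Γ.FlagAt v) := by
    rw [← Finite.one_lt_card_iff_nontrivial]; unfold FlagAt; omega
  exact exists_pair_ne _

theorem exists_flag_ne_end (Γ : Curve deg) (e : E) :
    ∃ f : Γ.FlagAt (Γ.endVertex e), f ≠ .inr ⟨e, rfl⟩ := by
  obtain ⟨f, g, hfg⟩ := Γ.exists_flag_ne (Γ.endVertex e)
  by_cases h : f = .inr ⟨e, rfl⟩
  · exact ⟨g, fun hg => hfg (h.trans hg.symm)⟩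
  · exact ⟨f, h⟩

/-- `a_V`: the outgoing slope on one of the edges adjacent to `v`. -/
def slopeA (Γ : Curve deg) (v : Γ.V) : N := Γ.out (Γ.exists_flag_ne v).choose

/-- `b_V`: the outgoing slope on another edge adjacent to `v`. -/
def slopeB (Γ : Curve deg) (v : Γ.V) : N := Γ.out (Γ.exists_flag_ne v).choose_spec.choose

/-- The slope `δ_e` of the curve at a marked point `e` (an unbounded end of slope zero), defined up
to sign when the adjacent vertex is trivalent: the slope on another edge adjacent to this vertex. -/
def slopeAtMark (Γ : Curve deg) (e : E) : N := Γ.out (Γ.exists_flag_ne_end e).choose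

/-- The factor `q ^ π_V - q ^ (-π_V)` of a trivalent vertex `V`, where `π_V = ± a_V ∧ b_V` has the
sign such that `ω(π_V) > 0`. If `ω(π_V) = 0` the factor is `0` (then `π_V ∈ K_ω`). -/
def vertexFactor (ω : LinearMap.BilinForm ℤ N) (K : Submodule ℤ (⋀[ℤ]^2 N)) (Γ : Curve deg)
    (v : Γ.V) : AddMonoidAlgebra ℤ ((⋀[ℤ]^2 N) ⧸ K) :=
  if 0 < ω (Γ.slopeA v) (Γ.slopeB v) then
    qPow K (wedge (Γ.slopeA v) (Γ.slopeB v)) - qPow K (-wedge (Γ.slopeA v) (Γ.slopeB v))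
  else if ω (Γ.slopeA v) (Γ.slopeB v) < 0 then
    qPow K (-wedge (Γ.slopeA v) (Γ.slopeB v)) - qPow K (wedge (Γ.slopeA v) (Γ.slopeB v))
  else 0

/-- The refined multiplicity: the product of the factors of the vertices that carry no marked point,
i.e. no unbounded end of slope zero. If the degree has no zero vector these are all the vertices; in
general these are the vertices of the curve obtained by forgetting the marked points (of a trivalent
curve in which no two marked points are adjacent to the same vertex). -/
def refinedMult (ω : LinearMap.BilinForm ℤ N) (K : Submodule ℤ (⋀[ℤ]^2 N)) (Γ : Curve deg) :
    AddMonoidAlgebra ℤ ((⋀[ℤ]^2 N) ⧸ K) :=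
  ∏ᶠ v ∈ {v : Γ.V | ∀ e, deg e = 0 → Γ.endVertex e ≠ v}, vertexFactor ω K Γ v

/-- The moment `ω(n_e, p)`, `p ∈ h(e)`, of an unbounded end `e`. -/
def moment (ω : LinearMap.BilinForm ℤ N) (Γ : Curve deg) (e : E) : ℝ :=
  formReal ω (toReal (deg e)) (Γ.h (Γ.endVertex e))

end General

end Curve

/-! ### The `ω`-problem, without and with marked points -/

section Problem

variable {N I : Type*} [AddCommGroup N] [Fintype I]

/-- `K_ω`, spanned by the bivectors `π_V` with `ω(π_V) = 0` of all the trivalent vertices `V`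
occurring in rational tropical curves of degree `Δ`. -/
def kerSpan (Δ : I → N) (ω : LinearMap.BilinForm ℤ N) : Submodule ℤ (⋀[ℤ]^2 N) :=
  Submodule.span ℤ {x | ∃ (Γ : Curve Δ) (v : Γ.V) (f g : Γ.FlagAt v), Γ.IsTrivalentAt v ∧ f ≠ g ∧
    ω (Γ.out f) (Γ.out g) = 0 ∧ x = wedge (Γ.out f) (Γ.out g)}

/-- The ring `ℤ[Λ² N / K_ω]`. -/
abbrev RefinedRing (Δ : I → N) (ω : LinearMap.BilinForm ℤ N) : Type _ :=
  AddMonoidAlgebra ℤ ((⋀[ℤ]^2 N) ⧸ kerSpan Δ ω)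

/-- The space `𝔐` of families of moments: real families with sum zero. -/
def momentSpace (I : Type*) [Fintype I] : Submodule ℝ (I → ℝ) where
  carrier := {μ | ∑ e, μ e = 0}
  add_mem' := by
    intro a b ha hb
    simp only [Set.mem_ofPred_eq] at ha hb ⊢
    simp [Finset.sum_add_distrib, ha, hb]
  zero_mem' := by simp
  smul_mem' := by
    intro c x hx
    simp only [Set.mem_ofPred_eq] at hx ⊢
    simp [← Finset.mul_sum, hx]

/-- The line `D ⊂ N_ℝ / ⟨n⟩` through the class of `x`, with slope the class of `δ`. -/
def lineD (n δ : N) (x : ℝ ⊗[ℤ] N) :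
    AffineSubspace ℝ ((ℝ ⊗[ℤ] N) ⧸ Submodule.span ℝ {toReal n}) :=
  AffineSubspace.mk' (Submodule.Quotient.mk x)
    (Submodule.span ℝ {Submodule.Quotient.mk (toReal δ)})

/-- The curves `h : Γ → N_ℝ` of degree `Δ` with family of moments `μ` and with `h(e₀) ∈ D`, where
`D` is the line through `x` with slope `δ`. -/
def omegaSolutions (Δ : I → N) (ω : LinearMap.BilinForm ℤ N) (e₀ : I) (δ : N)
    (c : momentSpace I × (ℝ ⊗[ℤ] N)) : Set (Curve Δ) :=
  {Γ | (∀ e, Γ.moment ω e = c.1.1 e) ∧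
    Submodule.Quotient.mk (Γ.h (Γ.endVertex e₀)) ∈ lineD (Δ e₀) δ c.2}

/-- The degree `Δ ⊔ {0^p}`; the marked points are the ends `Sum.inr i`. -/
def markedDegree (Δ : I → N) (p : ℕ) : I ⊕ Fin p → N := Sum.elim Δ fun _ => 0

/-- The curves of degree `Δ ⊔ {0^p}` with moments `μ` on the ends of `Δ`, with `h(e₀) ∈ D`, and with
the marked point `i` on the affine hyperplane `H_i = {φ_i = c_i}`; here `c = (μ, x, (c_i))`. -/
def markedSolutions (Δ : I → N) (ω : LinearMap.BilinForm ℤ N) (e₀ : I) {p : ℕ}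
    (φ : Fin p → Module.Dual ℤ N) (δ : N)
    (c : momentSpace I × (ℝ ⊗[ℤ] N) × (Fin p → ℝ)) : Set (Curve (markedDegree Δ p)) :=
  {Γ | (∀ e, Γ.moment ω (Sum.inl e) = c.1.1 e) ∧
    Submodule.Quotient.mk (Γ.h (Γ.endVertex (Sum.inl e₀))) ∈ lineD (Δ e₀) δ c.2.1 ∧
    ∀ i, dualReal (φ i) (Γ.h (Γ.endVertex (Sum.inr i))) = c.2.2 i}

/-- The refined multiplicity `∏ᵢ |φᵢ(δᵢ)| · B_Γ` of a curve with marked points. -/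
def markedMult (Δ : I → N) (ω : LinearMap.BilinForm ℤ N) {p : ℕ} (φ : Fin p → Module.Dual ℤ N)
    (Γ : Curve (markedDegree Δ p)) : RefinedRing Δ ω :=
  (∏ i, |φ i (Γ.slopeAtMark (Sum.inr i))|) • Γ.refinedMult ω (kerSpan Δ ω)

/-- The property `P` holds outside finitely many proper linear subspaces. -/
def HoldsGenerically {W : Type*} [AddCommGroup W] [Module ℝ W] (P : W → Prop) : Prop :=
  ∃ S : Set (Submodule ℝ W), S.Finite ∧ (∀ U ∈ S, U ≠ ⊤) ∧ ∀ w, (∀ U ∈ S, w ∉ U) → P w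

/-- `B` is the invariant of the `ω`-problem: whatever the slope `δ` of `D`, almost all constraints
are generic, and for all generic constraints there are finitely many solutions and their count with
refined multiplicity is `B`. -/
def IsOmegaInvariant (Δ : I → N) (ω : LinearMap.BilinForm ℤ N) (e₀ : I) (B : RefinedRing Δ ω) :
    Prop :=
  ∀ δ : N, ω (Δ e₀) δ ≠ 0 →
    HoldsGenerically (fun c => Curve.IsGenericFibre (omegaSolutions Δ ω e₀ δ c)) ∧
    ∀ c, Curve.IsGenericFibre (omegaSolutions Δ ω e₀ δ c) →
      (Curve.classes (omegaSolutions Δ ω e₀ δ c)).Finite ∧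
      Curve.count (omegaSolutions Δ ω e₀ δ c) (Curve.refinedMult ω (kerSpan Δ ω)) = B

/-- `B` is the invariant of the `ω`-problem with additional marked points on hyperplanes of slopes
`ker φ_i`, counted with multiplicity `markedMult`. -/
def IsMarkedInvariant (Δ : I → N) (ω : LinearMap.BilinForm ℤ N) (e₀ : I) {p : ℕ}
    (φ : Fin p → Module.Dual ℤ N) (B : RefinedRing Δ ω) : Prop :=
  ∀ δ : N, ω (Δ e₀) δ ≠ 0 →
    HoldsGenerically (fun c => Curve.IsGenericFibre (markedSolutions Δ ω e₀ φ δ c)) ∧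
    ∀ c, Curve.IsGenericFibre (markedSolutions Δ ω e₀ φ δ c) →
      (Curve.classes (markedSolutions Δ ω e₀ φ δ c)).Finite ∧
      Curve.count (markedSolutions Δ ω e₀ φ δ c) (markedMult Δ ω φ) = B

end Problem

end Tropical9

end

/-!
# Refined counts of rational tropical curves in the `ω`-problem

Root a curve at the end `e₀`. The position of the line of `e₀` is fixed by `D` and by the moment of
`e₀` (`mem_lineD_and_moment_iff`); take a base point `y` on it. By the balancing condition the slope
of the edge below a vertex is the sum `n_A` of the slopes of the ends in the set `A` above it, so a
curve is a laminar family of sets of ends together with a length `ℓ_A` for each of them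
(`Curve.exists_lengths`, `IsLaminar.exists_curve`). The constraints become the linear equations
`m_e = ∑_{A ∋ e} ℓ_A Λ(e, A)`, where `m_e` is the given moment relative to `y` and `Λ(e, f)` is
`ω(n_e, n_f)`, or `φ_e(n_f)` for a marked point `e` (`Curve.exists_lengths_of_mem_solutions`).
A family with the maximal number of members belongs to a trivalent curve, and the types for which
the equations do not have full rank only meet finitely many proper subspaces
(`holdsGenerically_solutions`).

The trivalent types are the binary trees whose leaves are the other ends. Starting from `y` and
moving along the root edge, the moments change linearly in time. The time at which a curve can divide
into the ends `A` and `B` is the one at which the moments of `A` (if there are marked points, of its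
unmarked ends) have the sum zero, and a marked point can be put on the curve when its own moment is
zero. Hence all the lengths are forced, and the count is a sum over the trees for which they are
positive (`exists_solution_of_tree`).

This sum over trees is evaluated in closed form. Consider the state consisting of the signs of the
moments of all blocks of ends. The resolvent sum `flowSum` attaches to a state a ring element such
that a change of state multiplies out over the two parts of each interval (`flowSum_sub`), and that
the state at the time `+∞` has the value zero (`flowSum_self`). A marked point is taken into account
by the factor `markFactor`, which changes by `|φ(δ)|` at the time at which its moment vanishes. So
the jumps of the product of the resolvent sum and the mark factors are precisely the contributions
of the possible divisions, and the sum of the jumps telescopes (`flow_telescope`). By induction on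
the number of ends, the trees growing from a base point are counted by this product (`hasClosedForm`).
For the root edge, which is unbounded, the time runs from `-∞`, and the sum is the value of the
product for the state at `-∞`, which is given by the signs of `ω(n_A, n_B)` and does not depend on
the constraints (`sum_rootWeight_eq`). The factor of a mark at `-∞` is the sum of the `φ(n_e)` over
the positive ones (`markFactor_eq_intersectionIndex`).

The telescoping requires that the pairing of two blocks never vanishes and that the moments satisfy no
accidental relation. Both are achieved by a small perturbation, under which the finitely many trees
keep their weights (`sum_rootWeight_eq_of_regular`). The perturbation chooses signs for the blocks
with `ω(n_A, n_B) = 0`; the choice is irrelevant as `n_A ∧ n_B` belongs to `K_ω`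
(`wedge_degSum_mem_kerSpan`), so that the factor of the corresponding vertex is zero for either sign.
-/

open scoped TensorProduct
set_option linter.unusedSectionVars false
noncomputable section
namespace Tropical9

/-! ### Resolvent sums over intervals of finite sets -/

section Resolvent

variable {E R : Type*} [DecidableEq E] [CommRing R]

theorem card_sdiff_lt_of_mem_Ioo {X Y Z : Finset E} (h : Z ∈ Finset.Ioo X Y) :
    (Z \ X).card < (Y \ X).card ∧ (Y \ Z).card < (Y \ X).card := by
  rw [Finset.mem_Ioo] at h
  obtain ⟨h1, h2⟩ := h
  have h3 : Z ⊆ Y := h2.le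
  have h4 : X ⊆ Z := h1.le
  have e1 := Finset.card_sdiff_of_subset h3
  have e2 := Finset.card_sdiff_of_subset h4
  have e3 := Finset.card_sdiff_of_subset (h4.trans h3)
  have c1 := Finset.card_lt_card h1
  have c2 := Finset.card_lt_card h2
  omega

/-- The resolvent sum of the interval `[X, Y]` of finite sets for the state `ε`. It is determined by
the recursion `∑_Z (ε Z - e X Y Z) Q X Z Y · (sum of [X, Z] for ε) · (sum of [Z, Y] for e X Y)` over
the intermediate sets `Z`, and by the value `1` if `Y \ X` has at most one element. The reference
state `e X Y` is the one for which the sum of `[X, Y]` vanishes. The three arguments of `Q`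
increase, but those of `e` are the two ends of the interval followed by the intermediate set. -/
def flowSum (Q : Finset E → Finset E → Finset E → R) (e : Finset E → Finset E → Finset E → R)
    (X Y : Finset E) (ε : Finset E → R) : R :=
  if (Y \ X).card ≤ 1 then 1 else
    ∑ Z : {Z // Z ∈ Finset.Ioo X Y}, (ε Z.1 - e X Y Z.1) * Q X Z.1 Y *
      flowSum Q e X Z.1 ε * flowSum Q e Z.1 Y (e X Y)
termination_by (Y \ X).card
decreasing_by
  · exact (card_sdiff_lt_of_mem_Ioo Z.2).1
  · exact (card_sdiff_lt_of_mem_Ioo Z.2).2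

variable (Q : Finset E → Finset E → Finset E → R) (e : Finset E → Finset E → Finset E → R)

theorem flowSum_of_card_le_one {X Y : Finset E} (h : (Y \ X).card ≤ 1) (ε : Finset E → R) :
    flowSum Q e X Y ε = 1 := by
  rw [flowSum, if_pos h]

theorem flowSum_of_one_lt_card {X Y : Finset E} (h : 1 < (Y \ X).card) (ε : Finset E → R) :
    flowSum Q e X Y ε = ∑ Z ∈ Finset.Ioo X Y, (ε Z - e X Y Z) * Q X Z Y *
      flowSum Q e X Z ε * flowSum Q e Z Y (e X Y) := by
  rw [flowSum, if_neg (by omega)]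
  exact Finset.sum_coe_sort (Finset.Ioo X Y) fun Z => (ε Z - e X Y Z) * Q X Z Y *
      flowSum Q e X Z ε * flowSum Q e Z Y (e X Y)

theorem flowSum_self {X Y : Finset E} (h : 1 < (Y \ X).card) :
    flowSum Q e X Y (e X Y) = 0 := by
  rw [flowSum_of_one_lt_card Q e h]
  exact Finset.sum_eq_zero fun Z _ => by simp

/-- The recursion defining `flowSum`, in which `ε'` is the reference state `e X Y`, is valid for an
arbitrary second state. -/
theorem flowSum_sub (hQ : ∀ X Z Z' Y, X ⊂ Z → Z ⊂ Z' → Z' ⊂ Y →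
      Q X Z Y * Q Z Z' Y = Q X Z' Y * Q X Z Z')
    (X Y : Finset E) (ε ε' : Finset E → R) :
    flowSum Q e X Y ε - flowSum Q e X Y ε' =
      ∑ Z ∈ Finset.Ioo X Y, (ε Z - ε' Z) * Q X Z Y * flowSum Q e X Z ε * flowSum Q e Z Y ε' := by
  induction hn : (Y \ X).card using Nat.strong_induction_on generalizing X Y ε ε' with
  | _ n ih =>
  by_cases h1 : (Y \ X).card ≤ 1
  · rw [flowSum_of_card_le_one Q e h1, flowSum_of_card_le_one Q e h1, sub_self]
    symm
    apply Finset.sum_eq_zero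
    intro Z hZ
    have := card_sdiff_lt_of_mem_Ioo hZ
    have h0 : (Z \ X).card = 0 := by omega
    rw [Finset.card_eq_zero, Finset.sdiff_eq_empty_iff_subset] at h0
    exact absurd h0 (Finset.mem_Ioo.1 hZ).1.2
  push Not at h1
  set d := e X Y with hd
  have key : ∑ Z ∈ Finset.Ioo X Y, (ε Z - ε' Z) * Q X Z Y * flowSum Q e X Z ε * flowSum Q e Z Y ε'
      = ∑ Z ∈ Finset.Ioo X Y, (ε Z - ε' Z) * Q X Z Y * flowSum Q e X Z ε * flowSum Q e Z Y d
      + ∑ W ∈ Finset.Ioo X Y, (ε' W - d W) * Q X W Y *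
          (flowSum Q e X W ε - flowSum Q e X W ε') * flowSum Q e W Y d := by
    have a1 : ∀ Z ∈ Finset.Ioo X Y,
        (ε Z - ε' Z) * Q X Z Y * flowSum Q e X Z ε * flowSum Q e Z Y ε' =
        (ε Z - ε' Z) * Q X Z Y * flowSum Q e X Z ε * flowSum Q e Z Y d +
        ∑ W ∈ Finset.Ioo Z Y, (ε Z - ε' Z) * Q X Z Y * flowSum Q e X Z ε *
          ((ε' W - d W) * Q Z W Y * flowSum Q e Z W ε' * flowSum Q e W Y d) := by
      intro Z hZ
      have := ih _ (hn ▸ (card_sdiff_lt_of_mem_Ioo hZ).2) Z Y ε' d rfl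
      rw [← Finset.mul_sum, ← this]
      ring
    have a2 : ∀ W ∈ Finset.Ioo X Y, (ε' W - d W) * Q X W Y *
          (flowSum Q e X W ε - flowSum Q e X W ε') * flowSum Q e W Y d =
        ∑ Z ∈ Finset.Ioo X W, (ε Z - ε' Z) * Q X Z Y * flowSum Q e X Z ε *
          ((ε' W - d W) * Q Z W Y * flowSum Q e Z W ε' * flowSum Q e W Y d) := by
      intro W hW
      rw [ih _ (hn ▸ (card_sdiff_lt_of_mem_Ioo hW).1) X W ε ε' rfl, Finset.mul_sum, Finset.sum_mul]
      refine Finset.sum_congr rfl fun Z hZ => ?_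
      have h2 := hQ X Z W Y (Finset.mem_Ioo.1 hZ).1 (Finset.mem_Ioo.1 hZ).2 (Finset.mem_Ioo.1 hW).2
      linear_combination (-(ε' W - d W) * (ε Z - ε' Z) * flowSum Q e X Z ε *
        flowSum Q e Z W ε' * flowSum Q e W Y d) * h2
    rw [Finset.sum_congr rfl a1, Finset.sum_congr rfl a2, Finset.sum_add_distrib]
    congr 1
    apply Finset.sum_comm'
    intro Z W
    simp only [Finset.mem_Ioo]
    constructor
    · rintro ⟨⟨p1, p2⟩, p3, p4⟩; exact ⟨⟨p1, p3⟩, p1.trans p3, p4⟩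
    · rintro ⟨⟨p1, p3⟩, p2, p4⟩; exact ⟨⟨p1, p3.trans p4⟩, p3, p4⟩
  rw [key, flowSum_of_one_lt_card Q e h1 ε, flowSum_of_one_lt_card Q e h1 ε', ← hd,
    ← Finset.sum_add_distrib, ← Finset.sum_sub_distrib]
  refine Finset.sum_congr rfl fun Z _ => ?_
  ring

theorem flowSum_congr (hQ : ∀ X Z Z' Y, X ⊂ Z → Z ⊂ Z' → Z' ⊂ Y →
      Q X Z Y * Q Z Z' Y = Q X Z' Y * Q X Z Z')
    {X Y : Finset E} {ε ε' : Finset E → R} (h : ∀ Z ∈ Finset.Ioo X Y, ε Z = ε' Z) :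
    flowSum Q e X Y ε = flowSum Q e X Y ε' := by
  rw [← sub_eq_zero, flowSum_sub Q e hQ]
  exact Finset.sum_eq_zero fun Z hZ => by rw [h Z hZ]; ring

end Resolvent

/-- A function of the subsets of `U` changes from `∅` to `U` in steps, one for each element in
increasing order. -/
theorem sum_telescope {A : Type*} [AddCommGroup A] (Φ : Finset ℝ → A) (U : Finset ℝ) :
    Φ ∅ - Φ U = ∑ τ ∈ U, (Φ (U.filter (· < τ)) - Φ (U.filter (· ≤ τ))) := by
  induction U using Finset.induction_on_max with
  | empty => simp
  | insert a s h ih =>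
    have ha : a ∉ s := fun h' => lt_irrefl _ (h a h')
    rw [Finset.sum_insert ha]
    have h1 : (insert a s).filter (· < a) = s := by
      ext x; simp only [Finset.mem_filter, Finset.mem_insert]
      exact ⟨fun hx => hx.1.resolve_left hx.2.ne, fun hx => ⟨.inr hx, h x hx⟩⟩
    have h2 : (insert a s).filter (· ≤ a) = insert a s := by
      ext x; simp only [Finset.mem_filter, Finset.mem_insert, and_iff_left_iff_imp]
      rintro (rfl | hx); exacts [le_rfl, (h x hx).le]
    have h3 : ∀ τ ∈ s, (insert a s).filter (· < τ) = s.filter (· < τ) := fun τ hτ => by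
      rw [Finset.filter_insert, if_neg (h τ hτ).le.not_gt]
    have h4 : ∀ τ ∈ s, (insert a s).filter (· ≤ τ) = s.filter (· ≤ τ) := fun τ hτ => by
      rw [Finset.filter_insert, if_neg (h τ hτ).not_ge]
    rw [h1, h2, Finset.sum_congr rfl fun τ hτ => by rw [h3 τ hτ, h4 τ hτ], ← ih]
    abel


/-! ### Flows of generic weights -/

section Flow

variable {E R : Type*} [DecidableEq E] [CommRing R]

/-- The pairing `∑_{e ∈ A, f ∈ B} Λ(e, f)` of two blocks of ends. For unmarked ends it is
`ω(n_A, n_B)`, where `n_A` is the sum of the slopes of the ends in `A`. -/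
def blockSum (Λ : E → E → ℝ) (A B : Finset E) : ℝ := ∑ e ∈ A, ∑ f ∈ B, Λ e f

/-- The moments after a displacement of the base point by `τ` times the sum of the slopes of the
ends in `S`. -/
def push (Λ : E → E → ℝ) (S : Finset E) (τ : ℝ) (m : E → ℝ) : E → ℝ :=
  fun e => m e - τ * ∑ f ∈ S, Λ e f

/-- The time `τ` at which the moments of the ends in `A` get the sum zero, when the base point moves
with the sum of the slopes of `S ⊇ A` as velocity. This is meaningful if `blockSum Λ A S ≠ 0`. -/
def splitTime (Λ : E → E → ℝ) (m : E → ℝ) (A S : Finset E) : ℝ := (∑ e ∈ A, m e) / blockSum Λ A S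

/-- Up to a factor, `∑_{e ∈ S} m e` is the only nontrivial linear combination with coefficients in
`K` of the moments of the ends in `S` and in `M` that may vanish. -/
def IsGeneric (K : Subfield ℝ) (S M : Finset E) (m : E → ℝ) : Prop :=
  ∀ a : E → ℝ, (∀ e, a e ∈ K) → ∑ e ∈ S, a e * m e + ∑ i ∈ M, a i * m i = 0 →
    (∀ i ∈ M, a i = 0) ∧ ∀ e ∈ S, ∀ f ∈ S, a e = a f

open Classical in
/-- The indicator of a proposition, with values in the ring `R`. -/
def ind (R : Type*) [CommRing R] (p : Prop) : R := if p then 1 else 0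

open Classical in
/-- The weighted number of positions of the mark `i` on a curve with the ends `S`. Here `a i e` is
the value of the linear form of `i` on the slope of the end `e`, and the proposition `p` says on
which side of the hyperplane of `i` the root of the curve lies; it is either the sum of the positive
`a i e`, or the sum of the absolute values of the negative ones. -/
def markFactor (a : E → E → ℤ) (S : Finset E) (i : E) (p : Prop) : ℤ :=
  ∑ e ∈ S, max (a i e) 0 - if p then ∑ e ∈ S, a i e else 0

/-- The state of `[X, Y]` at the time `+∞`: after a long displacement with the slope of `Y \ X` as
velocity, the sign of the moment of `Z \ X` is that of the pairing of `Y \ Z` with `Z \ X`. -/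
def finalState (R : Type*) [CommRing R] (pos : Finset E → Finset E → Prop) (X Y Z : Finset E) : R :=
  ind R (pos (Y \ Z) (Z \ X))

/-- The resolvent sum for the state defined by the signs of the moments `m`. It is the weighted
number of trees with the set of ends `Y \ X`, without marks, if the moments `m` are generic. -/
def flowAt (Q : Finset E → Finset E → Finset E → R) (pos : Finset E → Finset E → Prop)
    (X Y : Finset E) (m : E → ℝ) : R :=
  flowSum Q (finalState R pos) X Y fun Z => ind R (0 < ∑ e ∈ Z \ X, m e)

theorem sum_push (Λ : E → E → ℝ) (A S : Finset E) (τ : ℝ) (m : E → ℝ) :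
    ∑ e ∈ A, push Λ S τ m e = ∑ e ∈ A, m e - τ * blockSum Λ A S := by
  simp [push, blockSum, Finset.sum_sub_distrib, Finset.mul_sum]

theorem blockSum_mem (K : Subfield ℝ) {Λ : E → E → ℝ} (hK : ∀ e f, Λ e f ∈ K) (A B : Finset E) :
    blockSum Λ A B ∈ K :=
  sum_mem fun e _ => sum_mem fun f _ => hK e f

theorem blockSum_swap {Λ : E → E → ℝ} {A B : Finset E} (h : ∀ e ∈ A, ∀ f ∈ B, Λ e f = -Λ f e) :
    blockSum Λ A B = -blockSum Λ B A := by
  unfold blockSum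
  rw [Finset.sum_comm (s := B), ← Finset.sum_neg_distrib]
  refine Finset.sum_congr rfl fun e he => ?_
  rw [← Finset.sum_neg_distrib]
  exact Finset.sum_congr rfl fun f hf => h e he f hf

theorem blockSum_self {Λ : E → E → ℝ} {A : Finset E} (h : ∀ e ∈ A, ∀ f ∈ A, Λ e f = -Λ f e) :
    blockSum Λ A A = 0 := by
  have := blockSum_swap h
  linarith

theorem blockSum_union_left (Λ : E → E → ℝ) {A B : Finset E} (C : Finset E) (h : Disjoint A B) :
    blockSum Λ (A ∪ B) C = blockSum Λ A C + blockSum Λ B C := Finset.sum_union h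

theorem blockSum_union_right (Λ : E → E → ℝ) (A : Finset E) {B C : Finset E} (h : Disjoint B C) :
    blockSum Λ A (B ∪ C) = blockSum Λ A B + blockSum Λ A C := by
  unfold blockSum
  rw [← Finset.sum_add_distrib]
  exact Finset.sum_congr rfl fun e _ => Finset.sum_union h

theorem ind_congr {p q : Prop} (h : p ↔ q) : ind R p = ind R q := by rw [propext h]

theorem markFactor_congr (a : E → E → ℤ) (S : Finset E) (i : E) {p q : Prop}
    (h : ∑ e ∈ S, a i e ≠ 0 → (p ↔ q)) : markFactor a S i p = markFactor a S i q := by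
  by_cases h0 : ∑ e ∈ S, a i e = 0
  · simp [markFactor, h0]
  · rw [propext (h h0)]

/-- Two linear conditions on a nested pair of blocks are never met at the same time. -/
theorem IsGeneric.splitTime_ne {K : Subfield ℝ} {Λ : E → E → ℝ} (hK : ∀ e f, Λ e f ∈ K)
    {S M : Finset E} {m : E → ℝ} (hg : IsGeneric K S M m) {A B : Finset E} (hAB : A ⊂ B) (hBS : B ⊂ S)
    (hA : blockSum Λ A S ≠ 0) (hB : blockSum Λ B S ≠ 0)
    (hMS : Disjoint S M) : splitTime Λ m A S ≠ splitTime Λ m B S := by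
  intro h
  unfold splitTime at h
  rw [div_eq_div_iff hA hB] at h
  obtain ⟨x, hxB, hxA⟩ := Finset.exists_of_ssubset hAB
  obtain ⟨y, hyS, hyB⟩ := Finset.exists_of_ssubset hBS
  have hxS := hBS.1 hxB
  have hyA : y ∉ A := fun h => hyB (hAB.1 h)
  have := (hg (fun e => (if e ∈ A then blockSum Λ B S else 0) - (if e ∈ B then blockSum Λ A S else 0))
    (fun e => by
      have h1 := blockSum_mem K hK A S
      have h2 := blockSum_mem K hK B S
      refine K.sub_mem ?_ ?_ <;> split_ifs <;> first | assumption | exact K.zero_mem) ?_).2 x hxS y hyS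
  · simp only [hxA, hxB, hyA, hyB, if_true, if_false] at this
    apply hA; linarith
  · have hM : ∀ i ∈ M, i ∉ A ∧ i ∉ B := fun i hi =>
      ⟨fun h => Finset.disjoint_left.1 hMS (hBS.1 (hAB.1 h)) hi,
        fun h => Finset.disjoint_left.1 hMS (hBS.1 h) hi⟩
    rw [Finset.sum_eq_zero (s := M) (fun i hi => by simp [hM i hi])]
    simp only [sub_mul, ite_mul, zero_mul, Finset.sum_sub_distrib, Finset.sum_ite_mem,
      Finset.inter_eq_right.2 hBS.1, Finset.inter_eq_right.2 (hAB.1.trans hBS.1), ← Finset.mul_sum]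
    linarith

/-- The moment of a mark does not vanish together with the one of a block or of another mark. -/
theorem IsGeneric.splitTime_ne_mark {K : Subfield ℝ} {Λ : E → E → ℝ} (hK : ∀ e f, Λ e f ∈ K)
    {S M : Finset E} {m : E → ℝ} (hg : IsGeneric K S M m) {B : Finset E} {i : E} (hi : i ∈ M)
    (hiB : i ∉ B) (hB' : B ⊆ S ∨ B ⊆ M) (hiL : blockSum Λ {i} S ≠ 0) (hB : blockSum Λ B S ≠ 0)
    (hMS : Disjoint S M) : splitTime Λ m {i} S ≠ splitTime Λ m B S := by
  intro h
  unfold splitTime at h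
  rw [div_eq_div_iff hiL hB] at h
  have := (hg (fun e => (if e ∈ ({i} : Finset E) then blockSum Λ B S else 0) -
      (if e ∈ B then blockSum Λ {i} S else 0))
    (fun e => by
      have h1 := blockSum_mem K hK {i} S
      have h2 := blockSum_mem K hK B S
      refine K.sub_mem ?_ ?_ <;> split_ifs <;> first | assumption | exact K.zero_mem) ?_).1 i hi
  · simp only [hiB, Finset.mem_singleton, if_true, if_false] at this
    apply hB; linarith
  · have hiS : i ∉ S := fun h => Finset.disjoint_left.1 hMS h hi
    have h1 : S ∩ {i} = ∅ := by simp [hiS]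
    have h2 : M ∩ {i} = {i} := by simp [hi]
    simp only [sub_mul, ite_mul, zero_mul, Finset.sum_sub_distrib, Finset.sum_ite_mem, h1, h2, ← Finset.mul_sum]
    rcases hB' with hB' | hB'
    · have h3 : M ∩ B = ∅ := by
        rw [← Finset.disjoint_iff_inter_eq_empty]; exact (hMS.mono_left hB').symm
      rw [h3, Finset.inter_eq_right.2 hB']; simp at h ⊢; linarith
    · have h3 : S ∩ B = ∅ := by
        rw [← Finset.disjoint_iff_inter_eq_empty]; exact (hMS.mono_right hB')
      rw [h3, Finset.inter_eq_right.2 hB']; simp at h ⊢; linarith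

end Flow


/-! ### The telescoping formula -/

section Flow

variable {E R : Type*} [DecidableEq E] [CommRing R]

open Classical in
/-- While the base point moves, the state of `[X, Y]` jumps at the times at which the moment of a
block `Z \ X` or of a mark vanishes; by `flowSum_sub`, a jump contributes the product of the sums of
the two intervals `[X, Z]` and `[Z, Y]`. The sum of the jumps at the active times is the difference between the
first and the last state, and the latter contributes zero. -/
theorem flow_telescope {Q : Finset E → Finset E → Finset E → R}
    (hQ : ∀ X Z Z' Y, X ⊂ Z → Z ⊂ Z' → Z' ⊂ Y → Q X Z Y * Q Z Z' Y = Q X Z' Y * Q X Z Z')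
    {pos : Finset E → Finset E → Prop} {Λ : E → E → ℝ} {a : E → E → ℤ} {K : Subfield ℝ}
    (hK : ∀ e f, Λ e f ∈ K) {X Y M : Finset E} (hYM : Disjoint Y M)
    (hanti : ∀ e ∈ Y, ∀ f ∈ Y, Λ e f = -Λ f e)
    (hpos : ∀ A B, A ⊆ Y → B ⊆ Y → A.Nonempty → B.Nonempty → Disjoint A B →
      blockSum Λ A B ≠ 0 ∧ (pos A B ↔ 0 < blockSum Λ A B))
    (ha : ∀ i ∈ M, ∀ e, Λ i e = a i e)
    (hcard : 1 < (Y \ X).card ∨ (Y \ X).card = 1 ∧ M.Nonempty) {m : E → ℝ}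
    (hgen : IsGeneric K (Y \ X) M m)
    (act : ℝ → Prop) (hact : ∀ s t, act s → s ≤ t → act t) :
    flowSum Q (finalState R pos) X Y (fun Z => ind R (if act (splitTime Λ m (Z \ X) (Y \ X)) then
        pos (Z \ X) (Y \ Z) else pos (Y \ Z) (Z \ X))) *
      ∏ i ∈ M, (markFactor a (Y \ X) i (if act (splitTime Λ m {i} (Y \ X)) then
        ∑ e ∈ Y \ X, a i e < 0 else 0 < ∑ e ∈ Y \ X, a i e) : R) =
    (∑ Z ∈ Finset.Ioo X Y, if act (splitTime Λ m (Z \ X) (Y \ X)) then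
      (ind R (pos (Z \ X) (Y \ Z)) - ind R (pos (Y \ Z) (Z \ X))) * Q X Z Y *
        flowAt Q pos X Z (push Λ (Y \ X) (splitTime Λ m (Z \ X) (Y \ X)) m) *
        flowAt Q pos Z Y (push Λ (Y \ X) (splitTime Λ m (Z \ X) (Y \ X)) m) *
        ∏ i ∈ M, (markFactor a (Y \ X) i
          (push Λ (Y \ X) (splitTime Λ m (Z \ X) (Y \ X)) m i < 0) : R) else 0) +
    ∑ i ∈ M, if act (splitTime Λ m {i} (Y \ X)) then
      ((|∑ e ∈ Y \ X, a i e| : ℤ) : R) *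
        flowAt Q pos X Y (push Λ (Y \ X) (splitTime Λ m {i} (Y \ X)) m) *
        ∏ j ∈ M.erase i, (markFactor a (Y \ X) j
          (push Λ (Y \ X) (splitTime Λ m {i} (Y \ X)) m j < 0) : R) else 0 := by
  set S := Y \ X with hS
  set tZ : Finset E → ℝ := fun Z => splitTime Λ m (Z \ X) S with htZ
  set tI : E → ℝ := fun i => splitTime Λ m {i} S with htI
  set c : E → ℤ := fun i => ∑ e ∈ S, a i e with hc
  set U : Finset ℝ := ((Finset.Ioo X Y).image tZ ∪ (M.filter (c · ≠ 0)).image tI).filter act with hU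
  set εP : Finset ℝ → Finset E → R := fun P Z =>
    ind R (if act (tZ Z) ∧ tZ Z ∉ P then pos (Z \ X) (Y \ Z) else pos (Y \ Z) (Z \ X)) with hεP
  set κP : Finset ℝ → E → ℤ := fun P i =>
    markFactor a S i (if act (tI i) ∧ tI i ∉ P then c i < 0 else 0 < c i) with hκP
  -- `Φ P` is the state in which the active times belonging to `P` have passed
  set Φ : Finset ℝ → R := fun P =>
    flowSum Q (finalState R pos) X Y (εP P) * ∏ i ∈ M, (κP P i : R) with hΦ
  have hSM : Disjoint S M := hYM.mono_left Finset.sdiff_subset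
  -- basic facts on the blocks
  have hW : ∀ Z ∈ Finset.Ioo X Y, blockSum Λ (Z \ X) S = blockSum Λ (Z \ X) (Y \ Z) ∧
      blockSum Λ (Z \ X) (Y \ Z) = - blockSum Λ (Y \ Z) (Z \ X) ∧
      blockSum Λ (Z \ X) (Y \ Z) ≠ 0 ∧ (pos (Z \ X) (Y \ Z) ↔ 0 < blockSum Λ (Z \ X) S) ∧
      (pos (Y \ Z) (Z \ X) ↔ blockSum Λ (Z \ X) S < 0) := by
    intro Z hZ
    obtain ⟨h1, h2⟩ := Finset.mem_Ioo.1 hZ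
    have hd : Disjoint (Z \ X) (Y \ Z) :=
      Finset.disjoint_left.2 fun x hx hx' => (Finset.mem_sdiff.1 hx').2 (Finset.mem_sdiff.1 hx).1
    have hu : S = (Z \ X) ∪ (Y \ Z) := by
      ext x; simp only [hS, Finset.mem_sdiff, Finset.mem_union]
      have := @h1.1 x; have := @h2.1 x; tauto
    have s1 : Z \ X ⊆ Y := Finset.sdiff_subset.trans h2.1
    have s2 : Y \ Z ⊆ Y := Finset.sdiff_subset
    have n1 : (Z \ X).Nonempty := Finset.sdiff_nonempty.2 h1.2
    have n2 : (Y \ Z).Nonempty := Finset.sdiff_nonempty.2 h2.2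
    have e1 : blockSum Λ (Z \ X) S = blockSum Λ (Z \ X) (Y \ Z) := by
      rw [hu, blockSum_union_right Λ _ hd, blockSum_self (fun e he f hf => hanti e (s1 he) f (s1 hf)),
        zero_add]
    have e2 : blockSum Λ (Z \ X) (Y \ Z) = - blockSum Λ (Y \ Z) (Z \ X) :=
      blockSum_swap fun e he f hf => hanti e (s1 he) f (s2 hf)
    have p1 := hpos _ _ s1 s2 n1 n2 hd
    have p2 := hpos _ _ s2 s1 n2 n1 hd.symm
    refine ⟨e1, e2, p1.1, by rw [p1.2, e1], ?_⟩
    rw [p2.2, e1, e2]; constructor <;> intro h <;> linarith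
  have hWm : ∀ i ∈ M, blockSum Λ {i} S = c i := fun i hi => by
    simp only [blockSum, Finset.sum_singleton, hc, Int.cast_sum]
    exact Finset.sum_congr rfl fun e _ => ha i hi e
  have pushZ : ∀ τ, ∀ Z ∈ Finset.Ioo X Y,
      ∑ e ∈ Z \ X, push Λ S τ m e = blockSum Λ (Z \ X) S * (tZ Z - τ) := fun τ Z hZ => by
    have := (hW Z hZ).2.2.1
    rw [← (hW Z hZ).1] at this
    rw [sum_push, htZ]; simp only [splitTime]; field_simp
  have pushI : ∀ τ, ∀ i ∈ M, c i ≠ 0 → push Λ S τ m i = c i * (tI i - τ) := fun τ i hi h0 => by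
    have h0' : (c i : ℝ) ≠ 0 := by exact_mod_cast h0
    have : ∑ f ∈ S, Λ i f = c i := by rw [← hWm i hi]; simp [blockSum]
    rw [htI]; simp only [splitTime, hWm i hi, Finset.sum_singleton, push, this]; field_simp
  -- the states at the two ends
  have h0 : Φ ∅ = flowSum Q (finalState R pos) X Y (fun Z => ind R (if act (tZ Z) then
        pos (Z \ X) (Y \ Z) else pos (Y \ Z) (Z \ X))) *
      ∏ i ∈ M, (markFactor a S i (if act (tI i) then c i < 0 else 0 < c i) : R) := by
    simp [hΦ, hεP, hκP]
  have hUZ : ∀ Z ∈ Finset.Ioo X Y, (tZ Z ∈ U ↔ act (tZ Z)) := fun Z hZ => by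
    rw [hU, Finset.mem_filter, and_iff_right_iff_imp]
    exact fun _ => Finset.mem_union_left _ (Finset.mem_image_of_mem _ hZ)
  have hUI : ∀ i ∈ M, c i ≠ 0 → (tI i ∈ U ↔ act (tI i)) := fun i hi h0 => by
    rw [hU, Finset.mem_filter, and_iff_right_iff_imp]
    exact fun _ => Finset.mem_union_right _
      (Finset.mem_image_of_mem _ (Finset.mem_filter.2 ⟨hi, h0⟩))
  have hUend : Φ U = 0 := by
    rcases hcard with h1 | ⟨h1, i, hi⟩
    · have : flowSum Q (finalState R pos) X Y (εP U) = 0 := by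
        rw [← flowSum_self Q (finalState R pos) (hS ▸ h1)]
        refine flowSum_congr _ _ hQ fun Z hZ => ?_
        simp only [hεP, finalState, hUZ Z hZ, and_not_self, if_false]
      simp only [hΦ, this, zero_mul]
    · have : κP U i = 0 := by
        obtain ⟨e, he⟩ := Finset.card_eq_one.1 h1
        have h2 : κP U i = markFactor a S i (0 < c i) :=
          markFactor_congr a S i fun h0 => by simp [hUI i hi h0]
        have hci : c i = a i e := by simp only [hc]; rw [he, Finset.sum_singleton]
        rw [h2, markFactor, hci, he]
        simp only [Finset.sum_singleton]
        split_ifs with h3 <;> omega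
      simp only [hΦ]
      rw [Finset.prod_eq_zero hi (by rw [this, Int.cast_zero]), mul_zero]
  -- the states just before and just after a time
  have stZ : ∀ τ ∈ U, ∀ Z ∈ Finset.Ioo X Y, tZ Z ≠ τ →
      εP (U.filter (· < τ)) Z = ind R (0 < ∑ e ∈ Z \ X, push Λ S τ m e) ∧
      εP (U.filter (· ≤ τ)) Z = ind R (0 < ∑ e ∈ Z \ X, push Λ S τ m e) := by
    intro τ hτ Z hZ hne
    have hτa := (Finset.mem_filter.1 hτ).2
    obtain ⟨w1, w2, w3, w4, w5⟩ := hW Z hZ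
    rw [pushZ τ Z hZ]
    simp only [hεP, Finset.mem_filter, hUZ Z hZ, not_and]
    rcases lt_or_gt_of_ne hne with h | h
    · have e1 : 0 < blockSum Λ (Z \ X) S * (tZ Z - τ) ↔ blockSum Λ (Z \ X) S < 0 := by
        rw [mul_pos_iff]; constructor
        · rintro (h | h) <;> [linarith; exact h.1]
        · exact fun h' => .inr ⟨h', by linarith⟩
      constructor <;> refine ind_congr ?_ <;> rw [e1, if_neg, w5]
      · exact fun h' => h'.2 h'.1 h
      · exact fun h' => h'.2 h'.1 h.le
    · have e1 : 0 < blockSum Λ (Z \ X) S * (tZ Z - τ) ↔ 0 < blockSum Λ (Z \ X) S := by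
        exact mul_pos_iff_of_pos_right (by linarith)
      have hZa := hact _ _ hτa h.le
      constructor <;> refine ind_congr ?_ <;> rw [e1, if_pos, w4]
      · exact ⟨hZa, fun _ => h.le.not_gt⟩
      · exact ⟨hZa, fun _ => h.not_ge⟩
  have stZeq : ∀ τ ∈ U, ∀ Z ∈ Finset.Ioo X Y, tZ Z = τ →
      εP (U.filter (· < τ)) Z = ind R (pos (Z \ X) (Y \ Z)) ∧
      εP (U.filter (· ≤ τ)) Z = ind R (pos (Y \ Z) (Z \ X)) := by
    intro τ hτ Z hZ h
    have hτa := (Finset.mem_filter.1 hτ).2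
    simp [hεP, h, hτa, hτ]
  have stI : ∀ τ ∈ U, ∀ i ∈ M, (c i ≠ 0 → tI i ≠ τ) →
      κP (U.filter (· < τ)) i = markFactor a S i (push Λ S τ m i < 0) ∧
      κP (U.filter (· ≤ τ)) i = markFactor a S i (push Λ S τ m i < 0) := by
    intro τ hτ i hi hne
    have hτa := (Finset.mem_filter.1 hτ).2
    have key : c i ≠ 0 →
        ((if act (tI i) ∧ tI i ∉ U.filter (· < τ) then c i < 0 else 0 < c i) ↔ push Λ S τ m i < 0) ∧
        ((if act (tI i) ∧ tI i ∉ U.filter (· ≤ τ) then c i < 0 else 0 < c i) ↔ push Λ S τ m i < 0) := by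
      intro h0
      rw [pushI τ i hi h0]
      simp only [Finset.mem_filter, hUI i hi h0, not_and]
      rcases lt_or_gt_of_ne (hne h0) with h | h
      · have e1 : (c i : ℝ) * (tI i - τ) < 0 ↔ 0 < c i := by
          rw [mul_neg_iff, ← Int.cast_pos (R := ℝ)]; constructor
          · rintro (h | h) <;> [exact h.1; linarith]
          · exact fun h' => .inl ⟨h', by linarith⟩
        rw [e1, if_neg, if_neg]
        · simp
        · exact fun h' => h'.2 h'.1 h.le
        · exact fun h' => h'.2 h'.1 h
      · have e1 : (c i : ℝ) * (tI i - τ) < 0 ↔ c i < 0 := by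
          rw [mul_neg_iff, ← Int.cast_lt_zero (R := ℝ)]; constructor
          · rintro (h | h) <;> [linarith; exact h.1]
          · exact fun h' => .inr ⟨h', by linarith⟩
        have hIa := hact _ _ hτa h.le
        rw [e1, if_pos, if_pos]
        · simp
        · exact ⟨hIa, fun _ => h.not_ge⟩
        · exact ⟨hIa, fun _ => h.le.not_gt⟩
    exact ⟨markFactor_congr a S i fun h => (key h).1, markFactor_congr a S i fun h => (key h).2⟩
  have stIeq : ∀ τ ∈ U, ∀ i ∈ M, tI i = τ →
      κP (U.filter (· < τ)) i - κP (U.filter (· ≤ τ)) i = |c i| := by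
    intro τ hτ i hi h
    have hτa := (Finset.mem_filter.1 hτ).2
    simp only [hκP, h, hτa, hτ, Finset.mem_filter, lt_self_iff_false, le_refl, and_false, and_true,
      not_false_eq_true, if_true, if_false, not_true, markFactor]
    have : ∑ e ∈ S, a i e = c i := rfl
    rw [this]
    rcases lt_trichotomy (c i) 0 with h | h | h
    · rw [if_pos h, if_neg h.le.not_gt, abs_of_neg h]; ring
    · simp [h]
    · rw [if_neg h.le.not_gt, if_pos h, abs_of_pos h]; ring
  set TZ : Finset E → R := fun Z => (ind R (pos (Z \ X) (Y \ Z)) - ind R (pos (Y \ Z) (Z \ X))) *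
        Q X Z Y * flowAt Q pos X Z (push Λ S (tZ Z) m) * flowAt Q pos Z Y (push Λ S (tZ Z) m) *
        ∏ i ∈ M, (markFactor a S i (push Λ S (tZ Z) m i < 0) : R) with hTZ
  set TI : E → R := fun i => ((|c i| : ℤ) : R) * flowAt Q pos X Y (push Λ S (tI i) m) *
        ∏ j ∈ M.erase i, (markFactor a S j (push Λ S (tI i) m j < 0) : R) with hTI
  -- the jump at a time
  have jump : ∀ τ ∈ U, Φ (U.filter (· < τ)) - Φ (U.filter (· ≤ τ)) =
      ∑ Z ∈ (Finset.Ioo X Y).filter (tZ · = τ), TZ Z +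
      ∑ i ∈ (M.filter (c · ≠ 0)).filter (tI · = τ), TI i := by
    intro τ hτ
    by_cases hex : ∃ i ∈ M, c i ≠ 0 ∧ tI i = τ
    · obtain ⟨i, hi, hci, hti⟩ := hex
      have hci' : (blockSum Λ {i} S : ℝ) ≠ 0 := by rw [hWm i hi]; exact_mod_cast hci
      have noZ : ∀ Z ∈ Finset.Ioo X Y, tZ Z ≠ τ := by
        intro Z hZ h
        refine hgen.splitTime_ne_mark hK hi (B := Z \ X) ?_ (.inl ?_) hci' ?_ hSM (hti.trans h.symm)
        · intro h
          exact Finset.disjoint_left.1 hYM ((Finset.mem_Ioo.1 hZ).2.1 (Finset.mem_sdiff.1 h).1) hi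
        · exact Finset.sdiff_subset_sdiff (Finset.mem_Ioo.1 hZ).2.1 subset_rfl
        · rw [(hW Z hZ).1]; exact (hW Z hZ).2.2.1
      have noI : ∀ j ∈ M, j ≠ i → c j ≠ 0 → tI j ≠ τ := by
        intro j hj hji hcj h
        refine hgen.splitTime_ne_mark hK hi (B := {j}) ?_ (.inr ?_) hci' ?_ hSM (hti.trans h.symm)
        · simpa using hji.symm
        · simpa using hj
        · rw [hWm j hj]; exact_mod_cast hcj
      have f1 : (Finset.Ioo X Y).filter (tZ · = τ) = ∅ := Finset.filter_eq_empty_iff.2 fun Z hZ => noZ Z hZ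
      have f2 : (M.filter (c · ≠ 0)).filter (tI · = τ) = {i} := by
        ext j; simp only [Finset.mem_filter, Finset.mem_singleton]
        constructor
        · rintro ⟨⟨h1, h2⟩, h3⟩; by_contra h; exact noI j h1 h h2 h3
        · rintro rfl; exact ⟨⟨hi, hci⟩, hti⟩
      have g1 : ∀ P ∈ ({U.filter (· < τ), U.filter (· ≤ τ)} : Set (Finset ℝ)),
          flowSum Q (finalState R pos) X Y (εP P) = flowAt Q pos X Y (push Λ S τ m) ∧
          ∏ j ∈ M.erase i, (κP P j : R) = ∏ j ∈ M.erase i,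
            (markFactor a S j (push Λ S τ m j < 0) : R) := by
        intro P hP
        constructor
        · refine flowSum_congr _ _ hQ fun Z hZ => ?_
          have := stZ τ hτ Z hZ (noZ Z hZ)
          rcases hP with rfl | rfl <;> [exact this.1; exact this.2]
        · refine Finset.prod_congr rfl fun j hj => ?_
          have := stI τ hτ j (Finset.mem_of_mem_erase hj)
            (noI j (Finset.mem_of_mem_erase hj) (Finset.ne_of_mem_erase hj))
          rcases hP with rfl | rfl <;> [rw [this.1]; rw [this.2]]
      rw [f1, f2, Finset.sum_empty, Finset.sum_singleton, zero_add]
      simp only [hΦ, hTI, hti, ← Finset.mul_prod_erase M _ hi]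
      rw [(g1 _ (.inl rfl)).1, (g1 _ (.inl rfl)).2, (g1 _ (.inr rfl)).1, (g1 _ (.inr rfl)).2,
        ← stIeq τ hτ i hi hti]
      push_cast; ring
    · push Not at hex
      have f2 : (M.filter (c · ≠ 0)).filter (tI · = τ) = ∅ :=
        Finset.filter_eq_empty_iff.2 fun {j} h =>
          hex j (Finset.mem_filter.1 h).1 (Finset.mem_filter.1 h).2
      have g1 : ∀ P ∈ ({U.filter (· < τ), U.filter (· ≤ τ)} : Set (Finset ℝ)),
          ∏ j ∈ M, (κP P j : R) = ∏ j ∈ M, (markFactor a S j (push Λ S τ m j < 0) : R) := by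
        intro P hP
        refine Finset.prod_congr rfl fun j hj => ?_
        have := stI τ hτ j hj (hex j hj)
        rcases hP with rfl | rfl <;> [rw [this.1]; rw [this.2]]
      rw [f2, Finset.sum_empty, add_zero]
      simp only [hΦ]
      rw [g1 _ (.inl rfl), g1 _ (.inr rfl), ← sub_mul, flowSum_sub _ _ hQ, Finset.sum_filter,
        Finset.sum_mul]
      refine Finset.sum_congr rfl fun Z hZ => ?_
      split_ifs with hZτ
      · have hcomp : ∀ V ∈ Finset.Ioo X Y, Z ⊂ V ∨ V ⊂ Z → tZ V ≠ τ := by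
          intro V hV h hV'
          have b1 := (hW Z hZ).2.2.1
          have b2 := (hW V hV).2.2.1
          rw [← (hW Z hZ).1] at b1
          rw [← (hW V hV).1] at b2
          have mono : ∀ {V W}, V ∈ Finset.Ioo X Y → V ⊂ W → V \ X ⊂ W \ X := by
            intro V W hV h
            refine Finset.ssubset_iff_subset_ne.2 ⟨Finset.sdiff_subset_sdiff h.1 subset_rfl, ?_⟩
            intro h'
            obtain ⟨x, hx, hx'⟩ := Finset.exists_of_ssubset h
            have : x ∈ W \ X := Finset.mem_sdiff.2 ⟨hx, fun h => hx' ((Finset.mem_Ioo.1 hV).1.1 h)⟩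
            rw [← h'] at this
            exact hx' (Finset.mem_sdiff.1 this).1
          rcases h with h | h
          · exact hgen.splitTime_ne hK (mono hZ h) (mono hV (Finset.mem_Ioo.1 hV).2) b1 b2 hSM
              (hZτ.trans hV'.symm)
          · exact hgen.splitTime_ne hK (mono hV h) (mono hZ (Finset.mem_Ioo.1 hZ).2) b2 b1 hSM
              (hV'.trans hZτ.symm)
        have k1 : flowSum Q (finalState R pos) X Z (εP (U.filter (· < τ))) =
            flowAt Q pos X Z (push Λ S (tZ Z) m) := by
          refine flowSum_congr _ _ hQ fun V hV => ?_
          have hV' : V ∈ Finset.Ioo X Y := Finset.mem_Ioo.2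
            ⟨(Finset.mem_Ioo.1 hV).1, (Finset.mem_Ioo.1 hV).2.trans (Finset.mem_Ioo.1 hZ).2⟩
          rw [hZτ]
          exact (stZ τ hτ V hV' (hcomp V hV' (.inr (Finset.mem_Ioo.1 hV).2))).1
        have k2 : flowSum Q (finalState R pos) Z Y (εP (U.filter (· ≤ τ))) =
            flowAt Q pos Z Y (push Λ S (tZ Z) m) := by
          refine flowSum_congr _ _ hQ fun V hV => ?_
          have hV' : V ∈ Finset.Ioo X Y := Finset.mem_Ioo.2
            ⟨(Finset.mem_Ioo.1 hZ).1.trans (Finset.mem_Ioo.1 hV).1, (Finset.mem_Ioo.1 hV).2⟩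
          rw [hZτ, (stZ τ hτ V hV' (hcomp V hV' (.inl (Finset.mem_Ioo.1 hV).1))).2]
          have e1 : ∑ e ∈ Z \ X, push Λ S τ m e = 0 := by rw [pushZ τ Z hZ, hZτ]; ring
          have e2 : V \ X = (V \ Z) ∪ (Z \ X) := by
            ext x; simp only [Finset.mem_sdiff, Finset.mem_union]
            have := @(Finset.mem_Ioo.1 hV).1.1 x; have := @(Finset.mem_Ioo.1 hZ).1.1 x; tauto
          have e3 : Disjoint (V \ Z) (Z \ X) := Finset.disjoint_left.2 fun x hx hx' =>
            (Finset.mem_sdiff.1 hx).2 (Finset.mem_sdiff.1 hx').1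
          rw [e2, Finset.sum_union e3, e1, add_zero]
        rw [(stZeq τ hτ Z hZ hZτ).1, (stZeq τ hτ Z hZ hZτ).2, k1, k2]
        simp only [hTZ, hZτ]
      · rw [(stZ τ hτ Z hZ hZτ).1, (stZ τ hτ Z hZ hZτ).2]; ring
  rw [← h0]
  have tel := sum_telescope Φ U
  rw [hUend, sub_zero] at tel
  rw [tel, Finset.sum_congr rfl jump, Finset.sum_add_distrib]
  congr 1
  · rw [← Finset.sum_filter, ← Finset.sum_fiberwise_of_maps_to (t := U) (g := tZ)]
    · refine Finset.sum_congr rfl fun τ hτ => Finset.sum_congr ?_ fun _ _ => rfl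
      have hτa := (Finset.mem_filter.1 hτ).2
      ext Z; simp only [Finset.mem_filter]
      exact ⟨fun h => ⟨⟨h.1, by rw [← h.2] at hτa; exact hτa⟩, h.2⟩, fun h => ⟨h.1.1, h.2⟩⟩
    · exact fun Z hZ => (hUZ Z (Finset.mem_filter.1 hZ).1).2 (Finset.mem_filter.1 hZ).2
  · have : ∑ i ∈ M, (if act (tI i) then TI i else 0) =
        ∑ i ∈ (M.filter (c · ≠ 0)).filter (act ∘ tI), TI i := by
      rw [Finset.sum_filter, Finset.sum_filter]
      refine Finset.sum_congr rfl fun i _ => ?_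
      by_cases h : c i = 0
      · simp [h, hTI]
      · simp [h]
    refine Eq.trans ?_ this.symm
    rw [← Finset.sum_fiberwise_of_maps_to (t := U) (g := tI)]
    · refine Finset.sum_congr rfl fun τ hτ => Finset.sum_congr ?_ fun _ _ => rfl
      have hτa := (Finset.mem_filter.1 hτ).2
      ext i; simp only [Finset.mem_filter, Function.comp]
      exact ⟨fun h => ⟨⟨h.1, by rw [← h.2] at hτa; exact hτa⟩, h.2⟩, fun h => ⟨h.1.1, h.2⟩⟩
    · intro i hi
      have h1 := Finset.mem_filter.1 hi
      have h2 := Finset.mem_filter.1 h1.1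
      exact (hUI i h2.1 h2.2).2 h1.2

end Flow


/-! ### Sums over planar binary trees -/

/-- Binary trees with labelled leaves. -/
inductive BTree (E : Type*)
  | leaf (e : E) : BTree E
  | node (l r : BTree E) : BTree E

section Trees

variable {E R : Type*} [DecidableEq E] [CommRing R]

namespace BTree

/-- The set of the labels of the leaves. -/
def leaves : BTree E → Finset E
  | leaf e => {e}
  | node l r => l.leaves ∪ r.leaves

theorem leaves_nonempty : ∀ T : BTree E, T.leaves.Nonempty
  | leaf e => Finset.singleton_nonempty e
  | node l _ => l.leaves_nonempty.mono Finset.subset_union_left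

/-- The leaves have different labels, and the two subtrees at each node are ordered by means of
`pick`: the left one contains the chosen leaf. -/
def IsCanonical (pick : Finset E → E) : BTree E → Prop
  | leaf _ => True
  | node l r => l.IsCanonical pick ∧ r.IsCanonical pick ∧ Disjoint l.leaves r.leaves ∧
      pick (l.leaves ∪ r.leaves) ∈ l.leaves

end BTree

open BTree

open Classical in
/-- The canonical trees with the set of leaves `S`. They represent the unordered rooted binary trees
with these leaves. -/
def canonicalTrees (pick : Finset E → E) (S : Finset E) : Finset (BTree E) :=
  if S.card ≤ 1 then S.image leaf else
    Finset.univ.biUnion fun A : {A // A ∈ S.powerset.filter fun A => pick S ∈ A ∧ A ≠ S} =>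
      Finset.image₂ node (canonicalTrees pick A.1) (canonicalTrees pick (S \ A.1))
termination_by S.card
decreasing_by
  · have h := Finset.mem_filter.1 A.2
    exact Finset.card_lt_card (Finset.ssubset_iff_subset_ne.2 ⟨Finset.mem_powerset.1 h.1, h.2.2⟩)
  · have h := Finset.mem_filter.1 A.2
    refine Finset.card_lt_card (Finset.ssubset_iff_subset_ne.2 ⟨Finset.sdiff_subset, fun h' => ?_⟩)
    have h2 : pick S ∈ S \ A.1 := by rw [h']; exact Finset.mem_powerset.1 h.1 h.2.1
    exact (Finset.mem_sdiff.1 h2).2 h.2.1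

theorem mem_canonicalTrees (pick : Finset E → E) (T : BTree E) : ∀ S : Finset E,
    T ∈ canonicalTrees pick S ↔ T.IsCanonical pick ∧ T.leaves = S := by
  induction T with
  | leaf e =>
    intro S
    rw [canonicalTrees]
    split_ifs with h
    · simp only [Finset.mem_image, leaf.injEq, exists_eq_right, IsCanonical, true_and, leaves]
      constructor
      · intro he; exact (Finset.eq_singleton_iff_unique_mem.2
          ⟨he, fun x hx => Finset.card_le_one.1 h x hx e he⟩).symm
      · rintro rfl; simp
    · simp only [Finset.mem_biUnion, Finset.mem_image₂, reduceCtorEq, and_false, exists_false,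
        IsCanonical, leaves, true_and, false_iff]
      rintro rfl; simp at h
  | node l r ihl ihr =>
    intro S
    rw [canonicalTrees]
    split_ifs with h
    · simp only [Finset.mem_image, reduceCtorEq, and_false, exists_false, false_iff, IsCanonical, leaves]
      rintro ⟨⟨-, -, hd, -⟩, rfl⟩
      rw [Finset.card_union_of_disjoint hd] at h
      have := l.leaves_nonempty.card_pos
      have := r.leaves_nonempty.card_pos
      omega
    · simp only [Finset.mem_biUnion, Finset.mem_univ, true_and, Finset.mem_image₂, node.injEq,
        Subtype.exists, Finset.mem_filter, Finset.mem_powerset, IsCanonical, leaves]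
      constructor
      · rintro ⟨A, ⟨hA, hp, hne⟩, l', hl, r', hr, rfl, rfl⟩
        rw [ihl] at hl
        rw [ihr] at hr
        rw [hl.2, hr.2, Finset.union_sdiff_of_subset hA]
        exact ⟨⟨hl.1, hr.1, Finset.disjoint_sdiff, hp⟩, rfl⟩
      · rintro ⟨⟨hl, hr, hd, hp⟩, rfl⟩
        refine ⟨l.leaves, ⟨Finset.subset_union_left, hp, fun h' => ?_⟩, l, (ihl _).2 ⟨hl, rfl⟩, r,
          (ihr _).2 ⟨hr, ?_⟩, rfl, rfl⟩
        · obtain ⟨x, hx⟩ := r.leaves_nonempty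
          have : x ∈ l.leaves := h' ▸ Finset.mem_union_right _ hx
          exact Finset.disjoint_left.1 hd this hx
        · rw [Finset.union_sdiff_cancel_left hd]

theorem sum_canonicalTrees {A' : Type*} [AddCommMonoid A'] {pick : Finset E → E} {S : Finset E}
    (hS : 1 < S.card) (f : BTree E → A') :
    ∑ T ∈ canonicalTrees pick S, f T = ∑ A ∈ S.powerset with pick S ∈ A ∧ A ≠ S,
      ∑ l ∈ canonicalTrees pick A, ∑ r ∈ canonicalTrees pick (S \ A), f (node l r) := by
  classical
  rw [canonicalTrees, if_neg (by omega), Finset.sum_biUnion]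
  · rw [← Finset.sum_coe_sort (S.powerset.filter fun A => pick S ∈ A ∧ A ≠ S)]
    refine Finset.sum_congr rfl fun A _ => ?_
    rw [← Finset.sum_product', Finset.image₂, Finset.sum_image]
    · rfl
    · intro x _ y _ h
      simp only [Function.uncurry, node.injEq] at h
      exact Prod.ext h.1 h.2
  · intro A _ B _ hAB
    refine Finset.disjoint_left.2 fun T hT hT' => hAB ?_
    obtain ⟨l, hl, r, -, rfl⟩ := Finset.mem_image₂.1 hT
    obtain ⟨l', hl', r', -, h⟩ := Finset.mem_image₂.1 hT'
    obtain ⟨rfl, rfl⟩ := (node.injEq ..).mp h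
    rw [mem_canonicalTrees] at hl hl'
    exact Subtype.ext (hl.2.symm.trans hl'.2)

open Classical in
/-- The set of ends whose moments have the sum zero at a node with the two sets of descendants `A`
and `B`: a mark, if one of the two subtrees is a mark, and otherwise the ends of `A` that are not
marks. -/
def levelSet (mk A B : Finset E) : Finset E :=
  if ∃ i ∈ mk, A = {i} then A else if ∃ i ∈ mk, B = {i} then B else A \ mk

/-- The length of the edge below the node, forced by the moments `m` at its lower end. -/
def nodeTime (mk : Finset E) (Λ : E → E → ℝ) (m : E → ℝ) (A B : Finset E) : ℝ :=
  splitTime Λ m (levelSet mk A B) (A ∪ B)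

/-- The moments with respect to the node, if those at the lower end of the edge below it are `m`. -/
def nodePush (mk : Finset E) (Λ : E → E → ℝ) (m : E → ℝ) (A B : Finset E) : E → ℝ :=
  push Λ (A ∪ B) (nodeTime mk Λ m A B) m

namespace BTree

/-- The product of the node weights `k` if all the lengths of the edges, including the one below the
root node, are positive, and `0` otherwise. -/
def weight (k : Finset E → Finset E → R) (mk : Finset E) (Λ : E → E → ℝ) : BTree E → (E → ℝ) → R
  | leaf _, _ => 1
  | node l r, m => k l.leaves r.leaves * ind R (0 < nodeTime mk Λ m l.leaves r.leaves) *
      (l.weight k mk Λ (nodePush mk Λ m l.leaves r.leaves) *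
        r.weight k mk Λ (nodePush mk Λ m l.leaves r.leaves))

/-- The weight of a tree, with no condition on the edge below the root node. This edge is the
unbounded end `e₀`, along which the root vertex moves freely. -/
def rootWeight (k : Finset E → Finset E → R) (mk : Finset E) (Λ : E → E → ℝ) :
    BTree E → (E → ℝ) → R
  | leaf _, _ => 1
  | node l r, m => k l.leaves r.leaves *
      (l.weight k mk Λ (nodePush mk Λ m l.leaves r.leaves) *
        r.weight k mk Λ (nodePush mk Λ m l.leaves r.leaves))

end BTree

/-- The weighted number of trees with the leaves `S`, growing from a given base point. -/
def treeSum (pick : Finset E → E) (k : Finset E → Finset E → R) (mk : Finset E) (Λ : E → E → ℝ)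
    (S : Finset E) (m : E → ℝ) : R :=
  ∑ T ∈ canonicalTrees pick S, T.weight k mk Λ m

/-- The sum over the two parts `A`, `S \ A` into which the root node divides the leaves, provided
that the time of the division is active. -/
def splitSum (act : ℝ → Prop) (pick : Finset E → E) (k : Finset E → Finset E → R) (mk : Finset E)
    (Λ : E → E → ℝ) (S : Finset E) (m : E → ℝ) : R :=
  ∑ A ∈ S.powerset with pick S ∈ A ∧ A ≠ S, k A (S \ A) * ind R (act (nodeTime mk Λ m A (S \ A))) *
    (treeSum pick k mk Λ A (nodePush mk Λ m A (S \ A)) *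
      treeSum pick k mk Λ (S \ A) (nodePush mk Λ m A (S \ A)))

theorem treeSum_of_card_one (pick : Finset E → E) (k : Finset E → Finset E → R) (mk : Finset E)
    (Λ : E → E → ℝ) (e : E) (m : E → ℝ) : treeSum pick k mk Λ {e} m = 1 := by
  classical
  rw [treeSum, canonicalTrees, if_pos (by simp)]
  simp [weight]

theorem treeSum_of_one_lt_card {pick : Finset E → E} (k : Finset E → Finset E → R) (mk : Finset E)
    (Λ : E → E → ℝ) {S : Finset E} (hS : 1 < S.card) (m : E → ℝ) :
    treeSum pick k mk Λ S m = splitSum (0 < ·) pick k mk Λ S m := by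
  rw [treeSum, sum_canonicalTrees hS]
  refine Finset.sum_congr rfl fun A hA => ?_
  rw [treeSum, treeSum, Finset.sum_mul_sum, Finset.mul_sum]
  refine Finset.sum_congr rfl fun l hl => ?_
  rw [Finset.mul_sum]
  refine Finset.sum_congr rfl fun r hr => ?_
  rw [weight, ((mem_canonicalTrees _ _ _).1 hl).2, ((mem_canonicalTrees _ _ _).1 hr).2]

theorem sum_rootWeight {pick : Finset E → E} (k : Finset E → Finset E → R) (mk : Finset E)
    (Λ : E → E → ℝ) {S : Finset E} (hS : 1 < S.card) (m : E → ℝ) :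
    ∑ T ∈ canonicalTrees pick S, T.rootWeight k mk Λ m =
      splitSum (fun _ => True) pick k mk Λ S m := by
  rw [sum_canonicalTrees hS]
  refine Finset.sum_congr rfl fun A hA => ?_
  rw [treeSum, treeSum, Finset.sum_mul_sum, Finset.mul_sum]
  refine Finset.sum_congr rfl fun l hl => ?_
  rw [Finset.mul_sum]
  refine Finset.sum_congr rfl fun r hr => ?_
  rw [rootWeight, ((mem_canonicalTrees _ _ _).1 hl).2, ((mem_canonicalTrees _ _ _).1 hr).2]
  simp [ind]

/-- The moments of a part `A` are generic after the division at which their sum vanishes. -/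
theorem IsGeneric.push_block {K : Subfield ℝ} {Λ : E → E → ℝ} (hK : ∀ e f, Λ e f ∈ K)
    {S M : Finset E} {m : E → ℝ} (hg : IsGeneric K S M m) {A N : Finset E} (hAS : A ⊂ S) (hN : N ⊆ M)
    (hMS : Disjoint S M) : IsGeneric K A N (push Λ S (splitTime Λ m A S) m) := by
  intro a ha h
  classical
  -- the change of a relation under the push is compensated by a multiple of the moment of `A`
  set lam : ℝ := (∑ e ∈ A, a e * ∑ f ∈ S, Λ e f + ∑ i ∈ N, a i * ∑ f ∈ S, Λ i f) / blockSum Λ A S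
  have hsum : ∀ e, ∑ f ∈ S, Λ e f ∈ K := fun e => sum_mem fun f _ => hK e f
  have hlam : lam ∈ K := K.div_mem (K.add_mem
    (sum_mem fun e _ => K.mul_mem (ha e) (hsum e))
    (sum_mem fun e _ => K.mul_mem (ha e) (hsum e)))
    (blockSum_mem K hK A S)
  have hA0 : ∀ i ∈ M, i ∉ A := fun i hi h => Finset.disjoint_left.1 hMS (hAS.1 h) hi
  have hN0 : ∀ i ∈ S, i ∉ N := fun i hi h => Finset.disjoint_left.1 hMS hi (hN h)
  obtain ⟨h1, h2⟩ := hg (fun e => (if e ∈ A then a e - lam else 0) + if e ∈ N then a e else 0)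
    (fun e => by
      refine K.add_mem ?_ ?_ <;> split_ifs
      exacts [K.sub_mem (ha e) hlam, K.zero_mem, ha e, K.zero_mem]) (by
    rw [Finset.sum_congr rfl (fun e he => by rw [if_neg (hN0 e he), add_zero]),
      Finset.sum_congr (s₁ := M) rfl (fun e he => by rw [if_neg (hA0 e he), zero_add])]
    simp only [ite_mul, zero_mul, Finset.sum_ite_mem, Finset.inter_eq_right.2 hAS.1,
      Finset.inter_eq_right.2 hN]
    rw [← h]
    simp only [push, mul_sub, sub_mul, Finset.sum_sub_distrib, ← Finset.mul_sum]
    have e1 : ∀ s : Finset E, ∑ e ∈ s, a e * (splitTime Λ m A S * ∑ f ∈ S, Λ e f) =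
        splitTime Λ m A S * ∑ e ∈ s, a e * ∑ f ∈ S, Λ e f := fun s => by
      rw [Finset.mul_sum]; exact Finset.sum_congr rfl fun _ _ => by ring
    rw [e1, e1]
    simp only [splitTime, lam]
    ring)
  obtain ⟨y, hyS, hyA⟩ := Finset.exists_of_ssubset hAS
  refine ⟨fun i hi => ?_, ?_⟩
  · have := h1 i (hN hi)
    simpa [hi, hA0 i (hN hi)] using this
  · have key : ∀ e ∈ A, a e = lam := fun e he => by
      have := h2 e (hAS.1 he) y hyS
      simp only [he, hyA, if_true, if_false, hN0 e (hAS.1 he), hN0 y hyS] at this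
      linarith
    intro e he f hf
    rw [key e he, key f hf]

/-- The moments are generic at the time at which the moment of the mark `i` vanishes. -/
theorem IsGeneric.push_mark {K : Subfield ℝ} {Λ : E → E → ℝ} (hK : ∀ e f, Λ e f ∈ K)
    {S M : Finset E} {m : E → ℝ} (hg : IsGeneric K S M m) {i : E} (hi : i ∈ M)
    (hMS : Disjoint S M) : IsGeneric K S (M.erase i) (push Λ S (splitTime Λ m {i} S) m) := by
  intro a ha h
  classical
  set lam : ℝ := (∑ e ∈ S, a e * ∑ f ∈ S, Λ e f + ∑ i ∈ M.erase i, a i * ∑ f ∈ S, Λ i f) /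
    blockSum Λ {i} S
  have hsum : ∀ e, ∑ f ∈ S, Λ e f ∈ K := fun e => sum_mem fun f _ => hK e f
  have hlam : lam ∈ K := K.div_mem (K.add_mem
    (sum_mem fun e _ => K.mul_mem (ha e) (hsum e))
    (sum_mem fun e _ => K.mul_mem (ha e) (hsum e)))
    (blockSum_mem K hK {i} S)
  have hiS : ∀ e ∈ S, e ≠ i := fun e he h => Finset.disjoint_left.1 hMS (h ▸ he) hi
  obtain ⟨h1, h2⟩ := hg (fun e => if e = i then -lam else a e)
    (fun e => by split_ifs; exacts [K.neg_mem hlam, ha e]) (by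
    rw [Finset.sum_congr rfl (fun e he => by rw [if_neg (hiS e he)]),
      ← Finset.add_sum_erase M _ hi, if_pos rfl,
      Finset.sum_congr (s₁ := M.erase i) rfl (fun e he => by rw [if_neg (Finset.ne_of_mem_erase he)])]
    rw [← h]
    simp only [push, mul_sub, Finset.sum_sub_distrib]
    have e1 : ∀ s : Finset E, ∑ e ∈ s, a e * (splitTime Λ m {i} S * ∑ f ∈ S, Λ e f) =
        splitTime Λ m {i} S * ∑ e ∈ s, a e * ∑ f ∈ S, Λ e f := fun s => by
      rw [Finset.mul_sum]; exact Finset.sum_congr rfl fun _ _ => by ring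
    rw [e1, e1]
    simp only [splitTime, lam, Finset.sum_singleton]
    ring)
  refine ⟨fun j hj => ?_, fun e he f hf => ?_⟩
  · have := h1 j (Finset.mem_of_mem_erase hj)
    simpa [Finset.ne_of_mem_erase hj] using this
  · have := h2 e he f hf
    simpa [hiS e he, hiS f hf] using this

end Trees


/-! ### Evaluation of the tree sums -/

section ClosedForm

variable {E R : Type*} [DecidableEq E] [CommRing R]

/-- The properties of the pairing `Λ` and of the node weights `k` on which the evaluation of the
tree sums depends: `mk` is the set of marks, `a i` the values of the linear form of the mark `i`,
`q A B` is the monomial of exponent `n_A ∧ n_B`, and `pos A B` says that `Λ`, or a perturbation of it,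
is positive on the blocks `A`, `B`. -/
structure IsWeightSystem (top mk : Finset E) (Λ : E → E → ℝ) (a : E → E → ℤ)
    (q : Finset E → Finset E → R) (pos : Finset E → Finset E → Prop)
    (k : Finset E → Finset E → R) : Prop where
  mark_right : ∀ e, ∀ f ∈ mk, Λ e f = 0
  anti : ∀ e ∉ mk, ∀ f ∉ mk, Λ e f = -Λ f e
  mark_left : ∀ i ∈ mk, ∀ e, Λ i e = a i e
  cocycle : ∀ X Z Z' Y, X ⊂ Z → Z ⊂ Z' → Z' ⊂ Y →
    q (Z \ X) (Y \ Z) * q (Z' \ Z) (Y \ Z') = q (Z' \ X) (Y \ Z') * q (Z \ X) (Z' \ Z)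
  k_mark_left : ∀ i ∈ mk, ∀ B, i ∉ B → k {i} B = ((|∑ e ∈ B \ mk, a i e| : ℤ) : R)
  k_mark_right : ∀ i ∈ mk, ∀ B, i ∉ B → k B {i} = ((|∑ e ∈ B \ mk, a i e| : ℤ) : R)
  k_marks : ∀ A B, A ⊆ mk → B ⊆ mk → A.Nonempty → B.Nonempty → Disjoint A B → k A B = 0
  k_split : ∀ A B, A ⊆ top → B ⊆ top → Disjoint A B → (A \ mk).Nonempty → (B \ mk).Nonempty →
    k A B = (ind R (pos (A \ mk) (B \ mk)) - ind R (pos (B \ mk) (A \ mk))) *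
      (q (A \ mk) (B \ mk) - q (B \ mk) (A \ mk))

/-- A weight system for which the pairing of two blocks without marks never vanishes, and such that
its values belong to the field `K`. -/
structure IsFlowSystem (top mk : Finset E) (K : Subfield ℝ) (Λ : E → E → ℝ) (a : E → E → ℤ)
    (q : Finset E → Finset E → R) (pos : Finset E → Finset E → Prop)
    (k : Finset E → Finset E → R) : Prop extends IsWeightSystem top mk Λ a q pos k where
  mem : ∀ e f, Λ e f ∈ K
  pos_iff : ∀ A B, Disjoint A mk → Disjoint B mk → A.Nonempty → B.Nonempty → Disjoint A B →
    blockSum Λ A B ≠ 0 ∧ (pos A B ↔ 0 < blockSum Λ A B)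

/-- `pick` chooses an element of each nonempty set, and one that is not a mark whenever this is
possible. -/
structure IsPick (mk : Finset E) (pick : Finset E → E) : Prop where
  mem : ∀ S : Finset E, S.Nonempty → pick S ∈ S
  mem_sdiff : ∀ S : Finset E, (S \ mk).Nonempty → pick S ∈ S \ mk

theorem exists_isPick [Nonempty E] (mk : Finset E) : ∃ pick, IsPick mk pick := by
  classical
  refine ⟨fun S => if h : (S \ mk).Nonempty then h.choose else if h' : S.Nonempty then h'.choose
    else Classical.arbitrary E, fun S hS => ?_, fun S hS => ?_⟩
  · by_cases h : (S \ mk).Nonempty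
    · simp only [h, dif_pos]; exact (Finset.mem_sdiff.1 h.choose_spec).1
    · simp only [h, dif_neg, hS, dif_pos, not_false_eq_true]; exact hS.choose_spec
  · simp only [hS, dif_pos]; exact hS.choose_spec

variable {top mk : Finset E} {K : Subfield ℝ} {Λ : E → E → ℝ} {a : E → E → ℤ}
    {q : Finset E → Finset E → R} {pos : Finset E → Finset E → Prop}
    {k : Finset E → Finset E → R} {pick : Finset E → E}

theorem treeSum_marks (h : IsFlowSystem top mk K Λ a q pos k) {S : Finset E}
    (hS : S ⊆ mk) (hc : 1 < S.card) (m : E → ℝ) : treeSum pick k mk Λ S m = 0 := by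
  rw [treeSum_of_one_lt_card _ _ _ hc]
  refine Finset.sum_eq_zero fun A hA => ?_
  obtain ⟨hA, h1, h2⟩ := Finset.mem_filter.1 hA
  rw [Finset.mem_powerset] at hA
  rw [h.k_marks A (S \ A) (hA.trans hS) (Finset.sdiff_subset.trans hS) ⟨_, h1⟩
    (Finset.sdiff_nonempty.2 fun h' => h2 (hA.antisymm h')) Finset.disjoint_sdiff]
  ring

/-- The trees with the leaves `S` are counted by the resolvent sum of the leaves that are not marks,
times one factor for each mark. The interval `[X, Y]` may be any one with the difference `S \ mk`;
in the induction this allows both orders of the two parts of a division. -/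
def HasClosedForm (pick : Finset E → E) (k : Finset E → Finset E → R) (mk : Finset E)
    (K : Subfield ℝ) (Λ : E → E → ℝ) (a : E → E → ℤ) (q : Finset E → Finset E → R)
    (pos : Finset E → Finset E → Prop) (S : Finset E) : Prop :=
  ∀ (m : E → ℝ) (X Y : Finset E), X ⊆ Y → Y \ X = S \ mk → Disjoint Y mk → (S \ mk).Nonempty →
    ∑ e ∈ S \ mk, m e = 0 → IsGeneric K (S \ mk) (S ∩ mk) m →
    treeSum pick k mk Λ S m = flowAt (fun X Z Y => q (Z \ X) (Y \ Z)) pos X Y m *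
      ∏ i ∈ S ∩ mk, (markFactor a (S \ mk) i (m i < 0) : R)

theorem markFactor_add (a : E → E → ℤ) {A B : Finset E} (hd : Disjoint A B) (i : E) (p : Prop) :
    markFactor a A i p + markFactor a B i p = markFactor a (A ∪ B) i p := by
  unfold markFactor
  rw [Finset.sum_union hd, Finset.sum_union hd]
  split_ifs <;> ring

open Classical in
/-- The sum over the divisions of `S` is the sum of the jumps in `flow_telescope`. A division with
ends that are not marks on both sides belongs to the block of these ends, the marks being
distributed in all possible ways, which adds up their factors; a division with marks only on one
side has weight zero, unless this side is a single mark. -/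
theorem splitSum_eq (h : IsFlowSystem top mk K Λ a q pos k) (hp : IsPick mk pick) {S : Finset E}
    (hS : S ⊆ top) (ih : ∀ S' ⊂ S, HasClosedForm pick k mk K Λ a q pos S') (act : ℝ → Prop)
    {m : E → ℝ} {X Y : Finset E} (hXY : X ⊆ Y) (hYX : Y \ X = S \ mk) (hY : Disjoint Y mk)
    (hne : (S \ mk).Nonempty) (hm : ∑ e ∈ S \ mk, m e = 0)
    (hg : IsGeneric K (S \ mk) (S ∩ mk) m) :
    splitSum act pick k mk Λ S m =
    (∑ Z ∈ Finset.Ioo X Y, if act (splitTime Λ m (Z \ X) (Y \ X)) then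
      (ind R (pos (Z \ X) (Y \ Z)) - ind R (pos (Y \ Z) (Z \ X))) * q (Z \ X) (Y \ Z) *
        flowAt (fun X Z Y => q (Z \ X) (Y \ Z)) pos X Z
          (push Λ (Y \ X) (splitTime Λ m (Z \ X) (Y \ X)) m) *
        flowAt (fun X Z Y => q (Z \ X) (Y \ Z)) pos Z Y
          (push Λ (Y \ X) (splitTime Λ m (Z \ X) (Y \ X)) m) *
        ∏ i ∈ S ∩ mk, (markFactor a (Y \ X) i
          (push Λ (Y \ X) (splitTime Λ m (Z \ X) (Y \ X)) m i < 0) : R) else 0) +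
    ∑ i ∈ S ∩ mk, if act (splitTime Λ m {i} (Y \ X)) then
      ((|∑ e ∈ Y \ X, a i e| : ℤ) : R) *
        flowAt (fun X Z Y => q (Z \ X) (Y \ Z)) pos X Y
          (push Λ (Y \ X) (splitTime Λ m {i} (Y \ X)) m) *
        ∏ j ∈ (S ∩ mk).erase i, (markFactor a (Y \ X) j
          (push Λ (Y \ X) (splitTime Λ m {i} (Y \ X)) m j < 0) : R) else 0 := by
  rw [hYX]
  set S0 := S \ mk with hS0
  set M := S ∩ mk with hM
  set F := fun X Z Y : Finset E => q (Z \ X) (Y \ Z) with hF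
  have hSM : Disjoint S0 M := Finset.disjoint_left.2 fun x h1 h2 =>
    (Finset.mem_sdiff.1 h1).2 (Finset.mem_inter.1 h2).2
  have hpS : pick S ∈ S0 := hp.mem_sdiff S hne
  have hS0mk : Disjoint S0 mk := Finset.sdiff_disjoint
  -- marks do not contribute to the velocities
  have rowS : ∀ e, ∑ f ∈ S, Λ e f = ∑ f ∈ S0, Λ e f := fun e => by
    rw [← Finset.sum_sdiff (Finset.inter_subset_left : S ∩ mk ⊆ S), Finset.sdiff_inter_self_left,
      Finset.sum_eq_zero (s := S ∩ mk) fun f hf => h.mark_right e f (Finset.mem_inter.1 hf).2, add_zero]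
  have blockS : ∀ A, blockSum Λ A S = blockSum Λ A S0 := fun A =>
    Finset.sum_congr rfl fun e _ => rowS e
  have pushS : ∀ τ, push Λ S τ m = push Λ S0 τ m := fun τ => by
    funext e; simp only [push, rowS]
  have antiS0 : ∀ A ⊆ S0, ∀ B ⊆ S0, blockSum Λ A B = -blockSum Λ B A := fun A hA B hB =>
    blockSum_swap fun e he f hf => h.anti e (Finset.disjoint_left.1 hS0mk (hA he)) f
      (Finset.disjoint_left.1 hS0mk (hB hf))
  -- the two kinds of splits
  set 𝒜 := S.powerset.filter fun A => pick S ∈ A ∧ A ≠ S with h𝒜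
  set t : Finset E → R := fun A => k A (S \ A) * ind R (act (nodeTime mk Λ m A (S \ A))) *
    (treeSum pick k mk Λ A (nodePush mk Λ m A (S \ A)) *
      treeSum pick k mk Λ (S \ A) (nodePush mk Λ m A (S \ A))) with ht
  have e0 : splitSum act pick k mk Λ S m =
      ∑ A ∈ 𝒜.filter (fun A => ¬ S0 ⊆ A), t A + ∑ A ∈ 𝒜.filter (fun A => S0 ⊆ A), t A := by
    rw [splitSum, add_comm, Finset.sum_filter_add_sum_filter_not]
  rw [e0]
  congr 1
  · -- genuine splits
    set 𝒵 := S0.powerset.filter fun A => pick S ∈ A ∧ A ≠ S0 with h𝒵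
    have mem𝒵 : ∀ A ∈ 𝒵, A ⊂ S0 ∧ pick S ∈ A := fun A hA => by
      obtain ⟨h1, h2, h3⟩ := Finset.mem_filter.1 hA
      exact ⟨Finset.ssubset_iff_subset_ne.2 ⟨Finset.mem_powerset.1 h1, h3⟩, h2⟩
    set pm : Finset E → E → ℝ := fun A => push Λ S0 (splitTime Λ m A S0) m with hpm
    -- facts for a proper nonempty block
    have fact : ∀ A, A ⊂ S0 → A.Nonempty → (S0 \ A).Nonempty ∧ A ⊂ S ∧
        ∑ e ∈ A, pm A e = 0 ∧ splitTime Λ m (S0 \ A) S0 = splitTime Λ m A S0 := by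
      intro A hA hAn
      have hBn : (S0 \ A).Nonempty := Finset.sdiff_nonempty.2 hA.2
      have hu := Finset.union_sdiff_of_subset hA.1
      have hdm := fun {B : Finset E} (hB : B ⊆ S0) => hS0mk.mono_left hB
      have b1 : blockSum Λ A S0 = blockSum Λ A (S0 \ A) := by
        conv_lhs => rw [← hu]
        rw [blockSum_union_right Λ _ Finset.disjoint_sdiff,
          blockSum_self (A := A) (fun e he f hf => h.anti e (Finset.disjoint_left.1 hS0mk (hA.1 he)) f
            (Finset.disjoint_left.1 hS0mk (hA.1 hf))), zero_add]
      have b2 : blockSum Λ (S0 \ A) S0 = -blockSum Λ A S0 := by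
        have := antiS0 S0 subset_rfl S0 subset_rfl
        have h2 := blockSum_union_left Λ S0 (Finset.disjoint_sdiff (s := A) (t := S0))
        rw [hu] at h2
        linarith
      have b3 : blockSum Λ A S0 ≠ 0 := by
        rw [b1]
        exact (h.pos_iff A _ (hdm hA.1) (hdm Finset.sdiff_subset) hAn hBn Finset.disjoint_sdiff).1
      refine ⟨hBn, hA.trans_subset Finset.sdiff_subset, ?_, ?_⟩
      · rw [hpm]; simp only [sum_push, splitTime]; field_simp; ring
      · have h2 := Finset.sum_sdiff (f := m) hA.1
        rw [splitTime, splitTime, b2, show ∑ e ∈ S0 \ A, m e = -∑ e ∈ A, m e by linarith, neg_div_neg_eq]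
    have pm_compl : ∀ A, A ⊂ S0 → A.Nonempty → pm (S0 \ A) = pm A := fun A hA hAn => by
      simp only [hpm]; rw [(fact A hA hAn).2.2.2]
    have sd : ∀ A, A.Nonempty → A ⊂ S0 → S0 \ A ⊂ S0 := fun A ⟨x, hx⟩ hA =>
      Finset.ssubset_iff_subset_ne.2 ⟨Finset.sdiff_subset, fun h' => by
        have : x ∈ S0 \ A := h'.symm ▸ hA.1 hx
        exact (Finset.mem_sdiff.1 this).2 hx⟩
    -- the closed form for both parts of a split
    have ihpart : ∀ A, A ⊂ S0 → A.Nonempty → ∀ N ⊆ M, ∀ X' Y', X' ⊆ Y' → Y' \ X' = A → Disjoint Y' mk →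
        treeSum pick k mk Λ (A ∪ N) (pm A) = flowAt F pos X' Y' (pm A) *
          ∏ i ∈ N, (markFactor a A i (pm A i < 0) : R) := by
      intro A hA hAn N hN X' Y' hX' hd hY'
      have hNmk : N ⊆ mk := hN.trans Finset.inter_subset_right
      have hAmk : Disjoint A mk := hS0mk.mono_left hA.1
      have e1 : (A ∪ N) \ mk = A := by
        rw [Finset.union_sdiff_distrib, Finset.sdiff_eq_empty_iff_subset.2 hNmk, Finset.union_empty,
          Finset.sdiff_eq_self_of_disjoint hAmk]
      have e2 : (A ∪ N) ∩ mk = N := by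
        rw [Finset.union_inter_distrib_right, Finset.disjoint_iff_inter_eq_empty.1 hAmk,
          Finset.inter_eq_left.2 hNmk, Finset.empty_union]
      have hsub : A ∪ N ⊂ S := by
        refine Finset.ssubset_iff_subset_ne.2 ⟨Finset.union_subset (fact A hA hAn).2.1.1
          (hN.trans Finset.inter_subset_left), fun h' => hA.2 ?_⟩
        rw [hS0, ← h', e1]
      have := ih _ hsub (pm A) X' Y' hX' (by rw [e1, hd]) hY' (by rw [e1]; exact hAn)
        (by rw [e1]; exact (fact A hA hAn).2.2.1)
        (by rw [e1, e2]; exact hg.push_block h.mem hA hN hSM)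
      rw [e1, e2] at this
      exact this
    -- one genuine split, with all the distributions of the marks
    have one : ∀ A ∈ 𝒵, ∀ N ⊆ M, t (A ∪ N) =
        (ind R (pos A (S0 \ A)) - ind R (pos (S0 \ A) A)) * (q A (S0 \ A) - q (S0 \ A) A) *
        ind R (act (splitTime Λ m A S0)) *
        (flowAt F pos X (X ∪ A) (pm A) * flowAt F pos (X ∪ A) Y (pm A)) *
        ((∏ i ∈ N, (markFactor a A i (pm A i < 0) : R)) *
          ∏ i ∈ M \ N, (markFactor a (S0 \ A) i (pm A i < 0) : R)) := by
      intro A hA N hN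
      obtain ⟨hA1, hA2⟩ := mem𝒵 A hA
      have hAn : A.Nonempty := ⟨_, hA2⟩
      obtain ⟨f1, f2, f3, f4⟩ := fact A hA1 hAn
      have hNmk : N ⊆ mk := hN.trans Finset.inter_subset_right
      have hAmk : Disjoint A mk := hS0mk.mono_left hA1.1
      have hBmk : Disjoint (S0 \ A) mk := hS0mk.mono_left Finset.sdiff_subset
      have e1 : (A ∪ N) \ mk = A := by
        rw [Finset.union_sdiff_distrib, Finset.sdiff_eq_empty_iff_subset.2 hNmk, Finset.union_empty,
          Finset.sdiff_eq_self_of_disjoint hAmk]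
      have e3 : S \ (A ∪ N) = (S0 \ A) ∪ (M \ N) := by
        ext x
        have := @hAmk
        simp only [hS0, hM, Finset.mem_sdiff, Finset.mem_union, Finset.mem_inter]
        have h1 : x ∈ A → x ∉ mk := fun h => Finset.disjoint_left.1 hAmk h
        have h2 : x ∈ N → x ∈ mk := fun h => hNmk h
        tauto
      have e4 : ((S0 \ A) ∪ (M \ N)) \ mk = S0 \ A := by
        rw [Finset.union_sdiff_distrib, Finset.sdiff_eq_empty_iff_subset.2
          (Finset.sdiff_subset.trans Finset.inter_subset_right : M \ N ⊆ mk), Finset.union_empty,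
          Finset.sdiff_eq_self_of_disjoint hBmk]
      have hdj : Disjoint (A ∪ N) (S \ (A ∪ N)) := Finset.disjoint_sdiff
      have hsub : A ∪ N ⊆ S := Finset.union_subset f2.1 (hN.trans Finset.inter_subset_left)
      have hk := h.k_split (A ∪ N) (S \ (A ∪ N)) (hsub.trans hS) (Finset.sdiff_subset.trans hS) hdj
        (by rw [e1]; exact hAn) (by rw [e3, e4]; exact f1)
      have hlev : levelSet mk (A ∪ N) (S \ (A ∪ N)) = A := by
        rw [levelSet, if_neg, if_neg, e1]
        · rintro ⟨i, hi, hi'⟩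
          obtain ⟨y, hy⟩ := f1
          have : y ∈ S \ (A ∪ N) := e3 ▸ Finset.mem_union_left _ hy
          rw [hi', Finset.mem_singleton] at this
          exact Finset.disjoint_left.1 hBmk hy (this ▸ hi)
        · rintro ⟨i, hi, hi'⟩
          have : pick S ∈ A ∪ N := Finset.mem_union_left _ hA2
          rw [hi', Finset.mem_singleton] at this
          exact Finset.disjoint_left.1 hAmk hA2 (this ▸ hi)
      have hT : nodeTime mk Λ m (A ∪ N) (S \ (A ∪ N)) = splitTime Λ m A S0 := by
        rw [nodeTime, hlev, Finset.union_sdiff_of_subset hsub, splitTime, splitTime, blockS]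
      have hP : nodePush mk Λ m (A ∪ N) (S \ (A ∪ N)) = pm A := by
        rw [nodePush, hT, Finset.union_sdiff_of_subset hsub, pushS]
      have hXA : X ∪ A ⊆ Y := Finset.union_subset hXY (hA1.1.trans (hYX ▸ Finset.sdiff_subset))
      have hXAd : Disjoint X A := Finset.disjoint_left.2 fun x hx hx' => by
        have := hA1.1 hx'; rw [← hYX] at this; exact (Finset.mem_sdiff.1 this).2 hx
      have p1 := ihpart A hA1 hAn N hN X (X ∪ A) Finset.subset_union_left
        (Finset.union_sdiff_cancel_left hXAd) (hY.mono_left hXA)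
      have p2 := ihpart (S0 \ A) (sd A hAn hA1) f1 (M \ N) Finset.sdiff_subset (X ∪ A) Y hXA
        (by rw [← hYX, Finset.sdiff_sdiff_left']
            ext x; simp only [Finset.mem_sdiff, Finset.mem_union, Finset.mem_inter]; tauto) hY
      rw [pm_compl A hA1 hAn] at p2
      simp only [ht]
      rw [hk, hT, hP, p1, e3, p2, e1, e4]
      ring
    -- sum over the distributions of the marks
    have hsum1 : ∑ A ∈ 𝒜.filter (fun A => ¬ S0 ⊆ A), t A =
        ∑ A ∈ 𝒵, ∑ N ∈ M.powerset, t (A ∪ N) := by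
      rw [← Finset.sum_product']
      symm
      refine Finset.sum_bij' (fun x _ => x.1 ∪ x.2) (fun A _ => (A \ mk, A ∩ mk)) ?_ ?_ ?_ ?_ ?_
      · rintro ⟨A, N⟩ hx
        obtain ⟨hA, hN⟩ := Finset.mem_product.1 hx
        rw [Finset.mem_powerset] at hN
        obtain ⟨hA1, hA2⟩ := mem𝒵 A hA
        have hns : ¬ S0 ⊆ A ∪ N := fun h' => hA1.2 fun x hx => by
          rcases Finset.mem_union.1 (h' hx) with h2 | h2
          · exact h2
          · exact absurd (hN h2) (Finset.disjoint_left.1 hSM hx)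
        simp only [h𝒜, Finset.mem_filter, Finset.mem_powerset]
        refine ⟨⟨Finset.union_subset (hA1.1.trans Finset.sdiff_subset)
          (hN.trans Finset.inter_subset_left), Finset.mem_union_left _ hA2, fun h' => hns ?_⟩, hns⟩
        rw [h']; exact Finset.sdiff_subset
      · intro A hA
        simp only [h𝒜, Finset.mem_filter, Finset.mem_powerset] at hA
        simp only [Finset.mem_product, h𝒵, Finset.mem_filter, Finset.mem_powerset]
        refine ⟨⟨Finset.sdiff_subset_sdiff hA.1.1 subset_rfl, Finset.mem_sdiff.2
          ⟨hA.1.2.1, (Finset.mem_sdiff.1 hpS).2⟩, fun h' => hA.2 ?_⟩,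
          Finset.inter_subset_inter_right hA.1.1⟩
        rw [← h']; exact Finset.sdiff_subset
      · rintro ⟨A, N⟩ hx
        obtain ⟨hA, hN⟩ := Finset.mem_product.1 hx
        rw [Finset.mem_powerset] at hN
        have hAmk : Disjoint A mk := hS0mk.mono_left (mem𝒵 A hA).1.1
        have hNmk : N ⊆ mk := hN.trans Finset.inter_subset_right
        refine Prod.ext ?_ ?_
        · simp only
          rw [Finset.union_sdiff_distrib, Finset.sdiff_eq_empty_iff_subset.2 hNmk,
            Finset.union_empty, Finset.sdiff_eq_self_of_disjoint hAmk]
        · simp only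
          rw [Finset.union_inter_distrib_right, Finset.disjoint_iff_inter_eq_empty.1 hAmk,
            Finset.inter_eq_left.2 hNmk, Finset.empty_union]
      · intro A _
        exact Finset.sdiff_union_inter A mk
      · intros; rfl
    set G : Finset E → R := fun A => if act (splitTime Λ m A S0) then
        (ind R (pos A (S0 \ A)) - ind R (pos (S0 \ A) A)) * q A (S0 \ A) *
          flowAt F pos X (X ∪ A) (pm A) * flowAt F pos (X ∪ A) Y (pm A) *
          ∏ i ∈ M, (markFactor a S0 i (pm A i < 0) : R) else 0 with hG
    have hsum2 : ∀ A ∈ 𝒵, ∑ N ∈ M.powerset, t (A ∪ N) = G A + G (S0 \ A) := by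
      intro A hA
      obtain ⟨hA1, hA2⟩ := mem𝒵 A hA
      have hAn : A.Nonempty := ⟨_, hA2⟩
      obtain ⟨f1, f2, f3, f4⟩ := fact A hA1 hAn
      have hsub : A ⊆ Y \ X := hYX ▸ hA1.1
      rw [Finset.sum_congr rfl fun N hN => one A hA N (Finset.mem_powerset.1 hN), ← Finset.mul_sum,
        ← Finset.prod_add]
      rw [Finset.prod_congr rfl fun i _ => by
        rw [← Int.cast_add, markFactor_add a Finset.disjoint_sdiff, Finset.union_sdiff_of_subset hA1.1]]
      have swap : flowAt F pos X (X ∪ (S0 \ A)) (pm A) * flowAt F pos (X ∪ (S0 \ A)) Y (pm A) =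
          flowAt F pos X (X ∪ A) (pm A) * flowAt F pos (X ∪ A) Y (pm A) := by
        have hd1 : ∀ B ⊆ S0, Disjoint X B := fun B hB => Finset.disjoint_left.2 fun x hx hx' => by
          have := hB hx'; rw [← hYX] at this; exact (Finset.mem_sdiff.1 this).2 hx
        have hs1 : ∀ B ⊆ S0, X ∪ B ⊆ Y := fun B hB =>
          Finset.union_subset hXY (hB.trans (hYX ▸ Finset.sdiff_subset))
        have hc : ∀ B ⊆ S0, Y \ (X ∪ B) = S0 \ B := fun B hB => by
          rw [← hYX]; ext x; simp only [Finset.mem_sdiff, Finset.mem_union]; tauto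
        have q1 := ihpart A hA1 hAn ∅ (Finset.empty_subset _) X (X ∪ A) Finset.subset_union_left
          (Finset.union_sdiff_cancel_left (hd1 A hA1.1)) (hY.mono_left (hs1 A hA1.1))
        have q2 := ihpart A hA1 hAn ∅ (Finset.empty_subset _) (X ∪ (S0 \ A)) Y (hs1 _ Finset.sdiff_subset)
          (by rw [hc _ Finset.sdiff_subset, Finset.sdiff_sdiff_eq_self hA1.1]) hY
        have q3 := ihpart (S0 \ A) (sd A hAn hA1) f1 ∅ (Finset.empty_subset _) (X ∪ A) Y (hs1 _ hA1.1)
          (hc _ hA1.1) hY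
        have q4 := ihpart (S0 \ A) (sd A hAn hA1) f1 ∅ (Finset.empty_subset _) X (X ∪ (S0 \ A))
          Finset.subset_union_left (Finset.union_sdiff_cancel_left (hd1 _ Finset.sdiff_subset))
          (hY.mono_left (hs1 _ Finset.sdiff_subset))
        rw [pm_compl A hA1 hAn] at q3 q4
        simp only [Finset.prod_empty, mul_one] at q1 q2 q3 q4
        rw [← q1, ← q2, ← q3, ← q4]
        ring
      simp only [hG]
      rw [f4, pm_compl A hA1 hAn, Finset.sdiff_sdiff_eq_self hA1.1]
      by_cases hact : act (splitTime Λ m A S0)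
      · rw [if_pos hact, if_pos hact, show ind R (act (splitTime Λ m A S0)) = 1 from if_pos hact]
        linear_combination ((ind R (pos A (S0 \ A)) - ind R (pos (S0 \ A) A)) * q (S0 \ A) A *
          ∏ i ∈ M, (markFactor a S0 i (pm A i < 0) : R)) * swap
      · rw [if_neg hact, if_neg hact, show ind R (act (splitTime Λ m A S0)) = 0 from if_neg hact]
        ring
    rw [hsum1, Finset.sum_congr rfl hsum2, Finset.sum_add_distrib]
    -- both halves together run over all proper blocks
    have hall : ∑ A ∈ 𝒵, G A + ∑ A ∈ 𝒵, G (S0 \ A) =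
        ∑ A ∈ S0.powerset.filter (fun A => A.Nonempty ∧ A ≠ S0), G A := by
      rw [← Finset.sum_filter_add_sum_filter_not
        (S0.powerset.filter (fun A => A.Nonempty ∧ A ≠ S0)) (fun A => pick S ∈ A)]
      congr 1
      · refine Finset.sum_congr ?_ fun _ _ => rfl
        ext A; simp only [h𝒵, Finset.mem_filter]
        exact ⟨fun h => ⟨⟨h.1, ⟨_, h.2.1⟩, h.2.2⟩, h.2.1⟩, fun h => ⟨h.1.1, h.2, h.1.2.2⟩⟩
      · refine Finset.sum_bij' (fun A _ => S0 \ A) (fun A _ => S0 \ A) ?_ ?_ ?_ ?_ ?_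
        · intro A hA
          obtain ⟨hA1, hA2⟩ := mem𝒵 A hA
          simp only [Finset.mem_filter, Finset.mem_powerset]
          refine ⟨⟨Finset.sdiff_subset, Finset.sdiff_nonempty.2 hA1.2, (sd A ⟨_, hA2⟩ hA1).ne⟩,
            fun h' => (Finset.mem_sdiff.1 h').2 hA2⟩
        · intro A hA
          simp only [Finset.mem_filter, Finset.mem_powerset] at hA
          simp only [h𝒵, Finset.mem_filter, Finset.mem_powerset]
          refine ⟨Finset.sdiff_subset, Finset.mem_sdiff.2 ⟨hpS, hA.2⟩, ?_⟩
          exact (sd A hA.1.2.1 (Finset.ssubset_iff_subset_ne.2 ⟨hA.1.1, hA.1.2.2⟩)).ne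
        · intro A hA; exact Finset.sdiff_sdiff_eq_self (mem𝒵 A hA).1.1
        · intro A hA
          simp only [Finset.mem_filter, Finset.mem_powerset] at hA
          exact Finset.sdiff_sdiff_eq_self hA.1.1
        · intros; rfl
    rw [hall]
    symm
    refine Finset.sum_bij' (fun Z _ => Z \ X) (fun A _ => X ∪ A) ?_ ?_ ?_ ?_ ?_
    · intro Z hZ
      obtain ⟨h1, h2⟩ := Finset.mem_Ioo.1 hZ
      simp only [Finset.mem_filter, Finset.mem_powerset]
      refine ⟨hYX ▸ Finset.sdiff_subset_sdiff h2.1 subset_rfl, Finset.sdiff_nonempty.2 h1.2, fun h' => ?_⟩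
      obtain ⟨y, hy, hy'⟩ := Finset.exists_of_ssubset h2
      have : y ∈ Z \ X := by
        rw [h', ← hYX]; exact Finset.mem_sdiff.2 ⟨hy, fun h => hy' (h1.1 h)⟩
      exact hy' (Finset.mem_sdiff.1 this).1
    · intro A hA
      simp only [Finset.mem_filter, Finset.mem_powerset] at hA
      obtain ⟨hA1, ⟨x, hx⟩, hA3⟩ := hA
      rw [← hYX] at hA1 hA3
      refine Finset.mem_Ioo.2 ⟨Finset.ssubset_iff_subset_ne.2 ⟨Finset.subset_union_left, fun h' => ?_⟩,
        Finset.ssubset_iff_subset_ne.2 ⟨Finset.union_subset hXY (hA1.trans Finset.sdiff_subset),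
            fun h' => hA3 ?_⟩⟩
      · have : x ∈ X := by rw [h']; exact Finset.mem_union_right _ hx
        exact (Finset.mem_sdiff.1 (hA1 hx)).2 this
      · rw [← h', Finset.union_sdiff_cancel_left]
        exact Finset.disjoint_left.2 fun x hx hx' => (Finset.mem_sdiff.1 (hA1 hx')).2 hx
    · intro Z hZ; exact Finset.union_sdiff_of_subset (Finset.mem_Ioo.1 hZ).1.1
    · intro A hA
      simp only [Finset.mem_filter, Finset.mem_powerset] at hA
      have hA1 := hA.1
      rw [← hYX] at hA1
      exact Finset.union_sdiff_cancel_left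
        (Finset.disjoint_left.2 fun x hx hx' => (Finset.mem_sdiff.1 (hA1 hx')).2 hx)
    · intro Z hZ
      obtain ⟨h1, h2⟩ := Finset.mem_Ioo.1 hZ
      have c1 : S0 \ (Z \ X) = Y \ Z := by
        rw [← hYX]; ext x; simp only [Finset.mem_sdiff]; have := @h1.1 x; tauto
      have c2 : X ∪ (Z \ X) = Z := Finset.union_sdiff_of_subset h1.1
      simp only [hG, c1, c2, hpm]
  · -- a mark splits off
    have key : ∀ A ∈ 𝒜.filter (fun A => S0 ⊆ A), ∀ i ∈ mk, A = S \ {i} → i ∈ S →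
        t A = if act (splitTime Λ m {i} S0) then ((|∑ e ∈ S0, a i e| : ℤ) : R) *
          flowAt F pos X Y (push Λ S0 (splitTime Λ m {i} S0) m) *
          ∏ j ∈ M.erase i, (markFactor a S0 j (push Λ S0 (splitTime Λ m {i} S0) m j < 0) : R) else 0 := by
      intro A hA i hi hAi hiS
      have hA' : A ⊆ S := by rw [hAi]; exact Finset.sdiff_subset
      have hSA : S \ A = {i} := by
        rw [hAi, Finset.sdiff_sdiff_eq_self (Finset.singleton_subset_iff.2 hiS)]
      have hiA : i ∉ A := by rw [hAi]; simp
      have hAmk : A \ mk = S0 := by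
        rw [hAi, hS0]; ext x; simp only [Finset.mem_sdiff, Finset.mem_singleton]
        constructor
        · tauto
        · rintro ⟨h1, h2⟩; exact ⟨⟨h1, fun h => h2 (h ▸ hi)⟩, h2⟩
      have hAm : A ∩ mk = M.erase i := by
        rw [hAi, hM]; ext x; simp only [Finset.mem_sdiff, Finset.mem_singleton, Finset.mem_inter,
          Finset.mem_erase]; tauto
      have hk := h.k_mark_right i hi A hiA
      have hlev : levelSet mk A {i} = {i} := by
        rw [levelSet, if_neg, if_pos ⟨i, hi, rfl⟩]
        rintro ⟨j, hj, hj'⟩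
        have : pick S ∈ A := (Finset.mem_filter.1 (Finset.mem_filter.1 hA).1).2.1
        rw [hj', Finset.mem_singleton] at this
        exact (Finset.mem_sdiff.1 hpS).2 (this ▸ hj)
      have hun : A ∪ {i} = S := by rw [← hSA, Finset.union_sdiff_of_subset hA']
      have hT : nodeTime mk Λ m A {i} = splitTime Λ m {i} S0 := by
        rw [nodeTime, hlev, hun, splitTime, splitTime, blockS]
      have hP : nodePush mk Λ m A {i} = push Λ S0 (splitTime Λ m {i} S0) m := by
        rw [nodePush, hT, hun, pushS]
      simp only [ht]
      rw [hSA, hk, hT, hP, treeSum_of_card_one, hAmk]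
      by_cases hc : ∑ e ∈ S0, a i e = 0
      · simp [hc]
      have hsub : A ⊂ S := Finset.ssubset_iff_subset_ne.2 ⟨hA', fun h' => hiA (h' ▸ hiS)⟩
      have := ih A hsub (push Λ S0 (splitTime Λ m {i} S0) m) X Y hXY (by rw [hAmk, hYX]) hY
        (by rw [hAmk]; exact hne) (by
          rw [hAmk, sum_push, hm, blockSum_self fun e he f hf => h.anti e
            (Finset.disjoint_left.1 hS0mk he) f (Finset.disjoint_left.1 hS0mk hf)]; ring)
        (by
          rw [hAmk, hAm]
          exact hg.push_mark h.mem (Finset.mem_inter.2 ⟨hiS, hi⟩) hSM)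
      rw [this, hAmk, hAm, ind]
      split_ifs <;> ring
    symm
    refine Finset.sum_bij_ne_zero (fun i _ _ => S \ {i}) ?_ ?_ ?_ ?_
    · intro i hi _
      obtain ⟨h1, h2⟩ := Finset.mem_inter.1 hi
      have hs : S0 ⊆ S \ {i} := fun x hx => Finset.mem_sdiff.2 ⟨(Finset.mem_sdiff.1 hx).1, fun h' =>
        (Finset.mem_sdiff.1 hx).2 (Finset.mem_singleton.1 h' ▸ h2)⟩
      simp only [h𝒜, Finset.mem_filter, Finset.mem_powerset]
      refine ⟨⟨Finset.sdiff_subset, hs hpS, fun h' => ?_⟩, hs⟩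
      have : i ∈ S \ {i} := h'.symm ▸ h1
      simp at this
    · intro i hi _ j hj _ hij
      have h1 := (Finset.mem_inter.1 hi).1
      have h2 := (Finset.mem_inter.1 hj).1
      have := congrArg (S \ ·) hij
      simp only [Finset.sdiff_sdiff_eq_self (Finset.singleton_subset_iff.2 h1),
        Finset.sdiff_sdiff_eq_self (Finset.singleton_subset_iff.2 h2)] at this
      exact Finset.singleton_injective this
    · intro A hA htA
      obtain ⟨hA1, hA2⟩ := Finset.mem_filter.1 hA
      simp only [h𝒜, Finset.mem_filter, Finset.mem_powerset] at hA1
      have hsub : S \ A ⊆ mk := fun x hx => by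
        by_contra h'
        exact (Finset.mem_sdiff.1 hx).2 (hA2 (Finset.mem_sdiff.2 ⟨(Finset.mem_sdiff.1 hx).1, h'⟩))
      have hn : (S \ A).Nonempty := Finset.sdiff_nonempty.2 fun h' => hA1.2.2 (hA1.1.antisymm h')
      have hc : (S \ A).card = 1 := by
        have := hn.card_pos
        by_contra h'
        apply htA
        simp only [ht]
        rw [treeSum_marks h hsub (by omega), mul_zero, mul_zero]
      obtain ⟨i, hi⟩ := Finset.card_eq_one.1 hc
      have hi' : i ∈ S \ A := by rw [hi]; simp
      have hiS := (Finset.mem_sdiff.1 hi').1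
      have hAi : A = S \ {i} := by rw [← hi, Finset.sdiff_sdiff_eq_self hA1.1]
      refine ⟨i, Finset.mem_inter.2 ⟨hiS, hsub hi'⟩, ?_, hAi.symm⟩
      rw [← key A hA i (hsub hi') hAi hiS]
      exact htA
    · intro i hi hne'
      obtain ⟨h1, h2⟩ := Finset.mem_inter.1 hi
      refine (key _ ?_ i h2 rfl h1).symm
      have hs : S0 ⊆ S \ {i} := fun x hx => Finset.mem_sdiff.2 ⟨(Finset.mem_sdiff.1 hx).1, fun h' =>
        (Finset.mem_sdiff.1 hx).2 (Finset.mem_singleton.1 h' ▸ h2)⟩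
      simp only [h𝒜, Finset.mem_filter, Finset.mem_powerset]
      refine ⟨⟨Finset.sdiff_subset, hs hpS, fun h' => ?_⟩, hs⟩
      have : i ∈ S \ {i} := h'.symm ▸ h1
      simp at this

open Classical in
/-- Induction on the leaves: the recursion is given by `flow_telescope` and `splitSum_eq`. -/
theorem hasClosedForm (h : IsFlowSystem top mk K Λ a q pos k) (hp : IsPick mk pick) (S : Finset E)
    (hS : S ⊆ top) : HasClosedForm pick k mk K Λ a q pos S := by
  induction S using Finset.strongInduction with
  | _ S ih =>
  intro m X Y hXY hYX hY hne hm hg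
  rcases (show S.card = 1 ∨ 1 < S.card by
    have := (hne.mono Finset.sdiff_subset).card_pos; omega) with h1 | h1
  · obtain ⟨e, rfl⟩ := Finset.card_eq_one.1 h1
    have he : e ∉ mk := by
      obtain ⟨x, hx⟩ := hne
      obtain ⟨h1, h2⟩ := Finset.mem_sdiff.1 hx
      rwa [Finset.mem_singleton.1 h1] at h2
    have e1 : ({e} : Finset E) ∩ mk = ∅ := by
      rw [← Finset.disjoint_iff_inter_eq_empty]; simpa using he
    rw [treeSum_of_card_one, e1, Finset.prod_empty, mul_one, flowAt, flowSum_of_card_le_one]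
    rw [hYX]; exact Finset.card_le_card Finset.sdiff_subset
  set M := S ∩ mk with hM
  have hSM : Disjoint (S \ mk) M := Finset.disjoint_left.2 fun x h1 h2 =>
    (Finset.mem_sdiff.1 h1).2 (Finset.mem_inter.1 h2).2
  have hcardS : (S \ mk).card + M.card = S.card := by
    rw [hM, Finset.card_sdiff_add_card_inter]
  have tel := flow_telescope (R := R) (Q := fun X Z Y => q (Z \ X) (Y \ Z)) h.cocycle (pos := pos)
    (Λ := Λ) (a := a) h.mem (X := X) (Y := Y) (M := M)
    (hY.mono_right Finset.inter_subset_right)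
    (fun e he f hf => h.anti e (Finset.disjoint_left.1 hY he) f (Finset.disjoint_left.1 hY hf))
    (fun A B hA hB => h.pos_iff A B (hY.mono_left hA) (hY.mono_left hB))
    (fun i hi => h.mark_left i (Finset.mem_inter.1 hi).2)
    (by
      rw [hYX, ← Finset.card_pos (s := M)]
      have := hne.card_pos
      omega) (m := m) (by rw [hYX]; exact hg) (0 < ·) (fun _ _ h1 h2 => h1.trans_le h2)
  rw [treeSum_of_one_lt_card _ _ _ h1, splitSum_eq h hp hS
    (fun S' hS' => ih S' hS' (hS'.1.trans hS)) (0 < ·) hXY hYX hY hne hm hg]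
  refine tel.symm.trans ?_
  rw [hYX]
  have hS0mk : Disjoint (S \ mk) mk := Finset.sdiff_disjoint
  congr 1
  · refine flowSum_congr _ _ h.cocycle fun Z hZ => ind_congr ?_
    obtain ⟨z1, z2⟩ := Finset.mem_Ioo.1 hZ
    have hd : Disjoint (Z \ X) (Y \ Z) :=
      Finset.disjoint_left.2 fun x hx hx' => (Finset.mem_sdiff.1 hx').2 (Finset.mem_sdiff.1 hx).1
    have hu : S \ mk = (Z \ X) ∪ (Y \ Z) := by
      rw [← hYX]; ext x; simp only [Finset.mem_sdiff, Finset.mem_union]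
      have := @z1.1 x; have := @z2.1 x; tauto
    have d1 : Disjoint (Z \ X) mk := hY.mono_left (Finset.sdiff_subset.trans z2.1)
    have d2 : Disjoint (Y \ Z) mk := hY.mono_left Finset.sdiff_subset
    have n1 := Finset.sdiff_nonempty.2 z1.2
    have n2 := Finset.sdiff_nonempty.2 z2.2
    have e1 : blockSum Λ (Z \ X) (S \ mk) = blockSum Λ (Z \ X) (Y \ Z) := by
      rw [hu, blockSum_union_right Λ _ hd, blockSum_self (fun e he f hf =>
        h.anti e (Finset.disjoint_left.1 d1 he) f (Finset.disjoint_left.1 d1 hf)), zero_add]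
    have e2 : blockSum Λ (Y \ Z) (Z \ X) = - blockSum Λ (Z \ X) (Y \ Z) :=
      blockSum_swap fun e he f hf => h.anti e (Finset.disjoint_left.1 d2 he) f (Finset.disjoint_left.1 d1 hf)
    have p1 := h.pos_iff _ _ d1 d2 n1 n2 hd
    have p2 := h.pos_iff _ _ d2 d1 n2 n1 hd.symm
    rw [p1.2, p2.2, e2, splitTime, e1]
    have hm0 : ∑ e ∈ Z \ X, m e ≠ 0 := by
      intro h0
      obtain ⟨x, hx⟩ := n1
      obtain ⟨y, hy⟩ := n2
      have := (hg (fun e => if e ∈ Z \ X then 1 else 0)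
        (fun e => by split_ifs; exacts [K.one_mem, K.zero_mem]) (by
          have hz : ∀ i ∈ M, i ∉ Z \ X := fun i hi h' =>
            Finset.disjoint_left.1 d1 h' (Finset.mem_inter.1 hi).2
          rw [Finset.sum_eq_zero (s := M) fun i hi => by simp only [hz i hi, if_false, zero_mul]]
          simp only [ite_mul, one_mul, zero_mul, Finset.sum_ite_mem]
          rw [hu, Finset.union_inter_cancel_left, h0, add_zero])).2 x (hu ▸ Finset.mem_union_left _ hx)
            y (hu ▸ Finset.mem_union_right _ hy)
      have hy' : y ∉ Z \ X := fun h' => Finset.disjoint_left.1 hd h' hy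
      simp only [hx, hy', if_true, if_false] at this
      exact one_ne_zero this
    rw [Left.neg_pos_iff]
    set w := blockSum Λ (Z \ X) (Y \ Z)
    set s := ∑ e ∈ Z \ X, m e
    split_ifs with h2
    · rcases div_pos_iff.1 h2 with h3 | h3
      · simp [h3.1, h3.2]
      · simp [h3.1.not_gt, h3.2.not_gt]
    · have h3 : s / w < 0 := lt_of_le_of_ne (not_lt.1 h2) (div_ne_zero hm0 p1.1)
      rcases div_neg_iff.1 h3 with h3 | h3
      · simp [h3.1, h3.2]
      · simp [h3.1.not_gt, h3.2.not_gt]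
  · refine Finset.prod_congr rfl fun i hi => ?_
    congr 1
    refine markFactor_congr a _ i fun h0 => ?_
    have hi' := (Finset.mem_inter.1 hi).2
    have hb : blockSum Λ {i} (S \ mk) = (∑ e ∈ S \ mk, a i e : ℤ) := by
      simp only [blockSum, Finset.sum_singleton, Int.cast_sum]
      exact Finset.sum_congr rfl fun e _ => h.mark_left i hi' e
    rw [splitTime, hb, Finset.sum_singleton]
    set c := ∑ e ∈ S \ mk, a i e
    have hm0 : m i ≠ 0 := by
      intro h0
      have hiS : ∀ e ∈ S \ mk, e ≠ i := fun e he h' => Finset.disjoint_left.1 hS0mk he (h' ▸ hi')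
      have := (hg (fun e => if e = i then 1 else 0)
        (fun e => by split_ifs; exacts [K.one_mem, K.zero_mem]) (by
          rw [Finset.sum_eq_zero (s := S \ mk) fun e he => by simp only [hiS e he, if_false, zero_mul]]
          simp [h0])).1 i hi
      simp at this
    split_ifs with h2
    · rcases div_pos_iff.1 h2 with h3 | h3
      · have := h3.2; rw [Int.cast_pos] at this; simp [h3.1.not_gt, this.not_gt]
      · have := h3.2; rw [Int.cast_lt_zero] at this; simp [h3.1, this]
    · have h3 : m i / c < 0 := lt_of_le_of_ne (not_lt.1 h2) (div_ne_zero hm0 (by exact_mod_cast h0))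
      rcases div_neg_iff.1 h3 with h3 | h3
      · have := h3.2; rw [Int.cast_lt_zero] at this; simp [h3.1.not_gt, this.not_gt]
      · have := h3.2; rw [Int.cast_pos] at this; simp [h3.1, this]

/-- The weighted number of trees growing from `e₀`. As the time of the first division is arbitrary,
the moving base point runs from `-∞` to `+∞`, and the result depends only on the state at `-∞`,
hence not on the moments. -/
theorem sum_rootWeight_eq (h : IsFlowSystem top mk K Λ a q pos k) (hp : IsPick mk pick) {S : Finset E}
    (hS : S ⊆ top) {m : E → ℝ} (hcard : 1 < (S \ mk).card) (hm : ∑ e ∈ S \ mk, m e = 0)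
    (hg : IsGeneric K (S \ mk) (S ∩ mk) m) :
    ∑ T ∈ canonicalTrees pick S, T.rootWeight k mk Λ m =
      flowSum (fun X Z Y => q (Z \ X) (Y \ Z)) (finalState R pos) ∅ (S \ mk)
        (fun Z => ind R (pos Z ((S \ mk) \ Z))) *
      ∏ i ∈ S ∩ mk, (markFactor a (S \ mk) i (∑ e ∈ S \ mk, a i e < 0) : R) := by
  have h1 : 1 < S.card := hcard.trans_le (Finset.card_le_card Finset.sdiff_subset)
  have hne : (S \ mk).Nonempty := Finset.card_pos.1 (by omega)
  have hY : Disjoint (S \ mk) mk := Finset.sdiff_disjoint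
  have tel := flow_telescope (R := R) (Q := fun X Z Y => q (Z \ X) (Y \ Z)) h.cocycle (pos := pos)
    (Λ := Λ) (a := a) h.mem (X := ∅) (Y := S \ mk) (M := S ∩ mk)
    (hY.mono_right Finset.inter_subset_right)
    (fun e he f hf => h.anti e (Finset.disjoint_left.1 hY he) f (Finset.disjoint_left.1 hY hf))
    (fun A B hA hB => h.pos_iff A B (hY.mono_left hA) (hY.mono_left hB))
    (fun i hi => h.mark_left i (Finset.mem_inter.1 hi).2)
    (by simp only [Finset.sdiff_empty]; exact .inl hcard) (m := m)
    (by simp only [Finset.sdiff_empty]; exact hg) (fun _ => True) (fun _ _ _ _ => trivial)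
  rw [sum_rootWeight _ _ _ h1, splitSum_eq h hp hS (X := ∅) (Y := S \ mk)
    (fun S' hS' => hasClosedForm h hp S' (hS'.1.trans hS)) (fun _ => True) (Finset.empty_subset _)
    Finset.sdiff_empty hY hne hm hg]
  refine Eq.trans tel.symm ?_
  simp only [if_true, Finset.sdiff_empty]

end ClosedForm


/-! ### Perturbation to generic weights -/

section Perturbation

variable {E R : Type*} [DecidableEq E] [CommRing R]

namespace BTree

/-- No node has weight zero. -/
def Nondegenerate (k : Finset E → Finset E → R) : BTree E → Prop
  | leaf _ => True
  | node l r => k l.leaves r.leaves ≠ 0 ∧ l.Nondegenerate k ∧ r.Nondegenerate k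

/-- The product of the weights of the nodes. -/
def coeff (k : Finset E → Finset E → R) : BTree E → R
  | leaf _ => 1
  | node l r => k l.leaves r.leaves * (l.coeff k * r.coeff k)

/-- All the edges, including the one below the root node, have positive length. -/
def AllPos (mk : Finset E) (Λ : E → E → ℝ) : BTree E → (E → ℝ) → Prop
  | leaf _, _ => True
  | node l r, m => 0 < nodeTime mk Λ m l.leaves r.leaves ∧
      l.AllPos mk Λ (nodePush mk Λ m l.leaves r.leaves) ∧
      r.AllPos mk Λ (nodePush mk Λ m l.leaves r.leaves)

/-- Some edge, possibly the one below the root node, has negative length. -/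
def SomeNeg (mk : Finset E) (Λ : E → E → ℝ) : BTree E → (E → ℝ) → Prop
  | leaf _, _ => False
  | node l r, m => nodeTime mk Λ m l.leaves r.leaves < 0 ∨
      l.SomeNeg mk Λ (nodePush mk Λ m l.leaves r.leaves) ∨
      r.SomeNeg mk Λ (nodePush mk Λ m l.leaves r.leaves)

/-- All the edges above the root node have positive length. -/
def RootAllPos (mk : Finset E) (Λ : E → E → ℝ) : BTree E → (E → ℝ) → Prop
  | leaf _, _ => True
  | node l r, m => l.AllPos mk Λ (nodePush mk Λ m l.leaves r.leaves) ∧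
      r.AllPos mk Λ (nodePush mk Λ m l.leaves r.leaves)

/-- Some edge above the root node has negative length. -/
def RootSomeNeg (mk : Finset E) (Λ : E → E → ℝ) : BTree E → (E → ℝ) → Prop
  | leaf _, _ => False
  | node l r, m => l.SomeNeg mk Λ (nodePush mk Λ m l.leaves r.leaves) ∨
      r.SomeNeg mk Λ (nodePush mk Λ m l.leaves r.leaves)

variable {k : Finset E → Finset E → R} {mk : Finset E}

theorem weight_of_allPos {Λ : E → E → ℝ} : ∀ {T : BTree E} {m : E → ℝ}, T.AllPos mk Λ m →
    T.weight k mk Λ m = T.coeff k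
  | leaf _, _, _ => rfl
  | node l r, m, ⟨h, hl, hr⟩ => by
    rw [weight, coeff, weight_of_allPos hl, weight_of_allPos hr, ind, if_pos h, mul_one]

theorem weight_of_someNeg {Λ : E → E → ℝ} : ∀ {T : BTree E} {m : E → ℝ}, T.SomeNeg mk Λ m →
    T.weight k mk Λ m = 0
  | leaf _, _, h => h.elim
  | node l r, m, h => by
    rw [weight]
    rcases h with h | h | h
    · rw [ind, if_neg h.le.not_gt]; ring
    · rw [weight_of_someNeg h]; ring
    · rw [weight_of_someNeg h]; ring

theorem weight_of_not_nondegenerate {Λ : E → E → ℝ} : ∀ {T : BTree E} {m : E → ℝ},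
    ¬ T.Nondegenerate k → T.weight k mk Λ m = 0
  | leaf _, _, h => (h trivial).elim
  | node l r, m, h => by
    rw [weight]
    rw [Nondegenerate, not_and_or, not_and_or, not_not] at h
    rcases h with h | h | h
    · rw [h]; ring
    · rw [weight_of_not_nondegenerate h]; ring
    · rw [weight_of_not_nondegenerate h]; ring

theorem rootWeight_of_rootAllPos {Λ : E → E → ℝ} {T : BTree E} {m : E → ℝ}
    (h : T.RootAllPos mk Λ m) : T.rootWeight k mk Λ m = T.coeff k := by
  cases T with
  | leaf => rfl
  | node l r => rw [rootWeight, coeff, weight_of_allPos h.1, weight_of_allPos h.2]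

theorem rootWeight_of_rootSomeNeg {Λ : E → E → ℝ} {T : BTree E} {m : E → ℝ}
    (h : T.RootSomeNeg mk Λ m) : T.rootWeight k mk Λ m = 0 := by
  cases T with
  | leaf => exact h.elim
  | node l r =>
    rw [rootWeight]
    rcases h with h | h <;> rw [weight_of_someNeg h] <;> ring

theorem rootWeight_of_not_nondegenerate {Λ : E → E → ℝ} {T : BTree E} {m : E → ℝ}
    (h : ¬ T.Nondegenerate k) : T.rootWeight k mk Λ m = 0 := by
  cases T with
  | leaf => exact (h trivial).elim
  | node l r =>
    rw [rootWeight]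
    rw [Nondegenerate, not_and_or, not_and_or, not_not] at h
    rcases h with h | h | h
    · rw [h]; ring
    · rw [weight_of_not_nondegenerate h]; ring
    · rw [weight_of_not_nondegenerate h]; ring

end BTree

open BTree Filter Topology

variable {k : Finset E → Finset E → R} {mk : Finset E}

theorem tendsto_blockSum {ι : Type*} {F : Filter ι} {Λ' : ι → E → E → ℝ} {Λ : E → E → ℝ}
    (hΛ : ∀ e f, Tendsto (fun i => Λ' i e f) F (𝓝 (Λ e f))) (A B : Finset E) :
    Tendsto (fun i => blockSum (Λ' i) A B) F (𝓝 (blockSum Λ A B)) :=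
  tendsto_finsetSum _ fun e _ => tendsto_finsetSum _ fun f _ => hΛ e f

theorem tendsto_nodeTime {ι : Type*} {F : Filter ι} {Λ' : ι → E → E → ℝ} {Λ : E → E → ℝ}
    {m' : ι → E → ℝ} {m : E → ℝ} (hΛ : ∀ e f, Tendsto (fun i => Λ' i e f) F (𝓝 (Λ e f)))
    (hm : ∀ e, Tendsto (fun i => m' i e) F (𝓝 (m e))) {A B : Finset E}
    (h0 : blockSum Λ (levelSet mk A B) (A ∪ B) ≠ 0) :
    Tendsto (fun i => nodeTime mk (Λ' i) (m' i) A B) F (𝓝 (nodeTime mk Λ m A B)) :=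
  (tendsto_finsetSum _ fun e _ => hm e).div (tendsto_blockSum hΛ _ _) h0

theorem tendsto_nodePush {ι : Type*} {F : Filter ι} {Λ' : ι → E → E → ℝ} {Λ : E → E → ℝ}
    {m' : ι → E → ℝ} {m : E → ℝ} (hΛ : ∀ e f, Tendsto (fun i => Λ' i e f) F (𝓝 (Λ e f)))
    (hm : ∀ e, Tendsto (fun i => m' i e) F (𝓝 (m e))) {A B : Finset E}
    (h0 : blockSum Λ (levelSet mk A B) (A ∪ B) ≠ 0) (e : E) :
    Tendsto (fun i => nodePush mk (Λ' i) (m' i) A B e) F (𝓝 (nodePush mk Λ m A B e)) :=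
  (hm e).sub ((tendsto_nodeTime hΛ hm h0).mul (tendsto_finsetSum _ fun f _ => hΛ e f))

theorem eventually_allPos {ι : Type*} {F : Filter ι} {Λ' : ι → E → E → ℝ} {Λ : E → E → ℝ}
    (hΛ : ∀ e f, Tendsto (fun i => Λ' i e f) F (𝓝 (Λ e f)))
    (hk : ∀ A B, k A B ≠ 0 → blockSum Λ (levelSet mk A B) (A ∪ B) ≠ 0) :
    ∀ {T : BTree E} {m' : ι → E → ℝ} {m : E → ℝ}, (∀ e, Tendsto (fun i => m' i e) F (𝓝 (m e))) →
      T.Nondegenerate k → T.AllPos mk Λ m → ∀ᶠ i in F, T.AllPos mk (Λ' i) (m' i)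
  | leaf _, _, _, _, _, _ => Eventually.of_forall fun _ => trivial
  | node l r, _, _, hm, hn, h => by
    have h0 := hk _ _ hn.1
    have hp := tendsto_nodePush hΛ hm h0
    exact ((tendsto_nodeTime hΛ hm h0).eventually_const_lt h.1).and
      ((eventually_allPos hΛ hk hp hn.2.1 h.2.1).and (eventually_allPos hΛ hk hp hn.2.2 h.2.2))

theorem eventually_someNeg {ι : Type*} {F : Filter ι} {Λ' : ι → E → E → ℝ} {Λ : E → E → ℝ}
    (hΛ : ∀ e f, Tendsto (fun i => Λ' i e f) F (𝓝 (Λ e f)))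
    (hk : ∀ A B, k A B ≠ 0 → blockSum Λ (levelSet mk A B) (A ∪ B) ≠ 0) :
    ∀ {T : BTree E} {m' : ι → E → ℝ} {m : E → ℝ}, (∀ e, Tendsto (fun i => m' i e) F (𝓝 (m e))) →
      T.Nondegenerate k → T.SomeNeg mk Λ m → ∀ᶠ i in F, T.SomeNeg mk (Λ' i) (m' i)
  | leaf _, _, _, _, _, h => h.elim
  | node l r, _, _, hm, hn, h => by
    have h0 := hk _ _ hn.1
    have hp := tendsto_nodePush hΛ hm h0
    rcases h with h | h | h
    · exact ((tendsto_nodeTime hΛ hm h0).eventually_lt_const h).mono fun _ h => .inl h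
    · exact (eventually_someNeg hΛ hk hp hn.2.1 h).mono fun _ h => .inr (.inl h)
    · exact (eventually_someNeg hΛ hk hp hn.2.2 h).mono fun _ h => .inr (.inr h)

/-- If no length vanishes unless another one is negative, then the weight of a tree does not change
under a small perturbation of the pairing and of the moments. -/
theorem eventually_rootWeight_eq {ι : Type*} {F : Filter ι} {Λ' : ι → E → E → ℝ} {Λ : E → E → ℝ}
    (hΛ : ∀ e f, Tendsto (fun i => Λ' i e f) F (𝓝 (Λ e f)))
    (hk : ∀ A B, k A B ≠ 0 → blockSum Λ (levelSet mk A B) (A ∪ B) ≠ 0)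
    {T : BTree E} {m' : ι → E → ℝ} {m : E → ℝ} (hm : ∀ e, Tendsto (fun i => m' i e) F (𝓝 (m e)))
    (h : T.Nondegenerate k → T.RootAllPos mk Λ m ∨ T.RootSomeNeg mk Λ m) :
    ∀ᶠ i in F, T.rootWeight k mk (Λ' i) (m' i) = T.rootWeight k mk Λ m := by
  by_cases hn : T.Nondegenerate k
  swap
  · exact Eventually.of_forall fun i => by
      rw [rootWeight_of_not_nondegenerate hn, rootWeight_of_not_nondegenerate hn]
  cases T with
  | leaf => exact Eventually.of_forall fun i => rfl
  | node l r =>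
    have hp := tendsto_nodePush hΛ hm (hk _ _ hn.1)
    rcases h hn with h | h | h
    · filter_upwards [eventually_allPos hΛ hk hp hn.2.1 h.1, eventually_allPos hΛ hk hp hn.2.2 h.2]
        with i h1 h2
      rw [rootWeight_of_rootAllPos (T := node l r) (m := m) h,
        rootWeight_of_rootAllPos (T := node l r) (Λ := Λ' i) (m := m' i) ⟨h1, h2⟩]
    · filter_upwards [eventually_someNeg hΛ hk hp hn.2.1 h] with i h1
      rw [rootWeight_of_rootSomeNeg (T := node l r) (m := m) (Or.inl h),
        rootWeight_of_rootSomeNeg (T := node l r) (Λ := Λ' i) (m := m' i) (Or.inl h1)]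
    · filter_upwards [eventually_someNeg hΛ hk hp hn.2.2 h] with i h1
      rw [rootWeight_of_rootSomeNeg (T := node l r) (m := m) (Or.inr h),
        rootWeight_of_rootSomeNeg (T := node l r) (Λ := Λ' i) (m := m' i) (Or.inr h1)]

end Perturbation

section Generic

open Filter Topology

variable {E : Type*} [Fintype E] [DecidableEq E]

/-- The averages of suitable rational weights over two disjoint sets are different. -/
theorem exists_separating_weights (E : Type*) [Fintype E] [DecidableEq E] :
    ∃ v : E → ℚ, ∀ A B : Finset E, A.Nonempty → B.Nonempty → Disjoint A B →
      (B.card : ℚ) * ∑ e ∈ A, v e - A.card * ∑ e ∈ B, v e ≠ 0 := by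
  let ι := {p : Finset E × Finset E // p.1.Nonempty ∧ p.2.Nonempty ∧ Disjoint p.1 p.2}
  let x : ι → E → ℚ := fun p e => (if e ∈ p.1.1 then (p.1.2.card : ℚ) else 0) -
    if e ∈ p.1.2 then (p.1.1.card : ℚ) else 0
  obtain ⟨f, hf⟩ := Module.exists_dual_forall_apply_ne_zero (K := ℚ) x (fun p h => by
    obtain ⟨⟨A, B⟩, ⟨a, ha⟩, hB, hd⟩ := p
    have := congrFun h a
    have ha' : a ∉ B := Finset.disjoint_left.1 hd ha
    simp only at ha
    simp only [x, ha, ha', if_true, if_false, sub_zero, Pi.zero_apply, Nat.cast_eq_zero,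
      Finset.card_eq_zero] at this
    exact hB.ne_empty this)
  refine ⟨fun e => f (Pi.single e 1), fun A B hA hB hd h => hf ⟨(A, B), hA, hB, hd⟩ ?_⟩
  have e1 : ∀ y : E → ℚ, f y = ∑ e, y e * f (Pi.single e 1) := fun y => by
    conv_lhs => rw [← Finset.univ_sum_single y]
    rw [map_sum]
    refine Finset.sum_congr rfl fun e _ => ?_
    rw [← smul_eq_mul, ← map_smul, ← Pi.single_smul, smul_eq_mul, mul_one]
  rw [e1, ← h]
  simp only [x, sub_mul, ite_mul, zero_mul, Finset.sum_sub_distrib, Finset.sum_ite_mem,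
    Finset.univ_inter, Finset.mul_sum]

/-- The generic families of moments are dense in the families of sum zero. -/
theorem exists_isGeneric_mem_nhds {S M : Finset E} (hS : S.Nonempty) (hSM : Disjoint S M) {m : E → ℝ}
    (hm : ∑ e ∈ S, m e = 0) {O : Set (E → ℝ)} (hO : O ∈ 𝓝 m) :
    ∃ m' ∈ O, ∑ e ∈ S, m' e = 0 ∧ IsGeneric (algebraMap ℚ ℝ).fieldRange S M m' := by
  obtain ⟨e₁, he₁⟩ := hS
  -- rational multiples of a family of reals that is linearly independent over `ℚ` are dense
  obtain ⟨u, hu⟩ : ∃ u : E → ℝ, LinearIndependent ℚ u := by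
    have h1 : (Fintype.card E : Cardinal) ≤ Module.rank ℚ ℝ := by
      rw [Real.rank_rat_real]; exact (Cardinal.nat_lt_continuum _).le
    obtain ⟨s, hs, hli⟩ := le_rank_iff_exists_linearIndependent_finset.1 h1
    let f : E ≃ s := Fintype.equivOfCardEq (by simp [hs])
    exact ⟨fun e => (f e : ℝ), hli.comp f f.injective⟩
  have hu0 : ∀ e, u e ≠ 0 := fun e => hu.ne_zero e
  let Ψ : (E → ℝ) → E → ℝ := fun w e => if e = e₁ then -∑ f ∈ S.erase e₁, w f else w e
  have hΨm : Ψ m = m := by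
    funext e
    simp only [Ψ]
    split_ifs with h
    · rw [← Finset.add_sum_erase S _ he₁] at hm; rw [h]; linarith
    · rfl
  have hΨc : Continuous Ψ := by
    refine continuous_pi fun e => ?_
    simp only [Ψ]
    split_ifs <;> fun_prop
  have hO' : Ψ ⁻¹' O ∈ 𝓝 m := hΨc.continuousAt.preimage_mem_nhds (by rw [hΨm]; exact hO)
  have hd : Dense (Set.univ.pi fun e : E => {x : ℝ | ∃ r : ℚ, r ≠ 0 ∧ x = r * u e}) := by
    refine dense_pi _ fun e _ => ?_
    have h1 : Dense {x : ℝ | ∃ r : ℚ, r ≠ 0 ∧ x = r} := by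
      have := (Rat.denseRange_cast (𝕜 := ℝ)).sdiff_singleton 0
      refine this.mono ?_
      rintro x ⟨⟨r, rfl⟩, hx⟩
      exact ⟨r, fun h => hx (by simp [h]), rfl⟩
    have := (Homeomorph.mulRight₀ (u e) (hu0 e)).surjective.denseRange.dense_image
      (Homeomorph.mulRight₀ (u e) (hu0 e)).continuous h1
    refine this.mono ?_
    rintro _ ⟨_, ⟨r, hr, rfl⟩, rfl⟩
    exact ⟨r, hr, rfl⟩
  obtain ⟨w, hwO, hw⟩ := (mem_closure_iff_nhds.1 (hd m)) _ hO'
  choose r hr0 hr using fun e => hw e (Set.mem_univ e)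
  have hsum : ∑ e ∈ S, Ψ w e = 0 := by
    rw [← Finset.add_sum_erase S _ he₁]
    have : ∑ e ∈ S.erase e₁, Ψ w e = ∑ e ∈ S.erase e₁, w e :=
      Finset.sum_congr rfl fun e he => if_neg (Finset.ne_of_mem_erase he)
    rw [this]; simp [Ψ]
  refine ⟨Ψ w, hwO, hsum, fun a ha h => ?_⟩
  choose b hb using fun e => RingHom.mem_fieldRange.1 (ha e)
  have hΨ : ∀ e, e ≠ e₁ → Ψ w e = r e * u e := fun e he => by
    rw [← hr e]; exact if_neg he
  have hM : ∀ i ∈ M, i ≠ e₁ := fun i hi h => Finset.disjoint_left.1 hSM he₁ (h ▸ hi)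
  have h2 : ∑ e ∈ S.erase e₁, (a e - a e₁) * Ψ w e + ∑ i ∈ M, a i * Ψ w i = 0 := by
    rw [← h, ← Finset.add_sum_erase S (fun e => a e * Ψ w e) he₁]
    rw [← Finset.add_sum_erase S _ he₁] at hsum
    simp only [sub_mul, Finset.sum_sub_distrib, ← Finset.mul_sum]
    linear_combination (-a e₁) * hsum
  set c : E → ℚ := fun e => (if e ∈ S.erase e₁ then (b e - b e₁) * r e else 0) +
    if e ∈ M then b e * r e else 0 with hc
  have h3 : ∑ e, c e • u e = 0 := by
    rw [← h2]
    simp only [hc, add_smul, Finset.sum_add_distrib, ite_smul, zero_smul, Finset.sum_ite_mem,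
      Finset.univ_inter]
    congr 1
    · refine Finset.sum_congr rfl fun e he => ?_
      rw [hΨ e (Finset.ne_of_mem_erase he), ← hb, ← hb, Rat.smul_def]
      simp; ring
    · refine Finset.sum_congr rfl fun e he => ?_
      rw [hΨ e (hM e he), ← hb, Rat.smul_def]
      simp; ring
  have h4 := Fintype.linearIndependent_iff.1 hu c h3
  have hSM' : ∀ e ∈ S, e ∉ M := fun e he => Finset.disjoint_left.1 hSM he
  have key : ∀ e ∈ S, a e = a e₁ := fun e he => by
    by_cases h : e = e₁
    · rw [h]
    · have := h4 e
      simp only [hc, Finset.mem_erase, ne_eq, h, not_false_eq_true, he, and_self, if_true, hSM' e he,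
        if_false, add_zero, mul_eq_zero, hr0, or_false, sub_eq_zero] at this
      rw [← hb, ← hb, this]
  refine ⟨fun i hi => ?_, fun e he f hf => by rw [key e he, key f hf]⟩
  have := h4 i
  have hiS : i ∉ S := fun h => Finset.disjoint_left.1 hSM h hi
  simp only [hc, Finset.mem_erase, hiS, and_false, if_false, hi, if_true, zero_add, mul_eq_zero, hr0,
    or_false] at this
  rw [← hb, this, map_zero]

end Generic


section Constancy

open Filter Topology

variable {E R : Type*} [Fintype E] [DecidableEq E] [CommRing R]

/-- The pairing of two blocks for the form `(e, f) ↦ v e - v f`. -/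
def perturbSum (v : E → ℚ) (A B : Finset E) : ℚ := B.card * ∑ e ∈ A, v e - A.card * ∑ e ∈ B, v e

/-- The sign of the pairing of two blocks for the perturbation of `Λ` by an infinitely small
positive multiple of the form `(e, f) ↦ v e - v f`. -/
def lexPos (Λ : E → E → ℝ) (v : E → ℚ) (A B : Finset E) : Prop :=
  0 < blockSum Λ A B ∨ blockSum Λ A B = 0 ∧ 0 < perturbSum v A B

/-- The evaluation of the tree sum, for a form that may vanish on some blocks and moments that are
only regular. Both are approximated by generic ones, which does not change the weights of the
finitely many trees. -/
theorem sum_rootWeight_eq_of_regular {top mk : Finset E} {Λ : E → E → ℝ} {a : E → E → ℤ}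
    {q : Finset E → Finset E → R} {k : Finset E → Finset E → R} {pick : Finset E → E} {v : E → ℚ}
    (hv : ∀ A B : Finset E, A.Nonempty → B.Nonempty → Disjoint A B → perturbSum v A B ≠ 0)
    (h : IsWeightSystem top mk Λ a q (lexPos Λ v) k) (hint : ∀ e f, ∃ n : ℤ, Λ e f = n)
    (hk : ∀ A B, k A B ≠ 0 → blockSum Λ (levelSet mk A B) (A ∪ B) ≠ 0)
    (hp : IsPick mk pick) {S : Finset E} (hS : S ⊆ top) (hcard : 1 < (S \ mk).card) {m : E → ℝ}
    (hm : ∑ e ∈ S \ mk, m e = 0)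
    (hreg : ∀ T ∈ canonicalTrees pick S, T.Nondegenerate k →
      T.RootAllPos mk Λ m ∨ T.RootSomeNeg mk Λ m) :
    ∑ T ∈ canonicalTrees pick S, T.rootWeight k mk Λ m =
      flowSum (fun X Z Y => q (Z \ X) (Y \ Z)) (finalState R (lexPos Λ v)) ∅ (S \ mk)
        (fun Z => ind R (lexPos Λ v Z ((S \ mk) \ Z))) *
      ∏ i ∈ S ∩ mk, (markFactor a (S \ mk) i (∑ e ∈ S \ mk, a i e < 0) : R) := by
  classical
  set ε : ℕ → ℝ := fun n => 1 / ((n : ℝ) + 1) with hε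
  set Λ' : ℕ → E → E → ℝ := fun n e f =>
    Λ e f + ε n * ((if e ∈ mk ∨ f ∈ mk then 0 else v e - v f : ℚ) : ℝ)
    with hΛ'
  -- the pairing is perturbed along a null sequence, the values on the marks being kept
  have hε0 : Tendsto ε atTop (𝓝 0) := tendsto_one_div_add_atTop_nhds_zero_nat
  have hεpos : ∀ n, 0 < ε n := fun n => by simp only [hε]; positivity
  have hlim : ∀ e f, Tendsto (fun n => Λ' n e f) atTop (𝓝 (Λ e f)) := fun e f => by
    have := (hε0.mul_const ((if e ∈ mk ∨ f ∈ mk then 0 else v e - v f : ℚ) : ℝ)).const_add (Λ e f)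
    simpa only [zero_mul, add_zero] using this
  have hblock : ∀ n, ∀ A B, Disjoint A mk → Disjoint B mk →
      blockSum (Λ' n) A B = blockSum Λ A B + ε n * perturbSum v A B := by
    intro n A B hA hB
    have : ∀ e ∈ A, ∑ f ∈ B, Λ' n e f = ∑ f ∈ B, Λ e f + ε n * (B.card * v e - ∑ f ∈ B, (v f : ℝ)) := by
      intro e he
      have h2 : ∑ f ∈ B, ((if e ∈ mk ∨ f ∈ mk then 0 else v e - v f : ℚ) : ℝ) =
          B.card * v e - ∑ f ∈ B, (v f : ℝ) := by
        rw [← nsmul_eq_mul, ← Finset.sum_const, ← Finset.sum_sub_distrib]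
        refine Finset.sum_congr rfl fun f hf => ?_
        rw [if_neg (not_or.2 ⟨Finset.disjoint_left.1 hA he, Finset.disjoint_left.1 hB hf⟩),
          Rat.cast_sub]
      simp only [hΛ', Finset.sum_add_distrib, ← Finset.mul_sum]
      rw [h2]
    unfold blockSum
    rw [Finset.sum_congr rfl this, Finset.sum_add_distrib, ← Finset.mul_sum, Finset.sum_sub_distrib,
      ← Finset.mul_sum]
    simp [perturbSum]
  have hpos : ∀ᶠ n in atTop, ∀ A B, Disjoint A mk → Disjoint B mk → A.Nonempty → B.Nonempty →
      Disjoint A B → blockSum (Λ' n) A B ≠ 0 ∧ (lexPos Λ v A B ↔ 0 < blockSum (Λ' n) A B) := by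
    rw [eventually_all]; intro A
    rw [eventually_all]; intro B
    by_cases hd : Disjoint A mk ∧ Disjoint B mk ∧ A.Nonempty ∧ B.Nonempty ∧ Disjoint A B
    swap
    · exact Eventually.of_forall fun n h1 h2 h3 h4 h5 => absurd ⟨h1, h2, h3, h4, h5⟩ hd
    obtain ⟨h1, h2, h3, h4, h5⟩ := hd
    have hl := tendsto_blockSum hlim A B
    rcases lt_trichotomy (blockSum Λ A B) 0 with h0 | h0 | h0
    · filter_upwards [hl.eventually_lt_const h0] with n hn _ _ _ _ _
      exact ⟨hn.ne, by simp [lexPos, h0.not_gt, h0.ne, hn.not_gt]⟩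
    · refine Eventually.of_forall fun n _ _ _ _ _ => ?_
      rw [hblock n A B h1 h2, h0, zero_add]
      refine ⟨mul_ne_zero (hεpos n).ne' (by exact_mod_cast hv A B h3 h4 h5), ?_⟩
      rw [mul_pos_iff_of_pos_left (hεpos n)]
      simp [lexPos, h0]
    · filter_upwards [hl.eventually_const_lt h0] with n hn _ _ _ _ _
      exact ⟨hn.ne', by simp [lexPos, h0, hn]⟩
  have hT : ∀ᶠ p : ℕ × (E → ℝ) in atTop ×ˢ 𝓝 m, ∀ T ∈ canonicalTrees pick S,
      T.rootWeight k mk (Λ' p.1) p.2 = T.rootWeight k mk Λ m := by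
    rw [Filter.eventually_all_finset]
    intro T hT
    exact eventually_rootWeight_eq (fun e f => (hlim e f).comp tendsto_fst) hk
      (fun e => ((continuous_apply e).tendsto m).comp tendsto_snd) (hreg T hT)
  obtain ⟨pa, hpa, pb, hpb, hab⟩ := eventually_prod_iff.1 hT
  obtain ⟨n, hn, hnpos⟩ := (hpa.and hpos).exists
  have hSM : Disjoint (S \ mk) (S ∩ mk) := Finset.disjoint_left.2 fun x h1 h2 =>
    (Finset.mem_sdiff.1 h1).2 (Finset.mem_inter.1 h2).2
  obtain ⟨m', hm', hm'0, hgen⟩ := exists_isGeneric_mem_nhds (Finset.card_pos.1 (by omega)) hSM hm hpb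
  have hflow : IsFlowSystem top mk (algebraMap ℚ ℝ).fieldRange (Λ' n) a q (lexPos Λ v) k :=
    { h with
      mark_right := fun e f hf => by simp [hΛ', hf, h.mark_right e f hf]
      anti := fun e he f hf => by
        simp only [hΛ', he, hf, h.anti e he f hf, or_self, if_false,
          Rat.cast_sub]
        ring
      mark_left := fun i hi e => by simp [hΛ', hi, h.mark_left i hi e]
      mem := fun e f => by
        obtain ⟨z, hz⟩ := hint e f
        refine RingHom.mem_fieldRange.2 ⟨z + (1 / ((n : ℚ) + 1)) *
          (if e ∈ mk ∨ f ∈ mk then 0 else v e - v f), ?_⟩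
        simp only [hΛ', hε, hz]
        split_ifs <;> simp
      pos_iff := hnpos }
  rw [← sum_rootWeight_eq hflow hp hS hcard hm'0 hgen]
  exact Finset.sum_congr rfl fun T hT => (hab hn hm' T hT).symm

end Constancy


/-! ### Rooted trees -/

section Rooted

variable {V E : Type*}

/-- A tree with the root `r`, described by the parent `par v` of each vertex `v`; the root is its
own parent, and `rank` shows that iterating `par` leads to the root. -/
structure IsPar (G : SimpleGraph V) (r : V) (par : V → V) (rank : V → ℕ) : Prop where
  root : par r = r
  adj : ∀ v w, G.Adj v w ↔ (v ≠ r ∧ par v = w) ∨ (w ≠ r ∧ par w = v)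
  rank_lt : ∀ v, v ≠ r → rank (par v) < rank v

theorem exists_isPar {G : SimpleGraph V} (hG : G.IsTree) (r : V) :
    ∃ par rank, IsPar G r par rank := by
  classical
  have key : ∀ v, v ≠ r → ∃! w, G.Adj v w ∧ G.dist r v = G.dist r w + 1 := by
    intro v hv
    obtain ⟨p, hp, hpu⟩ := hG.existsUnique_path v r
    have hstep : ∀ w, G.Adj v w ∧ G.dist r v = G.dist r w + 1 → p.snd = w := by
      rintro w ⟨hw, hd⟩
      obtain ⟨q, hq, hlen⟩ := (hG.connected w r).exists_path_of_dist
      have : (SimpleGraph.Walk.cons hw q).IsPath := by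
        rw [SimpleGraph.Walk.cons_isPath_iff]
        refine ⟨hq, fun hmem => ?_⟩
        have h1 := (q.dropUntil v hmem)
        have h2 : G.dist v r ≤ (q.dropUntil v hmem).length := SimpleGraph.dist_le _
        have h3 := q.length_dropUntil_le_length hmem
        rw [G.dist_comm] at hd
        rw [G.dist_comm (u := r) (v := w)] at hd
        omega
      rw [← hpu _ this]
      simp
    have hex : ∃ w, G.Adj v w ∧ G.dist r v = G.dist r w + 1 := by
      obtain ⟨q, hlen⟩ := (hG.connected v r).exists_walk_length_eq_dist
      cases q with
      | nil => exact absurd rfl hv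
      | @cons _ w _ hw q =>
        refine ⟨w, hw, ?_⟩
        have := SimpleGraph.dist_le q
        have h4 := hG.dist_eq_dist_add_one_of_adj r hw
        rw [SimpleGraph.Walk.length_cons] at hlen
        rw [G.dist_comm (u := r) (v := v), G.dist_comm (u := r) (v := w)] at *
        omega
    obtain ⟨w, hw⟩ := hex
    exact ⟨w, hw, fun w' hw' => (hstep w' hw').symm.trans (hstep w hw)⟩
  refine ⟨fun v => if h : v = r then r else (key v h).choose, G.dist r, by simp, fun v w => ?_,
    fun v hv => ?_⟩
  · constructor
    · intro hvw
      rcases hG.dist_eq_dist_add_one_of_adj r hvw with h | h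
      · left
        have hv : v ≠ r := by rintro rfl; simp at h
        refine ⟨hv, ?_⟩
        rw [dif_neg hv]
        exact ((key v hv).choose_spec.2 w ⟨hvw, h⟩).symm
      · right
        have hw : w ≠ r := by rintro rfl; simp at h
        refine ⟨hw, ?_⟩
        rw [dif_neg hw]
        exact ((key w hw).choose_spec.2 v ⟨hvw.symm, h⟩).symm
    · rintro (⟨hv, h⟩ | ⟨hv, h⟩)
      · rw [dif_neg hv] at h; rw [← h]; exact (key v hv).choose_spec.1.1
      · rw [dif_neg hv] at h; rw [← h]; exact (key w hv).choose_spec.1.1.symm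
  · simp only [dif_neg hv]
    have := (key v hv).choose_spec.1.2
    omega

namespace IsPar

variable {G : SimpleGraph V} {r : V} {par : V → V} {rank : V → ℕ}

theorem unique (h : IsPar G r par rank) {par' : V → V} {rank' : V → ℕ}
    (h' : IsPar G r par' rank') (v : V) : par v = par' v := by
  induction hn : rank v using Nat.strong_induction_on generalizing v with
  | _ n ih =>
    by_cases hv : v = r
    · rw [hv, h.root, h'.root]
    have hlt := h.rank_lt v hv
    rcases (h'.adj v (par v)).1 ((h.adj _ _).2 (.inl ⟨hv, rfl⟩)) with h1 | ⟨h1, h2⟩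
    · exact h1.2.symm
    · have h3 := ih _ (hn ▸ hlt) (par v) rfl
      have h4 := h.rank_lt _ h1
      rw [h3, h2] at h4
      omega

theorem exists_iterate_eq_root (h : IsPar G r par rank) (v : V) : ∃ k, par^[k] v = r := by
  induction hn : rank v using Nat.strong_induction_on generalizing v with
  | _ n ih =>
    by_cases hv : v = r
    · exact ⟨0, hv⟩
    · obtain ⟨k, hk⟩ := ih _ (hn ▸ h.rank_lt v hv) _ rfl
      exact ⟨k + 1, hk⟩

theorem rank_iterate_le (h : IsPar G r par rank) (v : V) (k : ℕ) : rank (par^[k] v) ≤ rank v := by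
  induction k with
  | zero => rfl
  | succ k ih =>
    rw [Function.iterate_succ_apply']
    by_cases hv : par^[k] v = r
    · rwa [hv, h.root, ← hv]
    · exact (h.rank_lt _ hv).le.trans ih

theorem isTree [Finite V] (h : IsPar G r par rank) : G.IsTree := by
  classical
  have := Fintype.ofFinite V
  have hconn : G.Connected := by
    have hr : ∀ v, G.Reachable v r := by
      intro v
      induction hn : rank v using Nat.strong_induction_on generalizing v with
      | _ n ih =>
        by_cases hv : v = r
        · rw [hv]
        · exact (((h.adj _ _).2 (.inl ⟨hv, rfl⟩)).reachable).trans
            (ih _ (hn ▸ h.rank_lt v hv) _ rfl)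
    exact { preconnected := fun v w => (hr v).trans (hr w).symm, nonempty := ⟨r⟩ }
  rw [SimpleGraph.isTree_iff_connected_and_card]
  refine ⟨hconn, le_antisymm ?_ hconn.card_vert_le_card_edgeSet_add_one⟩
  have hsurj : Function.Surjective (fun v : {v : V // v ≠ r} =>
      (⟨s(v.1, par v.1), (h.adj _ _).2 (.inl ⟨v.2, rfl⟩)⟩ : G.edgeSet)) := by
    rintro ⟨e, he⟩
    induction e using Sym2.inductionOn with
    | hf v w =>
      rcases (h.adj v w).1 he with ⟨hv, h1⟩ | ⟨hv, h1⟩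
      · exact ⟨⟨v, hv⟩, Subtype.ext (show s(v, par v) = s(v, w) by rw [h1])⟩
      · exact ⟨⟨w, hv⟩, Subtype.ext (show s(w, par w) = s(v, w) by rw [h1, Sym2.eq_swap])⟩
  have h1 : Nat.card G.edgeSet ≤ _ := Nat.card_le_card_of_surjective _ hsurj
  have h2 : Nat.card {v : V // v ≠ r} + 1 = Nat.card V := by
    rw [Nat.card_eq_fintype_card, Nat.card_eq_fintype_card, Fintype.card_subtype_compl,
      Fintype.card_subtype_eq]
    have := Fintype.card_pos_iff.2 ⟨r⟩
    omega
  change _ ≤ _ at h1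
  exact (Nat.add_le_add_right h1 1).trans h2.le

end IsPar

section Clusters

variable [Fintype E] [DecidableEq E]

/-- The labels of the ends above the vertex `v`, where `e₀` is the end at the root vertex. -/
def cluster (endVertex : E → V) (e₀ : E) (par : V → V) (v : V) : Finset E := by
  classical exact Finset.univ.filter fun e => e ≠ e₀ ∧ ∃ k, par^[k] (endVertex e) = v

/-- The labels above a vertex or an unbounded end. -/
def pointCluster (endVertex : E → V) (e₀ : E) (par : V → V) : V ⊕ E → Finset E :=
  Sum.elim (cluster endVertex e₀ par) fun e => {e}

/-- The vertices and unbounded ends immediately above the vertex `v`. -/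
def down [Fintype V] (endVertex : E → V) (e₀ : E) (par : V → V) (v : V) : Finset (V ⊕ E) := by
  classical exact Finset.univ.filter fun x => x ≠ .inl (endVertex e₀) ∧ x ≠ .inr e₀ ∧
    Sum.elim par endVertex x = v

variable [Fintype V] {G : SimpleGraph V} {endVertex : E → V} {e₀ : E} {par : V → V} {rank : V → ℕ}

theorem mem_cluster {v : V} {e : E} :
    e ∈ cluster endVertex e₀ par v ↔ e ≠ e₀ ∧ ∃ k, par^[k] (endVertex e) = v := by
  simp [cluster]

theorem mem_down {v : V} {x : V ⊕ E} : x ∈ down endVertex e₀ par v ↔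
    x ≠ .inl (endVertex e₀) ∧ x ≠ .inr e₀ ∧ Sum.elim par endVertex x = v := by
  simp [down]

namespace IsPar

variable (h : IsPar G (endVertex e₀) par rank)

include h

theorem cluster_root : cluster endVertex e₀ par (endVertex e₀) = Finset.univ.erase e₀ := by
  ext e
  simp [mem_cluster, h.exists_iterate_eq_root (endVertex e)]

theorem mem_cluster_iff {v : V} {e : E} : e ∈ cluster endVertex e₀ par v ↔
    ∃ x ∈ down endVertex e₀ par v, e ∈ pointCluster endVertex e₀ par x := by
  constructor
  · intro he
    obtain ⟨he, k, hk⟩ := mem_cluster.1 he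
    induction k with
    | zero => exact ⟨.inr e, mem_down.2 ⟨by simp, by simpa using he, hk⟩, by simp [pointCluster]⟩
    | succ k ih =>
      rw [Function.iterate_succ_apply'] at hk
      by_cases hw : par^[k] (endVertex e) = endVertex e₀
      · refine ih ?_
        rw [← hk, hw, h.root]
      · exact ⟨.inl (par^[k] (endVertex e)), mem_down.2 ⟨by simpa using hw, by simp, hk⟩,
          mem_cluster.2 ⟨he, k, rfl⟩⟩
  · rintro ⟨x | x, hx, he⟩
    · obtain ⟨he, k, hk⟩ := mem_cluster.1 he
      refine mem_cluster.2 ⟨he, k + 1, ?_⟩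
      rw [Function.iterate_succ_apply', hk]
      exact (mem_down.1 hx).2.2
    · have hx := mem_down.1 hx
      rw [Finset.mem_singleton.1 (show e ∈ ({x} : Finset E) from he)]
      exact mem_cluster.2 ⟨by simpa using hx.2.1, 0, hx.2.2⟩

/-- The vertices below `u` form a chain. -/
theorem eq_of_iterate_eq {u v w : V} {k l : ℕ} (hv : par^[k] u = v) (hw : par^[l] u = w)
    (hkl : k ≤ l) : par^[l - k] v = w := by
  rw [← hv, ← Function.iterate_add_apply, Nat.sub_add_cancel hkl, hw]

theorem iterate_ne {v w : V} (hw : w ≠ endVertex e₀) (hp : par w = v) (k : ℕ) : par^[k] v ≠ w := by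
  intro hk
  have h1 := h.rank_iterate_le v k
  have h2 := h.rank_lt w hw
  rw [hk] at h1
  rw [hp] at h2
  omega

theorem pairwiseDisjoint_down (v : V) {x y : V ⊕ E} (hx : x ∈ down endVertex e₀ par v)
    (hy : y ∈ down endVertex e₀ par v) (hxy : x ≠ y) :
    Disjoint (pointCluster endVertex e₀ par x) (pointCluster endVertex e₀ par y) := by
  have main : ∀ w ≠ endVertex e₀, par w = v → ∀ w' ≠ endVertex e₀, par w' = v → ∀ e k l,
      par^[k] (endVertex e) = w → par^[l] (endVertex e) = w' → k ≤ l → w = w' := by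
    intro w hw hwv w' hw' hwv' e k l hk hl hkl
    have := h.eq_of_iterate_eq hk hl hkl
    obtain hj | ⟨j, hj⟩ : l - k = 0 ∨ ∃ j, l - k = j + 1 := by
      rcases Nat.eq_zero_or_pos (l - k) with h0 | h0
      · exact .inl h0
      · exact .inr ⟨l - k - 1, by omega⟩
    · rw [hj] at this; exact this
    · rw [hj, Function.iterate_succ_apply, hwv] at this
      exact absurd this (h.iterate_ne hw' hwv' j)
  have mixed : ∀ w ≠ endVertex e₀, par w = v → ∀ e, endVertex e = v →
      e ∉ cluster endVertex e₀ par w := by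
    intro w hw hwv e he hmem
    obtain ⟨-, k, hk⟩ := mem_cluster.1 hmem
    exact h.iterate_ne hw hwv k (he ▸ hk)
  rw [Finset.disjoint_left]
  obtain ⟨hx1, hx2, hx3⟩ := mem_down.1 hx
  obtain ⟨hy1, hy2, hy3⟩ := mem_down.1 hy
  intro e hex hey
  rcases x with w | f <;> rcases y with w' | f'
  · obtain ⟨-, k, hk⟩ := mem_cluster.1 hex
    obtain ⟨-, l, hl⟩ := mem_cluster.1 hey
    refine hxy (congrArg _ ?_)
    rcases le_total k l with hkl | hkl
    · exact main w (by simpa using hx1) hx3 w' (by simpa using hy1) hy3 e k l hk hl hkl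
    · exact (main w' (by simpa using hy1) hy3 w (by simpa using hx1) hx3 e l k hl hk hkl).symm
  · obtain rfl := Finset.mem_singleton.1 (show e ∈ ({f'} : Finset E) from hey)
    exact mixed w (by simpa using hx1) hx3 e hy3 hex
  · obtain rfl := Finset.mem_singleton.1 (show e ∈ ({f} : Finset E) from hex)
    exact mixed w' (by simpa using hy1) hy3 e hx3 hey
  · refine hxy (congrArg _ ?_)
    rw [← Finset.mem_singleton.1 (show e ∈ ({f} : Finset E) from hex),
      ← Finset.mem_singleton.1 (show e ∈ ({f'} : Finset E) from hey)]

/-- The sum counts every vertex and every end except for the root vertex and the end `e₀`. -/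
theorem sum_card_down : ∑ v, (down endVertex e₀ par v).card + 2 =
    Fintype.card V + Fintype.card E := by
  classical
  have h1 : ((Finset.univ.erase (.inl (endVertex e₀))).erase (.inr e₀) : Finset (V ⊕ E)).card =
      ∑ v, (down endVertex e₀ par v).card := by
    rw [Finset.card_eq_sum_card_fiberwise (f := Sum.elim par endVertex) (t := Finset.univ)
      (fun _ _ => Finset.mem_coe.2 (Finset.mem_univ _))]
    refine Finset.sum_congr rfl fun v _ => congrArg _ ?_
    ext x
    simp only [Finset.mem_filter, Finset.mem_erase, Finset.mem_univ, mem_down]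
    tauto
  rw [Finset.card_erase_of_mem (by simp), Finset.card_erase_of_mem (by simp), Finset.card_univ,
    Fintype.card_sum] at h1
  have : 0 < Fintype.card V := Fintype.card_pos_iff.2 ⟨endVertex e₀⟩
  have : 0 < Fintype.card E := Fintype.card_pos_iff.2 ⟨e₀⟩
  omega

theorem card_le_and_eq_iff (h2 : ∀ v, 2 ≤ (down endVertex e₀ par v).card) :
    Fintype.card V + 2 ≤ Fintype.card E ∧
    (Fintype.card V + 2 = Fintype.card E ↔ ∀ v, (down endVertex e₀ par v).card = 2) := by
  have h1 := h.sum_card_down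
  have h3 : ∑ v, (down endVertex e₀ par v).card =
      ∑ v : V, ((down endVertex e₀ par v).card - 2) + Fintype.card V * 2 := by
    rw [← Finset.card_univ, ← smul_eq_mul, ← Finset.sum_const, ← Finset.sum_add_distrib]
    exact Finset.sum_congr rfl fun v _ => by have := h2 v; omega
  refine ⟨by omega, ?_⟩
  have h4 : ∑ v : V, ((down endVertex e₀ par v).card - 2) = 0 ↔
      ∀ v, (down endVertex e₀ par v).card = 2 := by
    rw [Finset.sum_eq_zero_iff]
    exact forall_congr' fun v => by have := h2 v; simp; omega
  rw [← h4]
  omega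

variable (h2 : ∀ v, 2 ≤ (down endVertex e₀ par v).card)

include h2

theorem cluster_nonempty (v : V) : (cluster endVertex e₀ par v).Nonempty := by
  induction hn : Finset.univ.sup rank - rank v using Nat.strong_induction_on generalizing v with
  | _ n ih =>
    obtain ⟨x, hx⟩ := Finset.card_pos.1 (lt_of_lt_of_le zero_lt_two (h2 v))
    have : (pointCluster endVertex e₀ par x).Nonempty := by
      obtain ⟨hx1, hx2, hx3⟩ := mem_down.1 hx
      rcases x with w | e
      · have h3 := h.rank_lt w (by simpa using hx1)
        rw [show par w = v from hx3] at h3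
        have h4 := Finset.le_sup (f := rank) (Finset.mem_univ w)
        exact ih _ (by omega) w rfl
      · exact Finset.singleton_nonempty e
    obtain ⟨e, he⟩ := this
    exact ⟨e, h.mem_cluster_iff.2 ⟨x, hx, he⟩⟩

theorem pointCluster_nonempty (x : V ⊕ E) : (pointCluster endVertex e₀ par x).Nonempty := by
  rcases x with v | e
  · exact h.cluster_nonempty h2 v
  · exact Finset.singleton_nonempty e

theorem pointCluster_ssubset {v : V} {x : V ⊕ E} (hx : x ∈ down endVertex e₀ par v) :
    pointCluster endVertex e₀ par x ⊂ cluster endVertex e₀ par v := by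
  refine Finset.ssubset_iff_subset_ne.2 ⟨fun e he => h.mem_cluster_iff.2 ⟨x, hx, he⟩, fun heq => ?_⟩
  obtain ⟨y, hy, hxy⟩ := Finset.exists_mem_ne (lt_of_lt_of_le one_lt_two (h2 v)) x
  obtain ⟨e, he⟩ := h.pointCluster_nonempty h2 y
  have h3 : e ∈ pointCluster endVertex e₀ par x := heq ▸ h.mem_cluster_iff.2 ⟨y, hy, he⟩
  exact Finset.disjoint_left.1 (h.pairwiseDisjoint_down v hy hx hxy) he h3

theorem two_le_card_cluster (v : V) : 2 ≤ (cluster endVertex e₀ par v).card := by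
  obtain ⟨x, hx⟩ := Finset.card_pos.1 (lt_of_lt_of_le zero_lt_two (h2 v))
  have h3 := Finset.card_lt_card (h.pointCluster_ssubset h2 hx)
  have := (h.pointCluster_nonempty h2 x).card_pos
  omega

omit h2 in
theorem cluster_subset_iterate (v : V) (k : ℕ) :
    cluster endVertex e₀ par v ⊆ cluster endVertex e₀ par (par^[k] v) := by
  intro e he
  obtain ⟨he, l, hl⟩ := mem_cluster.1 he
  exact mem_cluster.2 ⟨he, k + l, by rw [Function.iterate_add_apply, hl]⟩

theorem cluster_ssubset_par {v : V} (hv : v ≠ endVertex e₀) :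
    cluster endVertex e₀ par v ⊂ cluster endVertex e₀ par (par v) :=
  h.pointCluster_ssubset h2 (x := .inl v) (mem_down.2 ⟨by simpa using hv, by simp, rfl⟩)

omit h2 in
theorem iterate_of_mem {v w : V} {e : E} (hv : e ∈ cluster endVertex e₀ par v)
    (hw : e ∈ cluster endVertex e₀ par w) : (∃ k, par^[k] v = w) ∨ ∃ k, par^[k] w = v := by
  obtain ⟨-, k, hk⟩ := mem_cluster.1 hv
  obtain ⟨-, l, hl⟩ := mem_cluster.1 hw
  rcases le_total k l with hkl | hkl
  · exact .inl ⟨_, h.eq_of_iterate_eq hk hl hkl⟩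
  · exact .inr ⟨_, h.eq_of_iterate_eq hl hk hkl⟩

omit h2 in
theorem laminar (v w : V) : cluster endVertex e₀ par v ⊆ cluster endVertex e₀ par w ∨
    cluster endVertex e₀ par w ⊆ cluster endVertex e₀ par v ∨
    Disjoint (cluster endVertex e₀ par v) (cluster endVertex e₀ par w) := by
  by_cases hd : Disjoint (cluster endVertex e₀ par v) (cluster endVertex e₀ par w)
  · exact .inr (.inr hd)
  · obtain ⟨e, hv, hw⟩ := Finset.not_disjoint_iff.1 hd
    rcases h.iterate_of_mem hv hw with ⟨k, rfl⟩ | ⟨k, rfl⟩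
    · exact .inl (h.cluster_subset_iterate v k)
    · exact .inr (.inl (h.cluster_subset_iterate w k))

theorem iterate_eq_self_of_subset {w : V} {k : ℕ}
    (hs : cluster endVertex e₀ par (par^[k] w) ⊆ cluster endVertex e₀ par w) : par^[k] w = w := by
  induction k with
  | zero => rfl
  | succ k ih =>
    have h1 := h.cluster_subset_iterate (par^[k] w) 1
    rw [Function.iterate_one, ← Function.iterate_succ_apply' par] at h1
    have h3 := ih (h1.trans hs)
    by_cases hw : w = endVertex e₀
    · rw [Function.iterate_succ_apply', h3, hw, h.root]
    · have h4 := h.cluster_ssubset_par h2 hw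
      rw [Function.iterate_succ_apply', h3] at hs
      exact absurd hs h4.not_subset

theorem cluster_subset_iff {v w : V} :
    cluster endVertex e₀ par v ⊆ cluster endVertex e₀ par w ↔ ∃ k, par^[k] v = w := by
  constructor
  · intro hs
    obtain ⟨e, he⟩ := h.cluster_nonempty h2 v
    rcases h.iterate_of_mem he (hs he) with h3 | ⟨k, rfl⟩
    · exact h3
    · exact ⟨0, h.iterate_eq_self_of_subset h2 hs⟩
  · rintro ⟨k, rfl⟩
    exact h.cluster_subset_iterate v k

theorem cluster_injective : Function.Injective (cluster endVertex e₀ par) := by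
  intro v w hvw
  obtain ⟨k, rfl⟩ := (h.cluster_subset_iff h2).1 hvw.subset
  exact (h.iterate_eq_self_of_subset h2 hvw.symm.subset).symm

theorem cluster_endVertex_subset_iff {e : E} (he : e ≠ e₀) {v : V} :
    cluster endVertex e₀ par (endVertex e) ⊆ cluster endVertex e₀ par v ↔
      e ∈ cluster endVertex e₀ par v := by
  rw [h.cluster_subset_iff h2, mem_cluster]
  simp [he]

/-- A vertex whose cluster is the disjoint union of the clusters of two points has these two points
immediately above it, and no other one. -/
theorem down_eq_pair {v : V} {x y : V ⊕ E} (hx : x ≠ .inr e₀) (hy : y ≠ .inr e₀)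
    (hd : Disjoint (pointCluster endVertex e₀ par x) (pointCluster endVertex e₀ par y))
    (hu : pointCluster endVertex e₀ par x ∪ pointCluster endVertex e₀ par y =
      cluster endVertex e₀ par v) : x ≠ y ∧ ∀ z, z ∈ down endVertex e₀ par v ↔ z = x ∨ z = y := by
  have key : ∀ x y : V ⊕ E, x ≠ .inr e₀ →
      Disjoint (pointCluster endVertex e₀ par x) (pointCluster endVertex e₀ par y) →
      pointCluster endVertex e₀ par x ∪ pointCluster endVertex e₀ par y =
        cluster endVertex e₀ par v → x ∈ down endVertex e₀ par v := by
    intro x y hx hd hu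
    have hss : pointCluster endVertex e₀ par x ⊂ cluster endVertex e₀ par v := by
      refine Finset.ssubset_iff_subset_ne.2 ⟨hu ▸ Finset.subset_union_left, fun heq => ?_⟩
      obtain ⟨e, he⟩ := h.pointCluster_nonempty h2 y
      exact Finset.disjoint_right.1 hd he (heq ▸ hu ▸ Finset.mem_union_right _ he)
    -- the point above `x`
    have hx1 : x ≠ .inl (endVertex e₀) := by
      rintro rfl
      refine hss.not_subset ?_
      change _ ⊆ cluster endVertex e₀ par (endVertex e₀)
      rw [h.cluster_root]
      intro e he
      exact Finset.mem_erase.2 ⟨(mem_cluster.1 he).1, Finset.mem_univ _⟩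
    set w := Sum.elim par endVertex x with hw
    have hxw : x ∈ down endVertex e₀ par w := mem_down.2 ⟨hx1, hx, rfl⟩
    have hwv : cluster endVertex e₀ par w ⊆ cluster endVertex e₀ par v := by
      rcases x with u | e
      · obtain ⟨k, hk⟩ := (h.cluster_subset_iff h2).1 hss.subset
        cases k with
        | zero => exact absurd (congrArg (cluster endVertex e₀ par) hk) hss.ne
        | succ k => exact (h.cluster_subset_iff h2).2 ⟨k, hk⟩
      · exact (h.cluster_endVertex_subset_iff h2 (by simpa using hx)).2
          (hss.subset (Finset.mem_singleton_self e))
    by_contra hne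
    have hwne : w ≠ v := fun h' => hne (h' ▸ hxw)
    have hxs := h.pointCluster_ssubset h2 hxw
    have hwvs : cluster endVertex e₀ par w ⊂ cluster endVertex e₀ par v :=
      Finset.ssubset_iff_subset_ne.2 ⟨hwv, fun h' => hwne (h.cluster_injective h2 h')⟩
    -- a point of `cluster w` outside `pointCluster x` lies in `pointCluster y`
    obtain ⟨f, hf, hf'⟩ := Finset.exists_of_ssubset hxs
    have hfy : f ∈ pointCluster endVertex e₀ par y := by
      have h3 := hwv hf
      rw [← hu] at h3
      exact (Finset.mem_union.1 h3).resolve_left hf'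
    have hy : pointCluster endVertex e₀ par y ⊆ cluster endVertex e₀ par w := by
      rcases y with u | e
      · rcases h.laminar u w with h3 | h3 | h3
        · exact h3
        · obtain ⟨g, hg⟩ := h.pointCluster_nonempty h2 x
          exact absurd (h3 (hxs.subset hg)) (Finset.disjoint_left.1 hd hg)
        · exact absurd hf (Finset.disjoint_left.1 h3 hfy)
      · rw [Finset.mem_singleton.1 (show f ∈ ({e} : Finset E) from hfy)] at hf
        exact Finset.singleton_subset_iff.2 hf
    refine hwvs.not_subset ?_
    rw [← hu]
    exact Finset.union_subset hxs.subset hy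
  have hxv := key x y hx hd hu
  have hyv := key y x hy hd.symm (by rw [Finset.union_comm, hu])
  refine ⟨?_, fun z => ⟨fun hz => ?_, ?_⟩⟩
  · rintro rfl
    obtain ⟨e, he⟩ := h.pointCluster_nonempty h2 x
    exact Finset.disjoint_left.1 hd he he
  · obtain ⟨e, he⟩ := h.pointCluster_nonempty h2 z
    have h4 : e ∈ cluster endVertex e₀ par v := h.mem_cluster_iff.2 ⟨z, hz, he⟩
    rw [← hu] at h4
    rcases Finset.mem_union.1 h4 with h3 | h3
    · left
      by_contra hne
      exact Finset.disjoint_left.1 (h.pairwiseDisjoint_down v hz hxv hne) he h3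
    · right
      by_contra hne
      exact Finset.disjoint_left.1 (h.pairwiseDisjoint_down v hz hyv hne) he h3
  · rintro (rfl | rfl) <;> assumption

end IsPar

end Clusters

end Rooted


/-! ### The lengths of the edges below the nodes of a binary tree -/

section Lengths

variable {E R : Type*} [DecidableEq E] [CommRing R]

/-- The moment of the end `e` produced by the lengths `l` of the edges below the members of `𝓛`, as
the path from the base point to `e` passes along the edges below the sets that contain `e`. -/
def lengthSum (Λ : E → E → ℝ) (𝓛 : Finset (Finset E)) (l : Finset E → ℝ) (e : E) : ℝ :=
  ∑ A ∈ 𝓛 with e ∈ A, l A * ∑ f ∈ A, Λ e f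

theorem lengthSum_congr (Λ : E → E → ℝ) {𝓛 : Finset (Finset E)} {l l' : Finset E → ℝ}
    (h : ∀ A ∈ 𝓛, l A = l' A) (e : E) : lengthSum Λ 𝓛 l e = lengthSum Λ 𝓛 l' e :=
  Finset.sum_congr rfl fun A hA => by rw [h A (Finset.mem_filter.1 hA).1]

theorem lengthSum_eq_of_subset (Λ : E → E → ℝ) {𝓛 𝓛' : Finset (Finset E)} {l : Finset E → ℝ} {e : E}
    (hs : 𝓛' ⊆ 𝓛) (h : ∀ A ∈ 𝓛, A ∉ 𝓛' → e ∈ A → l A = 0) :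
    lengthSum Λ 𝓛 l e = lengthSum Λ 𝓛' l e := by
  refine (Finset.sum_subset (Finset.filter_subset_filter _ hs) fun A hA hA' => ?_).symm
  obtain ⟨h1, h2⟩ := Finset.mem_filter.1 hA
  rw [h A h1 (fun h3 => hA' (Finset.mem_filter.2 ⟨h3, h2⟩)) h2, zero_mul]

namespace BTree

/-- The sets of leaves above the nodes of a tree. -/
def nodes : BTree E → Finset (Finset E)
  | leaf _ => ∅
  | node l r => insert (l.leaves ∪ r.leaves) (l.nodes ∪ r.nodes)

theorem subset_leaves_of_mem_nodes : ∀ {T : BTree E} {A : Finset E}, A ∈ T.nodes → A ⊆ T.leaves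
  | leaf _, A, h => absurd h (Finset.notMem_empty A)
  | node l r, A, h => by
    simp only [nodes, Finset.mem_insert, Finset.mem_union] at h
    rcases h with rfl | h | h
    · exact subset_rfl
    · exact (subset_leaves_of_mem_nodes h).trans Finset.subset_union_left
    · exact (subset_leaves_of_mem_nodes h).trans Finset.subset_union_right

theorem nonempty_of_mem_nodes : ∀ {T : BTree E} {A : Finset E}, A ∈ T.nodes → A.Nonempty
  | leaf _, A, h => absurd h (Finset.notMem_empty A)
  | node l r, A, h => by
    simp only [nodes, Finset.mem_insert, Finset.mem_union] at h
    rcases h with rfl | h | h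
    · exact (node l r).leaves_nonempty
    · exact nonempty_of_mem_nodes h
    · exact nonempty_of_mem_nodes h

section Canonical

variable {pick : Finset E → E}

theorem notMem_nodes_union {l r : BTree E} (hd : Disjoint l.leaves r.leaves) :
    l.leaves ∪ r.leaves ∉ l.nodes ∪ r.nodes := by
  intro h
  rcases Finset.mem_union.1 h with h | h
  · obtain ⟨e, he⟩ := r.leaves_nonempty
    exact Finset.disjoint_right.1 hd he (subset_leaves_of_mem_nodes h (Finset.mem_union_right _ he))
  · obtain ⟨e, he⟩ := l.leaves_nonempty
    exact Finset.disjoint_left.1 hd he (subset_leaves_of_mem_nodes h (Finset.mem_union_left _ he))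

theorem disjoint_nodes {l r : BTree E} (hd : Disjoint l.leaves r.leaves) :
    Disjoint l.nodes r.nodes := by
  rw [Finset.disjoint_left]
  intro A h h'
  obtain ⟨e, he⟩ := nonempty_of_mem_nodes h
  exact Finset.disjoint_left.1 hd (subset_leaves_of_mem_nodes h he) (subset_leaves_of_mem_nodes h' he)

theorem card_nodes : ∀ {T : BTree E}, T.IsCanonical pick → T.nodes.card + 1 = T.leaves.card
  | leaf e, _ => by simp [nodes, leaves]
  | node l r, ⟨hl, hr, hd, _⟩ => by
    rw [nodes, leaves, Finset.card_insert_of_notMem (notMem_nodes_union hd),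
      Finset.card_union_of_disjoint (disjoint_nodes hd), Finset.card_union_of_disjoint hd,
      ← card_nodes hl, ← card_nodes hr]
    omega

theorem two_le_card_of_mem_nodes : ∀ {T : BTree E}, T.IsCanonical pick → ∀ {A : Finset E},
    A ∈ T.nodes → 2 ≤ A.card
  | leaf _, _, A, h => absurd h (Finset.notMem_empty A)
  | node l r, ⟨hl, hr, hd, _⟩, A, h => by
    simp only [nodes, Finset.mem_insert, Finset.mem_union] at h
    rcases h with rfl | h | h
    · rw [Finset.card_union_of_disjoint hd]
      have := l.leaves_nonempty.card_pos
      have := r.leaves_nonempty.card_pos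
      omega
    · exact two_le_card_of_mem_nodes hl h
    · exact two_le_card_of_mem_nodes hr h

theorem laminar_nodes : ∀ {T : BTree E}, T.IsCanonical pick → ∀ {A B : Finset E},
    A ∈ T.nodes → B ∈ T.nodes → A ⊆ B ∨ B ⊆ A ∨ Disjoint A B
  | leaf _, _, A, _, h, _ => absurd h (Finset.notMem_empty A)
  | node l r, hT, A, B, hA, hB => by
    obtain ⟨hl, hr, hd, -⟩ := id hT
    have hA' := subset_leaves_of_mem_nodes hA
    have hB' := subset_leaves_of_mem_nodes hB
    simp only [nodes, Finset.mem_insert, Finset.mem_union] at hA hB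
    rcases hA with rfl | hA
    · exact .inr (.inl hB')
    rcases hB with rfl | hB
    · exact .inl hA'
    rcases hA with hA | hA <;> rcases hB with hB | hB
    · exact laminar_nodes hl hA hB
    · exact .inr (.inr (hd.mono (subset_leaves_of_mem_nodes hA) (subset_leaves_of_mem_nodes hB)))
    · exact .inr (.inr (hd.symm.mono (subset_leaves_of_mem_nodes hA) (subset_leaves_of_mem_nodes hB)))
    · exact laminar_nodes hr hA hB

theorem eq_leaf_or_mem_nodes (T : BTree E) : (∃ e, T = leaf e) ∨ T.leaves ∈ T.nodes := by
  cases T with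
  | leaf e => exact .inl ⟨e, rfl⟩
  | node l r => exact .inr (Finset.mem_insert_self _ _)

theorem eq_leaf_of_leaves {T : BTree E} (hT : T.IsCanonical pick) {i : E} (h : T.leaves = {i}) :
    T = leaf i := by
  rcases T.eq_leaf_or_mem_nodes with ⟨e, rfl⟩ | h'
  · rw [Finset.singleton_injective h]
  · have := two_le_card_of_mem_nodes hT h'
    rw [h, Finset.card_singleton] at this
    omega

theorem nodes_left {l r : BTree E} (hd : Disjoint l.leaves r.leaves) (A : Finset E) :
    A ∈ l.nodes ↔ A ∈ (node l r).nodes ∧ A ⊆ l.leaves := by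
  constructor
  · intro h
    exact ⟨by simp [nodes, h], subset_leaves_of_mem_nodes h⟩
  · rintro ⟨h, hs⟩
    simp only [nodes, Finset.mem_insert, Finset.mem_union] at h
    rcases h with rfl | h | h
    · obtain ⟨e, he⟩ := r.leaves_nonempty
      exact absurd (hs (Finset.mem_union_right _ he)) (Finset.disjoint_right.1 hd he)
    · exact h
    · obtain ⟨e, he⟩ := nonempty_of_mem_nodes h
      exact absurd (subset_leaves_of_mem_nodes h he) (Finset.disjoint_left.1 hd (hs he))

theorem nodes_right {l r : BTree E} (hd : Disjoint l.leaves r.leaves) (A : Finset E) :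
    A ∈ r.nodes ↔ A ∈ (node l r).nodes ∧ A ⊆ r.leaves := by
  rw [nodes_left (r := l) hd.symm, nodes, nodes, Finset.union_comm, Finset.union_comm l.nodes]

/-- A canonical tree is determined by its leaves and its family of nodes. -/
theorem eq_of_nodes_eq : ∀ {T T' : BTree E}, T.IsCanonical pick → T'.IsCanonical pick →
    T.leaves = T'.leaves → T.nodes = T'.nodes → T = T'
  | leaf e, T', _, hT', h, _ => (eq_leaf_of_leaves hT' h.symm).symm
  | node l r, leaf e, hT, _, h, _ => eq_leaf_of_leaves hT h
  | node l r, node l' r', ⟨hl, hr, hd, hp⟩, ⟨hl', hr', hd', hp'⟩, h, hn => by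
    have key : ∀ {l r l' r' : BTree E}, l.leaves ∪ r.leaves = l'.leaves ∪ r'.leaves →
        (node l r).nodes = (node l' r').nodes → Disjoint l.leaves r.leaves →
        Disjoint l'.leaves r'.leaves →
        pick (l.leaves ∪ r.leaves) ∈ l.leaves →
        pick (l'.leaves ∪ r'.leaves) ∈ l'.leaves → l.leaves ⊆ l'.leaves := by
      intro l r l' r' h hn hd hd' hp hp'
      rcases l.eq_leaf_or_mem_nodes with ⟨e, rfl⟩ | hm
      · rw [← h, Finset.mem_singleton.1 (show _ ∈ ({e} : Finset E) from hp)] at hp'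
        exact Finset.singleton_subset_iff.2 hp'
      · have h1 := (nodes_left hd _).1 hm
        rw [hn] at h1
        have h2 := h1.1
        simp only [nodes, Finset.mem_insert, Finset.mem_union] at h2
        rcases h2 with h2 | h2 | h2
        · obtain ⟨e, he⟩ := r.leaves_nonempty
          refine absurd (?_ : e ∈ l.leaves) (Finset.disjoint_right.1 hd he)
          rw [h2, ← h]
          exact Finset.mem_union_right _ he
        · exact subset_leaves_of_mem_nodes h2
        · rw [← h] at hp'
          exact absurd (subset_leaves_of_mem_nodes h2 hp) (Finset.disjoint_left.1 hd' hp')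
    have h1 : l.leaves = l'.leaves :=
      (key h hn hd hd' hp hp').antisymm
      (key (show l'.leaves ∪ r'.leaves = l.leaves ∪ r.leaves from h.symm) hn.symm hd' hd hp' hp)
    have h2 : r.leaves = r'.leaves := by
      have h3 : l.leaves ∪ r.leaves = l'.leaves ∪ r'.leaves := h
      rw [← Finset.union_sdiff_cancel_left hd, h3, h1, Finset.union_sdiff_cancel_left hd']
    rw [eq_of_nodes_eq hl hl' h1 (by ext A; rw [nodes_left hd, nodes_left hd', hn, h1]),
      eq_of_nodes_eq hr hr' h2 (by ext A; rw [nodes_right hd, nodes_right hd', hn, h2])]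

variable {Λ : E → E → ℝ} {mk : Finset E}

theorem lengthSum_node_left {l r : BTree E} (hd : Disjoint l.leaves r.leaves) (c : Finset E → ℝ)
    {e : E} (he : e ∈ l.leaves) : lengthSum Λ (node l r).nodes c e =
      c (l.leaves ∪ r.leaves) * ∑ f ∈ l.leaves ∪ r.leaves, Λ e f + lengthSum Λ l.nodes c e := by
  have h1 : (node l r).nodes.filter (e ∈ ·) =
      insert (l.leaves ∪ r.leaves) (l.nodes.filter (e ∈ ·)) := by
    ext A
    simp only [nodes, Finset.mem_filter, Finset.mem_insert, Finset.mem_union]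
    constructor
    · rintro ⟨rfl | h | h, h'⟩
      · exact .inl rfl
      · exact .inr ⟨h, h'⟩
      · exact absurd (subset_leaves_of_mem_nodes h h') (Finset.disjoint_left.1 hd he)
    · rintro (rfl | ⟨h, h'⟩)
      · exact ⟨.inl rfl, Finset.mem_union_left _ he⟩
      · exact ⟨.inr (.inl h), h'⟩
  rw [lengthSum, h1, Finset.sum_insert]
  · rfl
  · intro h
    exact notMem_nodes_union hd (Finset.mem_union_left _ (Finset.mem_filter.1 h).1)

theorem lengthSum_node_right {l r : BTree E} (hd : Disjoint l.leaves r.leaves) (c : Finset E → ℝ)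
    {e : E} (he : e ∈ r.leaves) : lengthSum Λ (node l r).nodes c e =
      c (l.leaves ∪ r.leaves) * ∑ f ∈ l.leaves ∪ r.leaves, Λ e f + lengthSum Λ r.nodes c e := by
  have := lengthSum_node_left (Λ := Λ) hd.symm c he
  rw [nodes, Finset.union_comm r.leaves, Finset.union_comm r.nodes] at this
  exact this

/-- The moments `m` are those produced by the lengths `c`. -/
def IsLengths (Λ : E → E → ℝ) (T : BTree E) (m : E → ℝ) (c : Finset E → ℝ) : Prop :=
  ∀ e ∈ T.leaves, m e = lengthSum Λ T.nodes c e

theorem isLengths_node {l r : BTree E} (hd : Disjoint l.leaves r.leaves) {m : E → ℝ}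
    {c : Finset E → ℝ} : IsLengths Λ (node l r) m c ↔
      IsLengths Λ l (push Λ (l.leaves ∪ r.leaves) (c (l.leaves ∪ r.leaves)) m) c ∧
      IsLengths Λ r (push Λ (l.leaves ∪ r.leaves) (c (l.leaves ∪ r.leaves)) m) c := by
  constructor
  · intro h
    constructor
    · intro e he
      rw [push, h e (Finset.mem_union_left _ he), lengthSum_node_left hd c he, add_sub_cancel_left]
    · intro e he
      rw [push, h e (Finset.mem_union_right _ he), lengthSum_node_right hd c he, add_sub_cancel_left]
  · rintro ⟨hl, hr⟩ e he
    rcases Finset.mem_union.1 he with he | he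
    · rw [lengthSum_node_left hd c he, ← hl e he, push]; ring
    · rw [lengthSum_node_right hd c he, ← hr e he, push]; ring

theorem IsLengths.congr {T : BTree E} {m : E → ℝ} {c c' : Finset E → ℝ} (h : IsLengths Λ T m c)
    (hc : ∀ A ∈ T.nodes, c A = c' A) : IsLengths Λ T m c' :=
  fun e he => (h e he).trans (lengthSum_congr Λ hc e)

theorem blockSum_sdiff_self (hr : ∀ e, ∀ f ∈ mk, Λ e f = 0)
    (ha : ∀ e ∉ mk, ∀ f ∉ mk, Λ e f = -Λ f e) (S : Finset E) : blockSum Λ (S \ mk) S = 0 := by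
  have h1 : blockSum Λ (S \ mk) S = blockSum Λ (S \ mk) (S \ mk) := by
    refine Finset.sum_congr rfl fun e _ => (Finset.sum_subset Finset.sdiff_subset fun f hf hf' => ?_).symm
    exact hr e f (by simpa [hf] using hf')
  rw [h1, blockSum_self]
  exact fun e he f hf => ha e (Finset.mem_sdiff.1 he).2 f (Finset.mem_sdiff.1 hf).2

theorem IsLengths.sum_eq_zero (hr : ∀ e, ∀ f ∈ mk, Λ e f = 0)
    (ha : ∀ e ∉ mk, ∀ f ∉ mk, Λ e f = -Λ f e) :
    ∀ {T : BTree E}, T.IsCanonical pick → ∀ {m : E → ℝ} {c : Finset E → ℝ}, IsLengths Λ T m c →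
      ∑ e ∈ T.leaves \ mk, m e = 0
  | leaf i, _, m, c, h => by
    refine Finset.sum_eq_zero fun e he => ?_
    rw [h e (Finset.mem_sdiff.1 he).1]
    simp [lengthSum, nodes]
  | node l r, ⟨hl, hr', hd, _⟩, m, c, h => by
    obtain ⟨h1, h2⟩ := (isLengths_node hd).1 h
    have h3 := IsLengths.sum_eq_zero hr ha hl h1
    have h4 := IsLengths.sum_eq_zero hr ha hr' h2
    have h5 := sum_push Λ ((l.leaves ∪ r.leaves) \ mk) (l.leaves ∪ r.leaves)
      (c (l.leaves ∪ r.leaves)) m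
    rw [blockSum_sdiff_self hr ha, Finset.union_sdiff_distrib, Finset.sum_union
      (hd.mono Finset.sdiff_subset Finset.sdiff_subset), h3, h4, ← Finset.union_sdiff_distrib] at h5
    rw [leaves]
    linarith

/-- The length of the edge below the root node is determined by the moments. -/
theorem IsLengths.nodeTime_eq (hr : ∀ e, ∀ f ∈ mk, Λ e f = 0)
    (ha : ∀ e ∉ mk, ∀ f ∉ mk, Λ e f = -Λ f e) {l r : BTree E} (hT : (node l r).IsCanonical pick)
    {m : E → ℝ} {c : Finset E → ℝ} (h : IsLengths Λ (node l r) m c)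
    (hb : blockSum Λ (levelSet mk l.leaves r.leaves) (l.leaves ∪ r.leaves) ≠ 0) :
    nodeTime mk Λ m l.leaves r.leaves = c (l.leaves ∪ r.leaves) := by
  obtain ⟨hl, hr', hd, -⟩ := hT
  obtain ⟨h1, h2⟩ := (isLengths_node hd).1 h
  have h5 := sum_push Λ (levelSet mk l.leaves r.leaves) (l.leaves ∪ r.leaves)
    (c (l.leaves ∪ r.leaves)) m
  have h6 : ∑ e ∈ levelSet mk l.leaves r.leaves,
      push Λ (l.leaves ∪ r.leaves) (c (l.leaves ∪ r.leaves)) m e = 0 := by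
    unfold levelSet
    split_ifs with hi hi'
    · obtain ⟨i, -, hi⟩ := hi
      obtain rfl := eq_leaf_of_leaves hl hi
      refine Finset.sum_eq_zero fun e he => ?_
      rw [h1 e he]
      simp [lengthSum, nodes]
    · obtain ⟨i, -, hi⟩ := hi'
      obtain rfl := eq_leaf_of_leaves hr' hi
      refine Finset.sum_eq_zero fun e he => ?_
      rw [h2 e he]
      simp [lengthSum, nodes]
    · exact h1.sum_eq_zero hr ha hl
  rw [h6] at h5
  rw [nodeTime, splitTime, div_eq_iff hb]
  linarith

variable {k : Finset E → Finset E → R}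

theorem allPos_iff_of_isLengths (hr : ∀ e, ∀ f ∈ mk, Λ e f = 0)
    (ha : ∀ e ∉ mk, ∀ f ∉ mk, Λ e f = -Λ f e)
    (hk : ∀ A B, k A B ≠ 0 → blockSum Λ (levelSet mk A B) (A ∪ B) ≠ 0) {c : Finset E → ℝ} :
    ∀ {T : BTree E}, T.IsCanonical pick → T.Nondegenerate k → ∀ {m : E → ℝ}, IsLengths Λ T m c →
      (T.AllPos mk Λ m ↔ ∀ A ∈ T.nodes, 0 < c A) ∧ (T.SomeNeg mk Λ m ↔ ∃ A ∈ T.nodes, c A < 0)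
  | leaf _, _, _, _, _ => by simp [AllPos, SomeNeg, nodes]
  | node l r, hT, ⟨hn, hnl, hnr⟩, m, h => by
    have ht := h.nodeTime_eq hr ha hT (hk _ _ hn)
    obtain ⟨hl, hr', hd, -⟩ := hT
    obtain ⟨h1, h2⟩ := (isLengths_node hd).1 h
    have h3 := allPos_iff_of_isLengths hr ha hk hl hnl h1
    have h4 := allPos_iff_of_isLengths hr ha hk hr' hnr h2
    simp only [AllPos, SomeNeg, nodePush, ht, h3, h4, nodes, Finset.mem_insert, Finset.mem_union,
      or_imp, forall_and, or_and_right, exists_or, forall_eq, exists_eq_left, and_self]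

theorem rootAllPos_iff_of_isLengths (hr : ∀ e, ∀ f ∈ mk, Λ e f = 0)
    (ha : ∀ e ∉ mk, ∀ f ∉ mk, Λ e f = -Λ f e)
    (hk : ∀ A B, k A B ≠ 0 → blockSum Λ (levelSet mk A B) (A ∪ B) ≠ 0) {c : Finset E → ℝ}
    {T : BTree E} (hT : T.IsCanonical pick) (hn : T.Nondegenerate k) {m : E → ℝ}
    (h : IsLengths Λ T m c) :
    (T.RootAllPos mk Λ m ↔ ∀ A ∈ T.nodes, A ≠ T.leaves → 0 < c A) ∧
      (T.RootSomeNeg mk Λ m ↔ ∃ A ∈ T.nodes, A ≠ T.leaves ∧ c A < 0) := by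
  cases T with
  | leaf _ => simp [RootAllPos, RootSomeNeg, nodes]
  | node l r =>
    have ht := h.nodeTime_eq hr ha hT (hk _ _ hn.1)
    obtain ⟨hl, hr', hd, -⟩ := hT
    obtain ⟨h1, h2⟩ := (isLengths_node hd).1 h
    have h3 := allPos_iff_of_isLengths hr ha hk hl hn.2.1 h1
    have h4 := allPos_iff_of_isLengths hr ha hk hr' hn.2.2 h2
    have h5 : ∀ A, (A ∈ (node l r).nodes ∧ A ≠ (node l r).leaves) ↔ A ∈ l.nodes ∨ A ∈ r.nodes := by
      intro A
      have h6 := notMem_nodes_union hd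
      simp only [nodes, leaves, Finset.mem_insert, Finset.mem_union] at h6 ⊢
      constructor
      · rintro ⟨h | h, h'⟩
        · exact absurd h h'
        · exact h
      · exact fun h => ⟨.inr h, fun h' => h6 (h' ▸ h)⟩
    constructor
    · rw [RootAllPos, nodePush, ht, h3.1, h4.1]
      constructor
      · rintro ⟨h6, h7⟩ A hA hA'
        exact ((h5 A).1 ⟨hA, hA'⟩).elim (h6 A) (h7 A)
      · intro h6
        exact ⟨fun A hA => have := (h5 A).2 (.inl hA); h6 A this.1 this.2,
          fun A hA => have := (h5 A).2 (.inr hA); h6 A this.1 this.2⟩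
    · rw [RootSomeNeg, nodePush, ht, h3.2, h4.2]
      constructor
      · rintro (⟨A, hA, h6⟩ | ⟨A, hA, h6⟩)
        · exact ⟨A, ((h5 A).2 (.inl hA)).1, ((h5 A).2 (.inl hA)).2, h6⟩
        · exact ⟨A, ((h5 A).2 (.inr hA)).1, ((h5 A).2 (.inr hA)).2, h6⟩
      · rintro ⟨A, hA, hA', h6⟩
        exact ((h5 A).1 ⟨hA, hA'⟩).imp (fun h => ⟨A, h, h6⟩) fun h => ⟨A, h, h6⟩

/-- On a tree without nodes of weight zero, the moments of sum zero are produced by suitable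
lengths, which may be negative. -/
theorem exists_isLengths (hr : ∀ e, ∀ f ∈ mk, Λ e f = 0)
    (ha : ∀ e ∉ mk, ∀ f ∉ mk, Λ e f = -Λ f e)
    (hk : ∀ A B, k A B ≠ 0 → blockSum Λ (levelSet mk A B) (A ∪ B) ≠ 0) :
    ∀ {T : BTree E}, T.IsCanonical pick → T.Nondegenerate k → ∀ {m : E → ℝ},
      ∑ e ∈ T.leaves \ mk, m e = 0 → (∀ i ∈ mk, T.leaves = {i} → m i = 0) →
      ∃ c, IsLengths Λ T m c
  | leaf i, _, _, m, h, h' => by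
    refine ⟨0, fun e he => ?_⟩
    obtain rfl := Finset.mem_singleton.1 (show e ∈ ({i} : Finset E) from he)
    have : m e = 0 := by
      by_cases hi : e ∈ mk
      · exact h' e hi rfl
      · rwa [leaves, Finset.sdiff_eq_self_of_disjoint (Finset.disjoint_singleton_left.2 hi),
          Finset.sum_singleton] at h
    simp [this, lengthSum, nodes]
  | node l r, hT, ⟨hn, hnl, hnr⟩, m, h, _ => by
    obtain ⟨hl, hr', hd, -⟩ := hT
    set S := l.leaves ∪ r.leaves with hS
    set t := nodeTime mk Λ m l.leaves r.leaves with ht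
    have hb := hk _ _ hn
    have h0 : ∑ e ∈ levelSet mk l.leaves r.leaves, push Λ S t m e = 0 := by
      rw [sum_push, ht, nodeTime, splitTime, div_mul_cancel₀ _ hb, sub_self]
    have htot : ∑ e ∈ l.leaves \ mk, push Λ S t m e + ∑ e ∈ r.leaves \ mk, push Λ S t m e = 0 := by
      rw [← Finset.sum_union (hd.mono Finset.sdiff_subset Finset.sdiff_subset),
        ← Finset.union_sdiff_distrib, sum_push, blockSum_sdiff_self hr ha, mul_zero, sub_zero]
      exact h
    have hl0 : (∑ e ∈ l.leaves \ mk, push Λ S t m e = 0) ∧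
        (∀ i ∈ mk, l.leaves = {i} → push Λ S t m i = 0) ∧
        ∀ i ∈ mk, r.leaves = {i} → push Λ S t m i = 0 := by
      by_cases hi : ∃ i ∈ mk, l.leaves = {i}
      · rw [levelSet, if_pos hi] at h0
        obtain ⟨i, him, hi⟩ := hi
        refine ⟨?_, ?_, ?_⟩
        · rw [hi, Finset.sdiff_eq_empty_iff_subset.2 (Finset.singleton_subset_iff.2 him),
            Finset.sum_empty]
        · intro j _ hj
          rwa [hj, Finset.sum_singleton] at h0
        · intro j hj hj'
          refine absurd (Finset.sum_eq_zero fun e he => Finset.sum_eq_zero fun f hf => hr e f ?_) hb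
          rw [hi, hj'] at hf
          rcases Finset.mem_union.1 hf with hf | hf
          · rwa [Finset.mem_singleton.1 hf]
          · rwa [Finset.mem_singleton.1 hf]
      · rw [levelSet, if_neg hi] at h0
        by_cases hi' : ∃ i ∈ mk, r.leaves = {i}
        · rw [if_pos hi'] at h0
          obtain ⟨i, him, hi'⟩ := hi'
          rw [hi', Finset.sdiff_eq_empty_iff_subset.2 (Finset.singleton_subset_iff.2 him),
            Finset.sum_empty, add_zero] at htot
          refine ⟨htot, fun j hj hj' => absurd ⟨j, hj, hj'⟩ hi, fun j hj hj' => ?_⟩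
          rwa [hj', Finset.sum_singleton] at h0
        · rw [if_neg hi'] at h0
          exact ⟨h0, fun j hj hj' => absurd ⟨j, hj, hj'⟩ hi, fun j hj hj' => absurd ⟨j, hj, hj'⟩ hi'⟩
    obtain ⟨hl1, hl2, hr2⟩ := hl0
    have hr1 : ∑ e ∈ r.leaves \ mk, push Λ S t m e = 0 := by rwa [hl1, zero_add] at htot
    obtain ⟨cl, hcl⟩ := exists_isLengths hr ha hk hl hnl hl1 hl2
    obtain ⟨cr, hcr⟩ := exists_isLengths hr ha hk hr' hnr hr1 hr2
    have hSn : S ∉ l.nodes ∪ r.nodes := notMem_nodes_union hd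
    refine ⟨fun A => if A = S then t else if A ∈ l.nodes then cl A else cr A,
      (isLengths_node hd).2 ⟨?_, ?_⟩⟩
    · simp only [← hS, if_true]
      refine hcl.congr fun A hA => ?_
      rw [if_neg (show A ≠ S from fun h' => hSn (h' ▸ Finset.mem_union_left _ hA)), if_pos hA]
    · simp only [← hS, if_true]
      refine hcr.congr fun A hA => ?_
      rw [if_neg (show A ≠ S from fun h' => hSn (h' ▸ Finset.mem_union_right _ hA)),
        if_neg (Finset.disjoint_right.1 (disjoint_nodes hd) hA)]

end Canonical

end BTree

end Lengths


/-! ### Slopes on rooted curves -/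

section Flags

variable {V E N : Type*} [Fintype E] [DecidableEq E] [Fintype V] [AddCommGroup N]
  {G : SimpleGraph V} {endVertex : E → V} {e₀ : E} {par : V → V} {rank : V → ℕ}

/-- The flag of an oriented bounded edge. -/
def EdgeFlag.ofDart {v : V} (d : G.Dart) (hd : d.fst = v) : EdgeFlag G endVertex v := .inl ⟨d, hd⟩

/-- The flag of an unbounded end. -/
def EdgeFlag.ofEnd (G : SimpleGraph V) {v : V} (e : E) (he : endVertex e = v) :
    EdgeFlag G endVertex v := .inr ⟨e, he⟩

/-- The flags at a vertex are the edge below it, given by `none`, and the edges to the points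
immediately above it. The slopes are described by the slope `σ x` of the edge ending at the point
`x` from below. -/
theorem IsPar.exists_flagEquiv (h : IsPar G (endVertex e₀) par rank) (v : V) :
    ∃ F : Option {x // x ∈ down endVertex e₀ par v} ≃ EdgeFlag G endVertex v,
      (∀ e (he : endVertex e = v) (hx : .inr e ∈ down endVertex e₀ par v),
        F (some ⟨.inr e, hx⟩) = .inr ⟨e, he⟩) ∧
      ∀ (slope : G.Dart → N) (deg : E → N) (σ : V ⊕ E → N),
      (∀ d : G.Dart, d.snd ≠ endVertex e₀ → par d.snd = d.fst → slope d = σ (.inl d.snd)) →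
      (∀ d : G.Dart, d.fst ≠ endVertex e₀ → par d.fst = d.snd → slope d = -σ (.inl d.fst)) →
      (∀ e, e ≠ e₀ → deg e = σ (.inr e)) → deg e₀ = -σ (.inl (endVertex e₀)) →
      flagSlope slope deg (F none) = -σ (.inl v) ∧
        ∀ x, flagSlope slope deg (F (some x)) = σ x.1 := by
  classical
  let F : Option {x // x ∈ down endVertex e₀ par v} → EdgeFlag G endVertex v := fun o =>
    match o with
    | none => if hv : v = endVertex e₀ then .ofEnd G e₀ hv.symm else
        .ofDart ⟨(v, par v), (h.adj _ _).2 (.inl ⟨hv, rfl⟩)⟩ rfl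
    | some ⟨.inl w, hw⟩ => .inl ⟨⟨(v, w), (h.adj _ _).2
        (.inr ⟨by simpa using (mem_down.1 hw).1, (mem_down.1 hw).2.2⟩)⟩, rfl⟩
    | some ⟨.inr e, he⟩ => .inr ⟨e, (mem_down.1 he).2.2⟩
  -- the other extremity of an edge at `v`
  let other : EdgeFlag G endVertex v → V ⊕ E :=
    fun f => Sum.elim (fun d => .inl d.1.snd) (fun e => .inr e.1) f
  have hF1 : ∀ hv : v = endVertex e₀, F none = .ofEnd G e₀ hv.symm := fun hv => dif_pos hv
  have hF2 : ∀ hv : v ≠ endVertex e₀, F none =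
      .ofDart ⟨(v, par v), (h.adj _ _).2 (.inl ⟨hv, rfl⟩)⟩ rfl := fun hv => dif_neg hv
  have hsome : ∀ x, other (F (some x)) = x.1 := by
    rintro ⟨w | e, hx⟩ <;> rfl
  have hnone : ∀ x, F none ≠ F (some x) := by
    intro x heq
    have h1 := congrArg other heq
    rw [hsome] at h1
    obtain ⟨h2, h3, h4⟩ := mem_down.1 x.2
    by_cases hv : v = endVertex e₀
    · rw [hF1 hv] at h1
      exact h3 h1.symm
    · rw [hF2 hv] at h1
      change Sum.inl (par v) = _ at h1
      rw [← h1] at h2 h4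
      exact h.iterate_ne (by simpa using h2) h4 1 rfl
  have hinj : Function.Injective F := by
    intro x y hxy
    rcases x with _ | x <;> rcases y with _ | y
    · rfl
    · exact absurd hxy (hnone y)
    · exact absurd hxy.symm (hnone x)
    · have h1 := congrArg other hxy
      rw [hsome, hsome] at h1
      rw [Subtype.ext h1]
  have hsurj : Function.Surjective F := by
    rintro (⟨⟨⟨u, w⟩, hd⟩, hu⟩ | ⟨e, he⟩)
    · obtain rfl : u = v := hu
      rcases (h.adj u w).1 hd with ⟨hu, hp⟩ | ⟨hw, hp⟩
      · refine ⟨none, ?_⟩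
        rw [hF2 hu]
        subst hp
        rfl
      · exact ⟨some ⟨.inl w, mem_down.2 ⟨by simpa using hw, by simp, hp⟩⟩, rfl⟩
    · by_cases h0 : e = e₀
      · subst h0
        exact ⟨none, hF1 he.symm⟩
      · exact ⟨some ⟨.inr e, mem_down.2 ⟨by simp, by simpa using h0, he⟩⟩, rfl⟩
  refine ⟨Equiv.ofBijective F ⟨hinj, hsurj⟩, fun e he hx => rfl, ?_⟩
  intro slope deg σ h1 h2 h3 h4
  refine ⟨?_, ?_⟩
  · change flagSlope slope deg (F none) = _
    by_cases hv : v = endVertex e₀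
    · rw [hF1 hv]
      change deg e₀ = _
      rw [h4, hv]
    · rw [hF2 hv]
      exact h2 _ hv rfl
  · rintro ⟨w | e, hx⟩
    · obtain ⟨h5, h6, h7⟩ := mem_down.1 hx
      exact h1 _ (by simpa using h5) h7
    · obtain ⟨h5, h6, h7⟩ := mem_down.1 hx
      exact h3 e (by simpa using h6)

theorem IsPar.card_flags (h : IsPar G (endVertex e₀) par rank) (v : V) :
    Nat.card (EdgeFlag G endVertex v) = (down endVertex e₀ par v).card + 1 := by
  obtain ⟨F, -⟩ := h.exists_flagEquiv (N := ℤ) v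
  rw [← Nat.card_congr F, Nat.card_eq_fintype_card, Fintype.card_option, Fintype.card_coe]

/-- The sum of the slopes of the ends in `A`. -/
def degSum (deg : E → N) (A : Finset E) : N := ∑ e ∈ A, deg e

theorem IsPar.degSum_cluster (h : IsPar G (endVertex e₀) par rank) (deg : E → N) (v : V) :
    degSum deg (cluster endVertex e₀ par v) =
      ∑ x ∈ down endVertex e₀ par v, degSum deg (pointCluster endVertex e₀ par x) := by
  classical
  have h1 : cluster endVertex e₀ par v =
      (down endVertex e₀ par v).biUnion (pointCluster endVertex e₀ par) := by
    ext e
    rw [h.mem_cluster_iff, Finset.mem_biUnion]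
  unfold degSum
  rw [h1, Finset.sum_biUnion]
  exact fun x hx y hy hxy => h.pairwiseDisjoint_down v hx hy hxy

end Flags

section Slopes

variable {N E : Type*} [AddCommGroup N]

theorem toReal_neg (a : N) : toReal (-a) = -toReal a := TensorProduct.tmul_neg _ _

theorem toReal_zero : toReal (0 : N) = 0 := TensorProduct.tmul_zero _ _

theorem toReal_sum {ι : Type*} (s : Finset ι) (f : ι → N) :
    toReal (∑ i ∈ s, f i) = ∑ i ∈ s, toReal (f i) := TensorProduct.tmul_sum _ _ _

@[simp] theorem dualReal_toReal (φ : Module.Dual ℤ N) (n : N) : dualReal φ (toReal n) = φ n := by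
  simp [dualReal, toReal, Module.Dual.baseChange]

@[simp] theorem formReal_toReal (ω : LinearMap.BilinForm ℤ N) (a b : N) :
    formReal ω (toReal a) (toReal b) = ω a b := by
  simp [formReal, toReal]

theorem toReal_injective [Module.Free ℤ N] : Function.Injective (toReal : N → ℝ ⊗[ℤ] N) := by
  intro a b hab
  rw [← sub_eq_zero, ← Module.forall_dual_apply_eq_zero_iff ℤ]
  intro φ
  have := congrArg (dualReal φ) hab
  rw [dualReal_toReal, dualReal_toReal] at this
  rw [map_sub, sub_eq_zero]
  exact_mod_cast this

variable {deg : E → N}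

instance (Γ : Curve deg) : Fintype Γ.V := @Fintype.ofFinite _ Γ.finite_V

theorem Curve.slope_symm [Module.Free ℤ N] (Γ : Curve deg) (d : Γ.graph.Dart) :
    Γ.slope d.symm = -Γ.slope d := by
  have h1 := Γ.affine d
  have h2 := Γ.affine d.symm
  have h3 : (⟨d.symm.edge, d.symm.edge_mem⟩ : Γ.graph.edgeSet) = ⟨d.edge, d.edge_mem⟩ :=
    Subtype.ext d.edge_symm
  rw [h3] at h2
  have h4 : Γ.length ⟨d.edge, d.edge_mem⟩ • toReal (Γ.slope d.symm) =
      Γ.length ⟨d.edge, d.edge_mem⟩ • toReal (-Γ.slope d) := by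
    rw [toReal_neg, smul_neg, ← h1, ← h2, neg_sub]
    rfl
  exact toReal_injective (smul_right_injective _ (Γ.length_pos _).ne' h4)

variable [Fintype E] [DecidableEq E] {e₀ : E}

/-- By the balancing condition, the slope of the edge below a point is the sum of the slopes of the
ends above it. -/
theorem Curve.exists_flagEquiv [Module.Free ℤ N] (Γ : Curve deg) {par : Γ.V → Γ.V} {rank : Γ.V → ℕ}
    (h : IsPar Γ.graph (Γ.endVertex e₀) par rank) :
    (∀ d : Γ.graph.Dart, d.snd ≠ Γ.endVertex e₀ → par d.snd = d.fst →
        Γ.slope d = degSum deg (cluster Γ.endVertex e₀ par d.snd)) ∧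
    deg e₀ = -degSum deg (cluster Γ.endVertex e₀ par (Γ.endVertex e₀)) ∧ ∀ v : Γ.V,
    ∃ F : Option {x // x ∈ down Γ.endVertex e₀ par v} ≃ Γ.FlagAt v,
      (∀ e (he : Γ.endVertex e = v) (hx : .inr e ∈ down Γ.endVertex e₀ par v),
        F (some ⟨.inr e, hx⟩) = .inr ⟨e, he⟩) ∧
      Γ.out (F none) = -degSum deg (cluster Γ.endVertex e₀ par v) ∧
      ∀ x, Γ.out (F (some x)) = degSum deg (pointCluster Γ.endVertex e₀ par x.1) := by
  classical
  let σ : Γ.V ⊕ E → N := Sum.elim (fun v => if hv : v = Γ.endVertex e₀ then -deg e₀ else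
    Γ.slope ⟨(par v, v), (h.adj _ _).2 (.inr ⟨hv, rfl⟩)⟩) deg
  have h1 : ∀ d : Γ.graph.Dart, d.snd ≠ Γ.endVertex e₀ → par d.snd = d.fst →
      Γ.slope d = σ (.inl d.snd) := by
    rintro ⟨⟨v, w⟩, hd⟩ hw hp
    change par w = v at hp
    subst hp
    simp only [σ, Sum.elim_inl]
    rw [dif_neg hw]
  have h2 : ∀ d : Γ.graph.Dart, d.fst ≠ Γ.endVertex e₀ → par d.fst = d.snd →
      Γ.slope d = -σ (.inl d.fst) := by
    intro d hv hp
    rw [← neg_eq_iff_eq_neg, ← Γ.slope_symm]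
    exact h1 d.symm hv hp
  have h3 : ∀ e, e ≠ e₀ → deg e = σ (.inr e) := fun _ _ => rfl
  have h4 : deg e₀ = -σ (.inl (Γ.endVertex e₀)) := by simp [σ]
  have hbal : ∀ v, σ (.inl v) = ∑ x ∈ down Γ.endVertex e₀ par v, σ x := by
    intro v
    obtain ⟨F, -, hF⟩ := h.exists_flagEquiv (N := N) v
    obtain ⟨hn, hs⟩ := hF Γ.slope deg σ h1 h2 h3 h4
    have := Γ.balanced v
    rw [← finsum_comp_equiv F, finsum_eq_sum_of_fintype, Fintype.sum_option, hn] at this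
    simp only [hs] at this
    rw [Finset.sum_coe_sort (down Γ.endVertex e₀ par v) σ] at this
    rw [← sub_eq_zero, ← neg_eq_zero, neg_sub, sub_eq_neg_add, this]
  have hσ : ∀ x, σ x = degSum deg (pointCluster Γ.endVertex e₀ par x) := by
    rintro (v | e)
    · induction hn : Finset.univ.sup rank - rank v using Nat.strong_induction_on generalizing v with
      | _ n ih =>
        rw [hbal]
        refine Eq.trans ?_ (h.degSum_cluster deg v).symm
        refine Finset.sum_congr rfl fun x hx => ?_
        obtain ⟨hx1, hx2, hx3⟩ := mem_down.1 hx
        rcases x with w | e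
        · have h3 := h.rank_lt w (by simpa using hx1)
          rw [show par w = v from hx3] at h3
          have h4 := Finset.le_sup (f := rank) (Finset.mem_univ w)
          exact ih _ (by omega) w rfl
        · simp [σ, degSum, pointCluster]
    · simp [σ, degSum, pointCluster]
  refine ⟨fun d hd hp => (h1 d hd hp).trans (hσ _), h4.trans (by rw [hσ]; rfl), fun v => ?_⟩
  obtain ⟨F, hF0, hF⟩ := h.exists_flagEquiv (N := N) v
  obtain ⟨hn, hs⟩ := hF Γ.slope deg σ h1 h2 h3 h4
  exact ⟨F, hF0, hn.trans (by rw [hσ]; rfl), fun x => (hs x).trans (hσ _)⟩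

theorem Curve.two_le_card_down (Γ : Curve deg) {par : Γ.V → Γ.V} {rank : Γ.V → ℕ}
    (h : IsPar Γ.graph (Γ.endVertex e₀) par rank) (v : Γ.V) :
    2 ≤ (down Γ.endVertex e₀ par v).card := by
  have := Γ.three_le_valence v
  rw [h.card_flags] at this
  omega

theorem Curve.isTrivalentAt_iff (Γ : Curve deg) {par : Γ.V → Γ.V} {rank : Γ.V → ℕ}
    (h : IsPar Γ.graph (Γ.endVertex e₀) par rank) (v : Γ.V) :
    Γ.IsTrivalentAt v ↔ (down Γ.endVertex e₀ par v).card = 2 := by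
  rw [Curve.IsTrivalentAt, Curve.FlagAt, h.card_flags]
  omega

/-- The laminar family of a rooted tree, consisting of the clusters of its vertices. -/
def clusters {V : Type*} [Fintype V] (endVertex : E → V) (e₀ : E) (par : V → V) :
    Finset (Finset E) := Finset.univ.image (cluster endVertex e₀ par)

theorem mem_clusters {V : Type*} [Fintype V] {endVertex : E → V} {e₀ : E} {par : V → V}
    {A : Finset E} : A ∈ clusters endVertex e₀ par ↔ ∃ v, cluster endVertex e₀ par v = A := by
  simp [clusters]

/-- A curve is determined by the position of its root vertex and the lengths of the edges below the
other vertices, considered as a function of the clusters. -/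
theorem Curve.exists_lengths [Module.Free ℤ N] (Γ : Curve deg) {par : Γ.V → Γ.V} {rank : Γ.V → ℕ}
    (h : IsPar Γ.graph (Γ.endVertex e₀) par rank) : ∃ c : Finset E → ℝ,
      (∀ v (hv : v ≠ Γ.endVertex e₀), c (cluster Γ.endVertex e₀ par v) =
        Γ.length ⟨s(v, par v), (h.adj _ _).2 (.inl ⟨hv, rfl⟩)⟩) ∧
      (∀ A ∈ clusters Γ.endVertex e₀ par, A ≠ Finset.univ.erase e₀ → 0 < c A) ∧
      c (Finset.univ.erase e₀) = 0 ∧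
      ∀ v, Γ.h v = Γ.h (Γ.endVertex e₀) + ∑ A ∈ clusters Γ.endVertex e₀ par with
        cluster Γ.endVertex e₀ par v ⊆ A, c A • toReal (degSum deg A) := by
  classical
  have h2 := Γ.two_le_card_down h
  have hinj := h.cluster_injective h2
  let l : Γ.V → ℝ := fun v => if hv : v = Γ.endVertex e₀ then 0 else
    Γ.length ⟨s(v, par v), (h.adj _ _).2 (.inl ⟨hv, rfl⟩)⟩
  have hl : ∀ v, Function.extend (cluster Γ.endVertex e₀ par) l 0 (cluster Γ.endVertex e₀ par v) = l v :=
    fun v => hinj.extend_apply _ _ _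
  refine ⟨Function.extend (cluster Γ.endVertex e₀ par) l 0, fun v hv => ?_, fun A hA hA' => ?_, ?_,
    fun v => ?_⟩
  · rw [hl]; simp only [l]; rw [dif_neg hv]
  · obtain ⟨v, -, rfl⟩ := Finset.mem_image.1 hA
    have hv : v ≠ Γ.endVertex e₀ := fun h' => hA' (h' ▸ h.cluster_root)
    rw [hl]
    simp only [l]
    rw [dif_neg hv]
    exact Γ.length_pos _
  · rw [← h.cluster_root, hl]
    simp [l]
  · rw [clusters, Finset.filter_image, Finset.sum_image hinj.injOn]
    simp only [hl]
    induction hn : rank v using Nat.strong_induction_on generalizing v with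
    | _ n ih =>
      by_cases hv : v = Γ.endVertex e₀
      · have : (Finset.univ.filter fun a => cluster Γ.endVertex e₀ par v ⊆
            cluster Γ.endVertex e₀ par a) = {v} := by
          ext w
          simp only [Finset.mem_filter, Finset.mem_univ, true_and, Finset.mem_singleton]
          refine ⟨fun hs => ?_, fun hs => hs ▸ subset_rfl⟩
          obtain ⟨k, rfl⟩ := (h.cluster_subset_iff h2).1 hs
          rw [hv, Function.iterate_fixed h.root]
        rw [this, Finset.sum_singleton, hv]
        simp [l]
      · have : (Finset.univ.filter fun a => cluster Γ.endVertex e₀ par v ⊆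
            cluster Γ.endVertex e₀ par a) = insert v (Finset.univ.filter fun a =>
              cluster Γ.endVertex e₀ par (par v) ⊆ cluster Γ.endVertex e₀ par a) := by
          ext w
          simp only [Finset.mem_filter, Finset.mem_univ, true_and, Finset.mem_insert,
            h.cluster_subset_iff h2]
          constructor
          · rintro ⟨k, rfl⟩
            cases k with
            | zero => exact .inl rfl
            | succ k => exact .inr ⟨k, rfl⟩
          · rintro (rfl | ⟨k, rfl⟩)
            · exact ⟨0, rfl⟩
            · exact ⟨k + 1, rfl⟩
        rw [this, Finset.sum_insert]
        · have h3 := ih _ (hn ▸ h.rank_lt v hv) (par v) rfl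
          have h4 := Γ.affine ⟨(par v, v), (h.adj _ _).2 (.inr ⟨hv, rfl⟩)⟩
          rw [(Γ.exists_flagEquiv h).1 _ hv rfl] at h4
          change Γ.h v - Γ.h (par v) = _ at h4
          have h5 : l v = Γ.length ⟨s(par v, v), (h.adj _ _).2 (.inr ⟨hv, rfl⟩)⟩ := by
            simp only [l]
            rw [dif_neg hv]
            congr 1
            exact Subtype.ext Sym2.eq_swap
          rw [sub_eq_iff_eq_add, h3] at h4
          rw [h4, h5, add_left_comm]
          rfl
        · simp only [Finset.mem_filter, Finset.mem_univ, true_and]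
          exact (h.cluster_ssubset_par h2 hv).not_subset

end Slopes


/-! ### The curve defined by a laminar family -/

section Builder

variable {E : Type*} [Fintype E] [DecidableEq E]

/-- The laminar families of sets with at least two elements that contain the set of all the ends
except `e₀`. -/
structure IsLaminar (e₀ : E) (𝓛 : Finset (Finset E)) : Prop where
  root : Finset.univ.erase e₀ ∈ 𝓛
  notMem : ∀ A ∈ 𝓛, e₀ ∉ A
  two_le : ∀ A ∈ 𝓛, 2 ≤ A.card
  laminar : ∀ A ∈ 𝓛, ∀ B ∈ 𝓛, A ⊆ B ∨ B ⊆ A ∨ Disjoint A B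

/-- A laminar family is the family of clusters of a rooted tree: the parent of a set is the smallest
member that contains it properly, and an end is adjacent to the smallest member containing it. -/
theorem IsLaminar.exists_isPar {e₀ : E} {𝓛 : Finset (Finset E)} (h : IsLaminar e₀ 𝓛)
    {V : Type} [Fintype V] {A : V → Finset E} (hA : Function.Injective A)
    (hr : ∀ B, B ∈ 𝓛 ↔ ∃ v, A v = B) :
    ∃ (G : SimpleGraph V) (endVertex : E → V) (par : V → V) (rank : V → ℕ),
      IsPar G (endVertex e₀) par rank ∧ ∀ v, cluster endVertex e₀ par v = A v := by
  classical
  have hmem : ∀ v, A v ∈ 𝓛 := fun v => (hr _).2 ⟨v, rfl⟩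
  obtain ⟨r, hroot⟩ := (hr _).1 h.root
  have hsub : ∀ v, A v ⊆ A r := fun v e he => by
    rw [hroot]
    exact Finset.mem_erase.2 ⟨fun h' => h.notMem _ (hmem v) (h' ▸ he), Finset.mem_univ _⟩
  have hne : ∀ v, (A v).Nonempty := fun v =>
    Finset.card_pos.1 (lt_of_lt_of_le zero_lt_two (h.two_le _ (hmem v)))
  -- the smallest cluster with a property satisfied by comparable clusters only
  have hmin : ∀ P : V → Prop, P r → (∀ v w, P v → P w → ¬ Disjoint (A v) (A w)) →
      ∃ w, P w ∧ ∀ v, P v → A w ⊆ A v := by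
    intro P hP hd
    obtain ⟨w, hw, hw'⟩ := Finset.exists_min_image (Finset.univ.filter P) (fun v => (A v).card)
      ⟨r, by simpa using hP⟩
    refine ⟨w, (Finset.mem_filter.1 hw).2, fun v hv => ?_⟩
    rcases h.laminar _ (hmem w) _ (hmem v) with h1 | h1 | h1
    · exact h1
    · exact (Finset.eq_of_subset_of_card_le h1 (hw' v (by simpa using hv))).symm.subset
    · exact absurd h1 (hd w v (Finset.mem_filter.1 hw).2 hv)
  have hpar : ∀ v, ∃ w, (v = r → w = r) ∧ (v ≠ r → A v ⊂ A w ∧ ∀ u, A v ⊂ A u → A w ⊆ A u) := by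
    intro v
    by_cases hv : v = r
    · exact ⟨r, fun _ => rfl, fun h' => absurd hv h'⟩
    · obtain ⟨w, hw⟩ := hmin (fun w => A v ⊂ A w)
        (Finset.ssubset_iff_subset_ne.2 ⟨hsub v, fun h' => hv (hA h')⟩) (fun u w hu hw hd => by
          obtain ⟨e, he⟩ := hne v
          exact Finset.disjoint_left.1 hd (hu.subset he) (hw.subset he))
      exact ⟨w, fun h' => absurd h' hv, fun _ => hw⟩
  choose par hpar0 hpar1 using hpar
  have hend : ∀ e, ∃ w, (e = e₀ → w = r) ∧ (e ≠ e₀ → e ∈ A w ∧ ∀ u, e ∈ A u → A w ⊆ A u) := by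
    intro e
    by_cases he : e = e₀
    · exact ⟨r, fun _ => rfl, fun h' => absurd he h'⟩
    · obtain ⟨w, hw⟩ := hmin (fun w => e ∈ A w) (by rw [hroot]; simpa using he)
        (fun u w hu hw hd => Finset.disjoint_left.1 hd hu hw)
      exact ⟨w, fun h' => absurd h' he, fun _ => hw⟩
  choose endVertex hend0 hend1 using hend
  have hlt : ∀ v, v ≠ r → Fintype.card E - (A (par v)).card < Fintype.card E - (A v).card := by
    intro v hv
    have h1 := Finset.card_lt_card (hpar1 v hv).1
    have h2 := Finset.card_le_univ (A (par v))
    omega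
  let G : SimpleGraph V :=
    { Adj := fun v w => (v ≠ r ∧ par v = w) ∨ (w ≠ r ∧ par w = v)
      symm := ⟨fun v w => Or.symm⟩
      loopless := ⟨fun v hv => by
        have h1 : v ≠ r ∧ par v = v := hv.elim id id
        have h2 := (hpar1 v h1.1).1
        rw [h1.2] at h2
        exact (ssubset_irrefl _ h2)⟩ }
  have he₀ : endVertex e₀ = r := hend0 e₀ rfl
  have hP : IsPar G (endVertex e₀) par (fun v => Fintype.card E - (A v).card) := by
    rw [he₀]
    exact { root := hpar0 r rfl, adj := fun v w => Iff.rfl, rank_lt := hlt }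
  refine ⟨G, endVertex, par, _, hP, fun v => ?_⟩
  have hchain : ∀ n u v, (A v).card - (A u).card = n → A u ⊆ A v → ∃ k, par^[k] u = v := by
    intro n
    induction n using Nat.strong_induction_on with
    | _ n ih =>
      intro u v hn huv
      by_cases h1 : u = v
      · exact ⟨0, h1⟩
      · have h2 : A u ⊂ A v := Finset.ssubset_iff_subset_ne.2 ⟨huv, fun h' => h1 (hA h')⟩
        have h3 : u ≠ r := by
          rintro rfl
          exact h2.not_subset (hsub v)
        have h4 := (hpar1 u h3).2 v h2
        have h5 := Finset.card_lt_card (hpar1 u h3).1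
        have h6 := Finset.card_le_card h4
        obtain ⟨k, hk⟩ := ih _ (by omega) (par u) v rfl h4
        exact ⟨k + 1, hk⟩
  have hup : ∀ k u, A u ⊆ A (par^[k] u) := by
    intro k
    induction k with
    | zero => exact fun u => subset_rfl
    | succ k ih =>
      intro u
      refine subset_trans ?_ (ih (par u))
      by_cases hu : u = r
      · rw [hu, hpar0 r rfl]
      · exact (hpar1 u hu).1.subset
  ext e
  rw [mem_cluster]
  constructor
  · rintro ⟨he, k, rfl⟩
    exact hup k _ (hend1 e he).1
  · intro he
    have h0 : e ≠ e₀ := fun h' => h.notMem _ (hmem v) (h' ▸ he)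
    exact ⟨h0, hchain _ _ _ rfl ((hend1 e h0).2 v he)⟩

theorem IsPar.two_le_card_down {V : Type*} [Fintype V] {G : SimpleGraph V} {endVertex : E → V}
    {e₀ : E} {par : V → V} {rank : V → ℕ} (h : IsPar G (endVertex e₀) par rank)
    (hinj : Function.Injective (cluster endVertex e₀ par))
    (h2 : ∀ v, 2 ≤ (cluster endVertex e₀ par v).card) (v : V) :
    2 ≤ (down endVertex e₀ par v).card := by
  by_contra hlt
  have h3 : (down endVertex e₀ par v).card ≤ 1 := by omega
  obtain ⟨e, he⟩ := Finset.card_pos.1 (lt_of_lt_of_le zero_lt_two (h2 v))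
  obtain ⟨x, hx, -⟩ := h.mem_cluster_iff.1 he
  have h4 : cluster endVertex e₀ par v = pointCluster endVertex e₀ par x := by
    ext f
    rw [h.mem_cluster_iff]
    constructor
    · rintro ⟨y, hy, hf⟩
      rwa [Finset.card_le_one.1 h3 x hx y hy]
    · exact fun hf => ⟨x, hx, hf⟩
  rcases x with w | f
  · obtain ⟨h5, -, h6⟩ := mem_down.1 hx
    rw [← hinj h4] at h5 h6
    have := h.rank_lt v (by simpa using h5)
    rw [show par v = v from h6] at this
    omega
  · have := h2 v
    rw [h4] at this
    simp [pointCluster] at this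

variable {N : Type*} [AddCommGroup N]

/-- The lengths on a laminar family and the position of the root vertex define a curve. -/
theorem IsLaminar.exists_curve {e₀ : E} {𝓛 : Finset (Finset E)} (h : IsLaminar e₀ 𝓛) (deg : E → N)
    (hsum : ∑ e, deg e = 0) (c : Finset E → ℝ) (hc : ∀ A ∈ 𝓛, A ≠ Finset.univ.erase e₀ → 0 < c A)
    (x : ℝ ⊗[ℤ] N) : ∃ (Γ : Curve deg) (par : Γ.V → Γ.V) (rank : Γ.V → ℕ),
      IsPar Γ.graph (Γ.endVertex e₀) par rank ∧ clusters Γ.endVertex e₀ par = 𝓛 ∧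
      ∀ v, Γ.h v = x + ∑ A ∈ 𝓛 with cluster Γ.endVertex e₀ par v ⊆ A, c A • toReal (degSum deg A) := by
  classical
  let A : Fin 𝓛.card → Finset E := fun v => (𝓛.equivFin.symm v).1
  have hA : Function.Injective A := Subtype.val_injective.comp 𝓛.equivFin.symm.injective
  have hr : ∀ B, B ∈ 𝓛 ↔ ∃ v, A v = B := fun B =>
    ⟨fun hB => ⟨𝓛.equivFin ⟨B, hB⟩, by simp [A]⟩, by rintro ⟨v, rfl⟩; exact (𝓛.equivFin.symm v).2⟩
  obtain ⟨G, endVertex, par, rank, hP, hcl⟩ := h.exists_isPar hA hr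
  have hcl' : cluster endVertex e₀ par = A := funext hcl
  have h2 := hP.two_le_card_down (hcl' ▸ hA) (fun v => hcl v ▸ h.two_le _ ((hr _).2 ⟨v, rfl⟩))
  have hedge : ∀ a : G.edgeSet, ∃ v, v ≠ endVertex e₀ ∧ a.1 = s(v, par v) := by
    rintro ⟨a, ha⟩
    induction a using Sym2.inductionOn with
    | hf v w =>
      rcases (hP.adj v w).1 ha with ⟨hv, h1⟩ | ⟨hv, h1⟩
      · exact ⟨v, hv, by rw [h1]⟩
      · exact ⟨w, hv, by rw [h1]; exact Sym2.eq_swap⟩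
  choose lower hlower1 hlower2 using hedge
  have hlower : ∀ (v : Fin 𝓛.card) (hv : v ≠ endVertex e₀) (a : G.edgeSet), a.1 = s(v, par v) →
      lower a = v := by
    intro v hv a ha
    have h1 := hlower2 a
    rw [ha, Sym2.eq_iff] at h1
    rcases h1 with ⟨h1, -⟩ | ⟨h1, h3⟩
    · exact h1.symm
    · have h4 := hP.rank_lt v hv
      have h5 := hP.rank_lt _ (hlower1 a)
      rw [← h1] at h5
      rw [h3] at h4
      omega
  let hh : Fin 𝓛.card → ℝ ⊗[ℤ] N := fun v => x + ∑ B ∈ 𝓛 with A v ⊆ B, c B • toReal (degSum deg B)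
  have hstep : ∀ v, v ≠ endVertex e₀ → hh v = hh (par v) + c (A v) • toReal (degSum deg (A v)) := by
    intro v hv
    have h3 : 𝓛.filter (A v ⊆ ·) = insert (A v) (𝓛.filter (A (par v) ⊆ ·)) := by
      ext B
      simp only [Finset.mem_filter, Finset.mem_insert]
      constructor
      · rintro ⟨hB, hs⟩
        obtain ⟨w, rfl⟩ := (hr B).1 hB
        rw [← hcl v, ← hcl w] at hs
        obtain ⟨k, rfl⟩ := (hP.cluster_subset_iff h2).1 hs
        cases k with
        | zero => exact .inl rfl
        | succ k =>
          refine .inr ⟨hB, ?_⟩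
          rw [← hcl, ← hcl]
          exact (hP.cluster_subset_iff h2).2 ⟨k, rfl⟩
      · have h4 : A v ⊆ A (par v) := by
          rw [← hcl, ← hcl]; exact hP.cluster_subset_iterate v 1
        rintro (rfl | ⟨hB, hs⟩)
        · exact ⟨(hr _).2 ⟨v, rfl⟩, subset_rfl⟩
        · exact ⟨hB, h4.trans hs⟩
    simp only [hh]
    rw [h3, Finset.sum_insert, add_assoc, add_comm (c (A v) • _)]
    intro hmem
    have h4 := hP.cluster_ssubset_par h2 hv
    rw [hcl, hcl] at h4
    exact h4.not_subset (Finset.mem_filter.1 hmem).2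
  let slope : G.Dart → N := fun d => if d.snd ≠ endVertex e₀ ∧ par d.snd = d.fst
    then degSum deg (A d.snd) else -degSum deg (A d.fst)
  have hs1 : ∀ d : G.Dart, d.snd ≠ endVertex e₀ → par d.snd = d.fst →
      slope d = degSum deg (pointCluster endVertex e₀ par (.inl d.snd)) := fun d h1 h3 =>
    (if_pos ⟨h1, h3⟩).trans (by rw [← hcl]; rfl)
  have hs2 : ∀ d : G.Dart, d.fst ≠ endVertex e₀ → par d.fst = d.snd →
      slope d = -degSum deg (pointCluster endVertex e₀ par (.inl d.fst)) := by
    intro d h1 h3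
    refine (if_neg ?_).trans (by rw [← hcl]; rfl)
    rintro ⟨h4, h5⟩
    have h6 := hP.rank_lt _ h1
    have h7 := hP.rank_lt _ h4
    rw [h3] at h6
    rw [h5] at h7
    omega
  have hbal : ∀ v, ∑ᶠ f : EdgeFlag G endVertex v, flagSlope slope deg f = 0 := by
    intro v
    obtain ⟨F, -, hF⟩ := hP.exists_flagEquiv (N := N) v
    obtain ⟨hn, hs⟩ := hF slope deg (fun x => degSum deg (pointCluster endVertex e₀ par x)) hs1 hs2
      (fun e _ => by simp [degSum, pointCluster]) (by
        rw [eq_neg_iff_add_eq_zero, ← hsum]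
        change deg e₀ + degSum deg (cluster endVertex e₀ par (endVertex e₀)) = _
        rw [hP.cluster_root, degSum, Finset.add_sum_erase _ _ (Finset.mem_univ _)])
    rw [← finsum_comp_equiv F, finsum_eq_sum_of_fintype, Fintype.sum_option, hn]
    simp only [hs]
    rw [Finset.sum_coe_sort (down endVertex e₀ par v)
      (fun x => degSum deg (pointCluster endVertex e₀ par x)), ← hP.degSum_cluster]
    exact neg_add_cancel _
  have hval : ∀ v, 3 ≤ Nat.card (EdgeFlag G endVertex v) := fun v => by
    rw [hP.card_flags]
    have := h2 v
    omega
  have hlen : ∀ a : G.edgeSet, 0 < c (A (lower a)) := fun a =>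
    hc _ ((hr _).2 ⟨_, rfl⟩) fun h' => hlower1 a (hA (by rw [h', ← hcl, hP.cluster_root]))
  have haff : ∀ d : G.Dart, hh d.snd - hh d.fst =
      c (A (lower ⟨d.edge, d.edge_mem⟩)) • toReal (slope d) := by
    intro d
    rcases (hP.adj d.fst d.snd).1 d.adj with ⟨hv, hp⟩ | ⟨hv, hp⟩
    · rw [hs2 d hv hp, hlower d.fst hv _ (show d.edge = _ by rw [hp]; rfl), hstep _ hv, hp,
        toReal_neg, smul_neg]
      change _ = -(c (A d.fst) • toReal (degSum deg (cluster endVertex e₀ par d.fst)))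
      rw [hcl]
      abel
    · rw [hs1 d hv hp, hlower d.snd hv _ (show d.edge = _ by rw [hp]; exact Sym2.eq_swap),
        hstep _ hv, hp]
      change _ = c (A d.snd) • toReal (degSum deg (cluster endVertex e₀ par d.snd))
      rw [hcl]
      abel
  have key : ∀ (i : Fintype (Fin 𝓛.card)) (B : Finset E),
      B ∈ @clusters E _ _ (Fin 𝓛.card) i endVertex e₀ par ↔ B ∈ 𝓛 := by
    intro i B
    rw [mem_clusters, hr, hcl']
  refine ⟨⟨Fin 𝓛.card, inferInstance, G, hP.isTree, endVertex, hval,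
    fun a => c (A (lower a)), hlen, hh, slope, haff, hbal⟩, par, rank, hP,
    Finset.ext fun B => key _ B, fun v => ?_⟩
  change hh v = _
  simp only [hh, ← hcl]

end Builder


/-! ### Trivalent curves and binary trees -/

section TreeOfCurve

variable {V E R : Type*} [Fintype E] [DecidableEq E] [Fintype V] [CommRing R]
  {G : SimpleGraph V} {endVertex : E → V} {e₀ : E} {par : V → V} {rank : V → ℕ}

namespace IsPar

theorem cluster_par_subset (h : IsPar G (endVertex e₀) par rank)
    (h2 : ∀ v, 2 ≤ (down endVertex e₀ par v).card) {v w : V}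
    (hs : cluster endVertex e₀ par v ⊂ cluster endVertex e₀ par w) :
    cluster endVertex e₀ par (par v) ⊆ cluster endVertex e₀ par w := by
  obtain ⟨k, rfl⟩ := (h.cluster_subset_iff h2).1 hs.subset
  cases k with
  | zero => exact absurd hs (ssubset_irrefl _)
  | succ k => exact (h.cluster_subset_iff h2).2 ⟨k, rfl⟩

theorem exists_down_of_ssubset (h : IsPar G (endVertex e₀) par rank)
    (h2 : ∀ v, 2 ≤ (down endVertex e₀ par v).card) {v w : V}
    (hs : cluster endVertex e₀ par w ⊂ cluster endVertex e₀ par v) :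
    ∃ x ∈ down endVertex e₀ par v, cluster endVertex e₀ par w ⊆ pointCluster endVertex e₀ par x := by
  obtain ⟨e, he⟩ := h.cluster_nonempty h2 w
  obtain ⟨x, hx, hex⟩ := h.mem_cluster_iff.1 (hs.subset he)
  refine ⟨x, hx, ?_⟩
  rcases x with u | f
  · rcases h.laminar w u with h3 | h3 | h3
    · exact h3
    · by_cases h4 : cluster endVertex e₀ par u = cluster endVertex e₀ par w
      · exact h4.symm.subset
      · have h5 := h.cluster_par_subset h2 (Finset.ssubset_iff_subset_ne.2 ⟨h3, h4⟩)
        rw [show par u = v from (mem_down.1 hx).2.2] at h5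
        exact absurd h5 hs.not_subset
    · exact absurd hex (Finset.disjoint_left.1 h3 he)
  · obtain rfl := Finset.mem_singleton.1 (show e ∈ ({f} : Finset E) from hex)
    have h5 := (h.cluster_endVertex_subset_iff h2 (by simpa using (mem_down.1 hx).2.1)).2 he
    rw [show endVertex e = v from (mem_down.1 hx).2.2] at h5
    exact absurd h5 hs.not_subset

/-- A trivalent rooted tree is a binary tree, and its vertices are the nodes. -/
theorem exists_canonicalTree (h : IsPar G (endVertex e₀) par rank)
    (h2 : ∀ v, (down endVertex e₀ par v).card = 2) {pick : Finset E → E}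
    (hpick : ∀ S : Finset E, S.Nonempty → pick S ∈ S) {k : Finset E → Finset E → R} {κ : V → R}
    (hk : ∀ v x y, x ≠ y → (∀ z, z ∈ down endVertex e₀ par v ↔ z = x ∨ z = y) →
      k (pointCluster endVertex e₀ par x) (pointCluster endVertex e₀ par y) = κ v) :
    ∃ T : BTree E, T.IsCanonical pick ∧ T.leaves = Finset.univ.erase e₀ ∧
      T.nodes = clusters endVertex e₀ par ∧ T.coeff k = ∏ v, κ v := by
  classical
  have h2' : ∀ v, 2 ≤ (down endVertex e₀ par v).card := fun v => (h2 v).ge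
  have key : ∀ n, ∀ x : V ⊕ E, (pointCluster endVertex e₀ par x).card = n →
      ∃ T : BTree E, T.IsCanonical pick ∧ T.leaves = pointCluster endVertex e₀ par x ∧
      (∀ A, A ∈ T.nodes ↔ ∃ w, cluster endVertex e₀ par w = A ∧ A ⊆ pointCluster endVertex e₀ par x) ∧
      T.coeff k = ∏ w with cluster endVertex e₀ par w ⊆ pointCluster endVertex e₀ par x, κ w := by
    intro n
    induction n using Nat.strong_induction_on with
    | _ n ih =>
      rintro (v | e) hn
      · obtain ⟨x, y, hxy, hd⟩ := Finset.card_eq_two.1 (h2 v)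
        have hd' : ∀ z, z ∈ down endVertex e₀ par v ↔ z = x ∨ z = y := fun z => by simp [hd]
        have hU : cluster endVertex e₀ par v =
            pointCluster endVertex e₀ par x ∪ pointCluster endVertex e₀ par y := by
          ext e
          simp [h.mem_cluster_iff, hd]
        obtain ⟨x, y, hxy, hd', hU, hp⟩ : ∃ x y, x ≠ y ∧
            (∀ z, z ∈ down endVertex e₀ par v ↔ z = x ∨ z = y) ∧ cluster endVertex e₀ par v =
              pointCluster endVertex e₀ par x ∪ pointCluster endVertex e₀ par y ∧
            pick (cluster endVertex e₀ par v) ∈ pointCluster endVertex e₀ par x := by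
          have h3 := hpick _ (h.cluster_nonempty h2' v)
          have h3' : _ ∈ pointCluster endVertex e₀ par x ∪ pointCluster endVertex e₀ par y := hU.subset h3
          rcases Finset.mem_union.1 h3' with h4 | h4
          · exact ⟨x, y, hxy, hd', hU, h4⟩
          · exact ⟨y, x, hxy.symm, fun z => (hd' z).trans or_comm, hU.trans (Finset.union_comm _ _), h4⟩
        have hx : x ∈ down endVertex e₀ par v := (hd' x).2 (.inl rfl)
        have hy : y ∈ down endVertex e₀ par v := (hd' y).2 (.inr rfl)
        have hxs := h.pointCluster_ssubset h2' hx
        have hys := h.pointCluster_ssubset h2' hy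
        have hdis := h.pairwiseDisjoint_down v hx hy hxy
        obtain ⟨Tx, hx1, hx2, hx3, hx4⟩ := ih _ (hn ▸ Finset.card_lt_card hxs) x rfl
        obtain ⟨Ty, hy1, hy2, hy3, hy4⟩ := ih _ (hn ▸ Finset.card_lt_card hys) y rfl
        have hsplit : ∀ w, cluster endVertex e₀ par w ⊆ cluster endVertex e₀ par v ↔ w = v ∨
            cluster endVertex e₀ par w ⊆ pointCluster endVertex e₀ par x ∨
            cluster endVertex e₀ par w ⊆ pointCluster endVertex e₀ par y := by
          intro w
          constructor
          · intro hs
            by_cases hw : w = v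
            · exact .inl hw
            · obtain ⟨z, hz, hwz⟩ := h.exists_down_of_ssubset h2' (Finset.ssubset_iff_subset_ne.2
                ⟨hs, fun h' => hw (h.cluster_injective h2' h')⟩)
              rcases (hd' z).1 hz with rfl | rfl
              · exact .inr (.inl hwz)
              · exact .inr (.inr hwz)
          · rintro (rfl | hs | hs)
            · exact subset_rfl
            · exact hs.trans hxs.subset
            · exact hs.trans hys.subset
        refine ⟨.node Tx Ty, ⟨hx1, hy1, by rwa [hx2, hy2], by rwa [hx2, hy2, ← hU]⟩, ?_, ?_, ?_⟩
        · rw [BTree.leaves, hx2, hy2, ← hU]; rfl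
        · intro A
          simp only [BTree.nodes, Finset.mem_insert, Finset.mem_union, hx3, hy3, hx2, hy2, ← hU]
          constructor
          · rintro (rfl | ⟨w, rfl, hs⟩ | ⟨w, rfl, hs⟩)
            · exact ⟨v, rfl, subset_rfl⟩
            · exact ⟨w, rfl, hs.trans hxs.subset⟩
            · exact ⟨w, rfl, hs.trans hys.subset⟩
          · rintro ⟨w, rfl, hs⟩
            rcases (hsplit w).1 hs with rfl | h3 | h3
            · exact .inl rfl
            · exact .inr (.inl ⟨w, rfl, h3⟩)
            · exact .inr (.inr ⟨w, rfl, h3⟩)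
        · have h5 : (Finset.univ.filter fun w => cluster endVertex e₀ par w ⊆
              pointCluster endVertex e₀ par (.inl v)) = insert v
              ((Finset.univ.filter fun w => cluster endVertex e₀ par w ⊆
                pointCluster endVertex e₀ par x) ∪ (Finset.univ.filter fun w =>
                  cluster endVertex e₀ par w ⊆ pointCluster endVertex e₀ par y)) := by
            ext w
            simp only [Finset.mem_insert, Finset.mem_union, Finset.mem_filter, Finset.mem_univ,
              true_and]
            exact hsplit w
          rw [h5, Finset.prod_insert, Finset.prod_union, BTree.coeff, hx4, hy4, hx2, hy2,
            hk v x y hxy hd']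
          · rw [Finset.disjoint_left]
            intro w hw hw'
            obtain ⟨e, he⟩ := h.cluster_nonempty h2' w
            exact Finset.disjoint_left.1 hdis ((Finset.mem_filter.1 hw).2 he)
              ((Finset.mem_filter.1 hw').2 he)
          · intro hw
            rcases Finset.mem_union.1 hw with hw | hw
            · exact hxs.not_subset (Finset.mem_filter.1 hw).2
            · exact hys.not_subset (Finset.mem_filter.1 hw).2
      · refine ⟨.leaf e, trivial, rfl, fun A => ?_, ?_⟩
        · simp only [BTree.nodes, Finset.notMem_empty, false_iff]
          rintro ⟨w, rfl, hs⟩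
          have h3 := Finset.card_le_card hs
          have h4 := h.two_le_card_cluster h2' w
          simp only [pointCluster, Sum.elim_inr, Finset.card_singleton] at h3
          omega
        · rw [Finset.filter_false_of_mem, Finset.prod_empty, BTree.coeff]
          intro w _ hs
          have h3 := Finset.card_le_card hs
          have h4 := h.two_le_card_cluster h2' w
          simp only [pointCluster, Sum.elim_inr, Finset.card_singleton] at h3
          omega
  obtain ⟨T, hT1, hT2, hT3, hT4⟩ := key _ (.inl (endVertex e₀)) rfl
  have hroot : ∀ w, cluster endVertex e₀ par w ⊆
      pointCluster endVertex e₀ par (.inl (endVertex e₀)) := fun w e he => by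
    change e ∈ cluster endVertex e₀ par (endVertex e₀)
    rw [h.cluster_root]
    exact Finset.mem_erase.2 ⟨(mem_cluster.1 he).1, Finset.mem_univ _⟩
  refine ⟨T, hT1, hT2.trans h.cluster_root, ?_, ?_⟩
  · ext A
    rw [hT3, mem_clusters]
    exact ⟨fun ⟨w, hw, _⟩ => ⟨w, hw⟩, fun ⟨w, hw⟩ => ⟨w, hw, hw ▸ hroot w⟩⟩
  · rw [hT4, Finset.filter_true_of_mem fun w _ => hroot w]

theorem isLaminar (h : IsPar G (endVertex e₀) par rank)
    (h2 : ∀ v, 2 ≤ (down endVertex e₀ par v).card) : IsLaminar e₀ (clusters endVertex e₀ par) where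
  root := mem_clusters.2 ⟨_, h.cluster_root⟩
  notMem := by
    intro A hA he
    obtain ⟨v, rfl⟩ := mem_clusters.1 hA
    exact (mem_cluster.1 he).1 rfl
  two_le := by
    intro A hA
    obtain ⟨v, rfl⟩ := mem_clusters.1 hA
    exact h.two_le_card_cluster h2 v
  laminar := by
    intro A hA B hB
    obtain ⟨v, rfl⟩ := mem_clusters.1 hA
    obtain ⟨w, rfl⟩ := mem_clusters.1 hB
    exact h.laminar v w

theorem card_clusters (h : IsPar G (endVertex e₀) par rank)
    (h2 : ∀ v, 2 ≤ (down endVertex e₀ par v).card) :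
    (clusters endVertex e₀ par).card = Fintype.card V := by
  rw [clusters, Finset.card_image_of_injective _ (h.cluster_injective h2), Finset.card_univ]

end IsPar

end TreeOfCurve

section SameType

variable {N E : Type*} [AddCommGroup N] [Fintype E] [DecidableEq E] {deg : E → N} {e₀ : E}
  {Γ Γ' : Curve deg} {par : Γ.V → Γ.V} {rank : Γ.V → ℕ} {par' : Γ'.V → Γ'.V} {rank' : Γ'.V → ℕ}

/-- An isomorphism of labelled graphs respects the root and hence the parents. -/
theorem Curve.par_map (h : IsPar Γ.graph (Γ.endVertex e₀) par rank)
    (h' : IsPar Γ'.graph (Γ'.endVertex e₀) par' rank') (f : Γ.graph ≃g Γ'.graph)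
    (hf : ∀ e, f (Γ.endVertex e) = Γ'.endVertex e) (v : Γ.V) : par' (f v) = f (par v) := by
  have h3 : IsPar Γ'.graph (Γ'.endVertex e₀) (fun w => f (par (f.symm w))) (fun w => rank (f.symm w)) :=
    { root := by
        rw [← hf e₀, f.symm_apply_apply, h.root]
      adj := by
        intro v w
        obtain ⟨v, rfl⟩ := f.surjective v
        obtain ⟨w, rfl⟩ := f.surjective w
        rw [f.map_adj_iff, h.adj, ← hf e₀]
        simp only [f.symm_apply_apply, ne_eq, f.injective.eq_iff]
      rank_lt := by
        intro v hv
        obtain ⟨v, rfl⟩ := f.surjective v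
        simp only [f.symm_apply_apply]
        exact h.rank_lt v fun h4 => hv (by rw [h4, hf]) }
  rw [h'.unique h3 (f v), f.symm_apply_apply]

theorem Curve.cluster_map (h : IsPar Γ.graph (Γ.endVertex e₀) par rank)
    (h' : IsPar Γ'.graph (Γ'.endVertex e₀) par' rank') (f : Γ.graph ≃g Γ'.graph)
    (hf : ∀ e, f (Γ.endVertex e) = Γ'.endVertex e) (v : Γ.V) :
    cluster Γ'.endVertex e₀ par' (f v) = cluster Γ.endVertex e₀ par v := by
  have h3 : ∀ k u, par'^[k] (f u) = f (par^[k] u) := by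
    intro k
    induction k with
    | zero => exact fun u => rfl
    | succ k ih =>
      intro u
      rw [Function.iterate_succ_apply, Function.iterate_succ_apply, par_map h h' f hf, ih]
  ext e
  simp only [mem_cluster, ← hf e, h3, f.injective.eq_iff]

theorem Curve.clusters_eq_of_sameType (h : IsPar Γ.graph (Γ.endVertex e₀) par rank)
    (h' : IsPar Γ'.graph (Γ'.endVertex e₀) par' rank') (hs : Curve.SameType Γ Γ') :
    clusters Γ.endVertex e₀ par = clusters Γ'.endVertex e₀ par' := by
  obtain ⟨f, hf⟩ := hs
  ext A
  rw [mem_clusters, mem_clusters]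
  constructor
  · rintro ⟨v, rfl⟩
    exact ⟨f v, cluster_map h h' f hf v⟩
  · rintro ⟨w, rfl⟩
    obtain ⟨v, rfl⟩ := f.surjective w
    exact ⟨v, (cluster_map h h' f hf v).symm⟩

/-- The combinatorial type is determined by the laminar family. -/
theorem Curve.sameType_of_clusters_eq (h : IsPar Γ.graph (Γ.endVertex e₀) par rank)
    (h' : IsPar Γ'.graph (Γ'.endVertex e₀) par' rank')
    (hc : clusters Γ.endVertex e₀ par = clusters Γ'.endVertex e₀ par') : Curve.SameType Γ Γ' := by
  have h2 := Γ.two_le_card_down h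
  have h2' := Γ'.two_le_card_down h'
  have h3 : ∀ v, ∃ w, cluster Γ'.endVertex e₀ par' w = cluster Γ.endVertex e₀ par v := fun v =>
    mem_clusters.1 (hc ▸ mem_clusters.2 ⟨v, rfl⟩)
  choose f hf using h3
  have hbij : Function.Bijective f := by
    refine ⟨fun v w hvw => h.cluster_injective h2 ?_, fun w => ?_⟩
    · rw [← hf, ← hf, hvw]
    · obtain ⟨v, hv⟩ := mem_clusters.1 (hc.symm ▸ mem_clusters.2 ⟨w, rfl⟩ :
        cluster Γ'.endVertex e₀ par' w ∈ clusters Γ.endVertex e₀ par)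
      exact ⟨v, h'.cluster_injective h2' ((hf v).trans hv)⟩
  have hroot : f (Γ.endVertex e₀) = Γ'.endVertex e₀ := h'.cluster_injective h2' (by
    rw [hf, h.cluster_root, h'.cluster_root])
  have hpar : ∀ v, v ≠ Γ.endVertex e₀ → par' (f v) = f (par v) := by
    intro v hv
    have hv' : f v ≠ Γ'.endVertex e₀ := fun h4 => hv (hbij.1 (h4.trans hroot.symm))
    apply h'.cluster_injective h2'
    refine subset_antisymm (h'.cluster_par_subset h2' ?_) ?_
    · rw [hf, hf]
      exact h.cluster_ssubset_par h2 hv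
    · obtain ⟨w, hw⟩ := hbij.2 (par' (f v))
      rw [← hw, hf, hf]
      refine h.cluster_par_subset h2 ?_
      rw [← hf, ← hf w, hw]
      exact h'.cluster_ssubset_par h2' hv'
  have hne : ∀ v, f v ≠ Γ'.endVertex e₀ ↔ v ≠ Γ.endVertex e₀ := fun v => by
    rw [← hroot]; exact hbij.1.ne_iff
  refine ⟨⟨Equiv.ofBijective f hbij, ?_⟩, fun e => ?_⟩
  · intro v w
    change Γ'.graph.Adj (f v) (f w) ↔ _
    rw [h'.adj, h.adj, hne, hne]
    refine or_congr (and_congr_right fun hv => ?_) (and_congr_right fun hv => ?_)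
    · rw [hpar v hv, hbij.1.eq_iff]
    · rw [hpar w hv, hbij.1.eq_iff]
  · change f _ = _
    by_cases he : e = e₀
    · rw [he, hroot]
    apply h'.cluster_injective h2'
    refine subset_antisymm ?_ ?_
    · obtain ⟨w, hw⟩ := hbij.2 (Γ'.endVertex e)
      rw [← hw, hf, hf, h.cluster_endVertex_subset_iff h2 he, ← hf w, hw]
      exact (h'.cluster_endVertex_subset_iff h2' he).1 subset_rfl
    · rw [h'.cluster_endVertex_subset_iff h2' he, hf]
      exact (h.cluster_endVertex_subset_iff h2 he).1 subset_rfl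

end SameType


/-! ### Solutions of the enumerative problem as lengths on laminar families -/

section Solutions

variable {N E : Type*} [AddCommGroup N]

open Classical in
/-- The form whose value on an end is prescribed: the form `φ e` for a marked point, and the form
`ω(n_e, -)` otherwise. -/
def endForm (deg : E → N) (ω : LinearMap.BilinForm ℤ N) (φ : E → Module.Dual ℤ N) (e : E) :
    Module.Dual ℝ (ℝ ⊗[ℤ] N) :=
  if deg e = 0 then dualReal (φ e) else formReal ω (toReal (deg e))

open Classical in
/-- The value of the form of the end `e` on the slope of the end `f`. -/
def pairing (deg : E → N) (ω : LinearMap.BilinForm ℤ N) (φ : E → Module.Dual ℤ N) (e f : E) : ℤ :=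
  if deg e = 0 then φ e (deg f) else ω (deg e) (deg f)

/-- The curves for which the form of each end has the prescribed value, and which have the end `e₀`
on the line through `y` with the slope of `e₀`. Both enumerative problems are of this kind. -/
def solutions (deg : E → N) (ω : LinearMap.BilinForm ℤ N) (φ : E → Module.Dual ℤ N) (e₀ : E)
    (c : E → ℝ) (y : ℝ ⊗[ℤ] N) : Set (Curve deg) :=
  {Γ | (∀ e, endForm deg ω φ e (Γ.h (Γ.endVertex e)) = c e) ∧
    ∃ s : ℝ, Γ.h (Γ.endVertex e₀) = y + s • toReal (deg e₀)}

variable {deg : E → N} {ω : LinearMap.BilinForm ℤ N} {φ : E → Module.Dual ℤ N} {e₀ : E}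

theorem endForm_toReal_deg (e f : E) :
    endForm deg ω φ e (toReal (deg f)) = pairing deg ω φ e f := by
  unfold endForm pairing
  split_ifs <;> simp

theorem Curve.Isom.mem_solutions {Γ Γ' : Curve deg} (h : Curve.Isom Γ Γ') {c : E → ℝ}
    {y : ℝ ⊗[ℤ] N} (hΓ : Γ ∈ solutions deg ω φ e₀ c y) : Γ' ∈ solutions deg ω φ e₀ c y := by
  obtain ⟨f, h1, -, h3⟩ := h
  exact ⟨fun e => by rw [← h1, h3, hΓ.1], by rw [← h1, h3]; exact hΓ.2⟩

variable [Fintype E] [DecidableEq E]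

theorem endForm_toReal_degSum (e : E) (A : Finset E) :
    endForm deg ω φ e (toReal (degSum deg A)) = ∑ f ∈ A, (pairing deg ω φ e f : ℝ) := by
  rw [degSum, toReal_sum, map_sum]
  exact Finset.sum_congr rfl fun f _ => endForm_toReal_deg e f

theorem endForm_sum (e : E) (𝓛 : Finset (Finset E)) (l : Finset E → ℝ) :
    endForm deg ω φ e (∑ A ∈ 𝓛 with e ∈ A, l A • toReal (degSum deg A)) =
      lengthSum (fun e f => (pairing deg ω φ e f : ℝ)) 𝓛 l e := by
  rw [map_sum]
  exact Finset.sum_congr rfl fun A _ => by rw [map_smul, endForm_toReal_degSum, smul_eq_mul]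

/-- The lengths on the laminar family of a solution, with respect to the base point `y`. The edge
below the root vertex lies on the end `e₀`, and its length may have any sign. -/
theorem Curve.exists_lengths_of_mem_solutions [Module.Free ℤ N] {Γ : Curve deg} {par : Γ.V → Γ.V}
    {rank : Γ.V → ℕ} (h : IsPar Γ.graph (Γ.endVertex e₀) par rank) {c : E → ℝ} {y : ℝ ⊗[ℤ] N}
    (hΓ : Γ ∈ solutions deg ω φ e₀ c y) : ∃ l : Finset E → ℝ,
      (∀ v (hv : v ≠ Γ.endVertex e₀), l (cluster Γ.endVertex e₀ par v) =
        Γ.length ⟨s(v, par v), (h.adj _ _).2 (.inl ⟨hv, rfl⟩)⟩) ∧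
      (∀ A ∈ clusters Γ.endVertex e₀ par, A ≠ Finset.univ.erase e₀ → 0 < l A) ∧
      (∀ v, Γ.h v = y + ∑ A ∈ clusters Γ.endVertex e₀ par with
        cluster Γ.endVertex e₀ par v ⊆ A, l A • toReal (degSum deg A)) ∧
      ∀ e ≠ e₀, c e - endForm deg ω φ e y = lengthSum (fun e f => (pairing deg ω φ e f : ℝ))
        (clusters Γ.endVertex e₀ par) l e := by
  have h2 := Γ.two_le_card_down h
  obtain ⟨l, hl1, hl2, hl3, hl4⟩ := Γ.exists_lengths h
  obtain ⟨hc, s, hs⟩ := hΓ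
  set l' := Function.update l (Finset.univ.erase e₀) (-s) with hl'
  have hroot : ∀ v, v ≠ Γ.endVertex e₀ → cluster Γ.endVertex e₀ par v ≠ Finset.univ.erase e₀ :=
    fun v hv h' => hv (h.cluster_injective h2 (h'.trans h.cluster_root.symm))
  have hpos : ∀ v, Γ.h v = y + ∑ A ∈ clusters Γ.endVertex e₀ par with
        cluster Γ.endVertex e₀ par v ⊆ A, l' A • toReal (degSum deg A) := by
    intro v
    have hmem : Finset.univ.erase e₀ ∈ (clusters Γ.endVertex e₀ par).filter
        (cluster Γ.endVertex e₀ par v ⊆ ·) := by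
      refine Finset.mem_filter.2 ⟨mem_clusters.2 ⟨_, h.cluster_root⟩, fun e he => ?_⟩
      exact Finset.mem_erase.2 ⟨(mem_cluster.1 he).1, Finset.mem_univ _⟩
    have hdeg := (Γ.exists_flagEquiv h).2.1
    rw [h.cluster_root] at hdeg
    rw [hl4 v, hs, ← Finset.add_sum_erase _ _ hmem, ← Finset.add_sum_erase _ (fun A => l' A • _) hmem,
      hl3, zero_smul, zero_add, hl', Function.update_self, hdeg, toReal_neg, smul_neg, neg_smul,
      add_assoc]
    congr 2
    refine Finset.sum_congr rfl fun A hA => ?_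
    rw [Function.update_of_ne (Finset.ne_of_mem_erase hA)]
  refine ⟨l', fun v hv => ?_, fun A hA hA' => ?_, hpos, fun e he => ?_⟩
  · rw [hl', Function.update_of_ne (hroot v hv), hl1 v hv]
  · rw [hl', Function.update_of_ne hA']
    exact hl2 A hA hA'
  · rw [← hc e, hpos, map_add, add_sub_cancel_left, ← endForm_sum]
    congr 2
    refine Finset.filter_congr fun A hA => ?_
    obtain ⟨v, rfl⟩ := mem_clusters.1 hA
    exact h.cluster_endVertex_subset_iff h2 he

/-- A solution of the linear equations for the lengths, with positive lengths except for the one at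
the root, comes from a curve. -/
theorem IsLaminar.exists_mem_solutions (hω : ω.IsAlt) (h0 : deg e₀ ≠ 0) (hsum : ∑ e, deg e = 0)
    {𝓛 : Finset (Finset E)} (h𝓛 : IsLaminar e₀ 𝓛) {l : Finset E → ℝ}
    (hl : ∀ A ∈ 𝓛, A ≠ Finset.univ.erase e₀ → 0 < l A) {c : E → ℝ} {y : ℝ ⊗[ℤ] N}
    (hy : endForm deg ω φ e₀ y = c e₀)
    (hc : ∀ e ≠ e₀, c e - endForm deg ω φ e y =
      lengthSum (fun e f => (pairing deg ω φ e f : ℝ)) 𝓛 l e) :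
    ∃ Γ ∈ solutions deg ω φ e₀ c y, ∃ (par : Γ.V → Γ.V) (rank : Γ.V → ℕ),
      IsPar Γ.graph (Γ.endVertex e₀) par rank ∧ clusters Γ.endVertex e₀ par = 𝓛 := by
  obtain ⟨Γ, par, rank, h, hcl, hpos⟩ := h𝓛.exists_curve deg hsum l hl y
  have h2 := Γ.two_le_card_down h
  have hdeg : toReal (degSum deg (Finset.univ.erase e₀)) = -toReal (deg e₀) := by
    rw [← toReal_neg, degSum]
    congr 1
    rw [eq_neg_iff_add_eq_zero, add_comm, Finset.add_sum_erase _ _ (Finset.mem_univ _), hsum]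
  have hroot : Γ.h (Γ.endVertex e₀) = y + (-l (Finset.univ.erase e₀)) • toReal (deg e₀) := by
    rw [hpos, h.cluster_root]
    have : 𝓛.filter (Finset.univ.erase e₀ ⊆ ·) = {Finset.univ.erase e₀} := by
      ext A
      simp only [Finset.mem_filter, Finset.mem_singleton]
      constructor
      · rintro ⟨hA, hs⟩
        refine subset_antisymm (fun e he => ?_) hs
        exact Finset.mem_erase.2 ⟨fun h' => h𝓛.notMem A hA (h' ▸ he), Finset.mem_univ _⟩
      · rintro rfl
        exact ⟨h𝓛.root, subset_rfl⟩
    rw [this, Finset.sum_singleton, hdeg, smul_neg, neg_smul]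
  refine ⟨Γ, ⟨fun e => ?_, _, hroot⟩, par, rank, h, hcl⟩
  by_cases he : e = e₀
  · have h3 : pairing deg ω φ e₀ e₀ = 0 := by simp [pairing, h0, hω.self_eq_zero]
    rw [he, hroot, map_add, map_smul, endForm_toReal_deg, h3, Int.cast_zero, smul_zero, add_zero, hy]
  · have h3 := hc e he
    rw [← endForm_sum, sub_eq_iff_eq_add] at h3
    rw [h3, hpos, map_add, add_comm]
    congr 3
    refine Finset.filter_congr fun A hA => ?_
    rw [← hcl] at hA
    obtain ⟨v, rfl⟩ := mem_clusters.1 hA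
    exact h.cluster_endVertex_subset_iff h2 he

/-- Curves of the same type with the same lengths and the same base point are isomorphic. -/
theorem Curve.isom_of_lengths_eq {Γ Γ' : Curve deg} {par : Γ.V → Γ.V}
    {rank : Γ.V → ℕ} (h : IsPar Γ.graph (Γ.endVertex e₀) par rank) {par' : Γ'.V → Γ'.V}
    {rank' : Γ'.V → ℕ} (h' : IsPar Γ'.graph (Γ'.endVertex e₀) par' rank')
    (hs : Curve.SameType Γ Γ') {l : Finset E → ℝ} {y : ℝ ⊗[ℤ] N}
    (hl : ∀ v (hv : v ≠ Γ.endVertex e₀), l (cluster Γ.endVertex e₀ par v) =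
        Γ.length ⟨s(v, par v), (h.adj _ _).2 (.inl ⟨hv, rfl⟩)⟩)
    (hl' : ∀ v (hv : v ≠ Γ'.endVertex e₀), l (cluster Γ'.endVertex e₀ par' v) =
        Γ'.length ⟨s(v, par' v), (h'.adj _ _).2 (.inl ⟨hv, rfl⟩)⟩)
    (hh : ∀ v, Γ.h v = y + ∑ A ∈ clusters Γ.endVertex e₀ par with
        cluster Γ.endVertex e₀ par v ⊆ A, l A • toReal (degSum deg A))
    (hh' : ∀ v, Γ'.h v = y + ∑ A ∈ clusters Γ'.endVertex e₀ par' with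
        cluster Γ'.endVertex e₀ par' v ⊆ A, l A • toReal (degSum deg A)) : Curve.Isom Γ Γ' := by
  have hc := Curve.clusters_eq_of_sameType h h' hs
  obtain ⟨f, hf⟩ := hs
  refine ⟨f, hf, fun a => ?_, fun v => ?_⟩
  · obtain ⟨a, ha⟩ := a
    obtain ⟨v, hv, rfl⟩ : ∃ v, v ≠ Γ.endVertex e₀ ∧ a = s(v, par v) := by
      induction a using Sym2.inductionOn with
      | hf v w =>
        rcases (h.adj v w).1 ha with ⟨hv, h1⟩ | ⟨hv, h1⟩
        · exact ⟨v, hv, by rw [h1]⟩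
        · exact ⟨w, hv, by rw [h1]; exact Sym2.eq_swap⟩
    have hv' : f v ≠ Γ'.endVertex e₀ := fun h3 => hv (f.injective (h3.trans (hf e₀).symm))
    rw [← hl v hv, ← Curve.cluster_map h h' f hf v, hl' _ hv']
    congr 1
    apply Subtype.ext
    exact show s(f v, f (par v)) = s(f v, par' (f v)) by rw [Curve.par_map h h' f hf]
  · rw [hh, hh', Curve.cluster_map h h' f hf, hc]

end Solutions


/-! ### The weights of the enumerative problem -/

section Weights

variable {N E : Type*} [AddCommGroup N]

theorem wedge_add_left (a a' b : N) : wedge (a + a') b = wedge a b + wedge a' b :=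
  (exteriorPower.ιMulti ℤ 2).map_vecCons_add ![b] a a'

theorem wedge_swap (a b : N) : wedge a b = -wedge b a := by
  have := (exteriorPower.ιMulti ℤ (M := N) 2).map_swap ![b, a] (i := 0) (j := 1) (by decide)
  rw [← wedge.eq_1] at this
  rw [← this, wedge]
  congr 1
  ext i
  fin_cases i <;> simp

theorem wedge_add_right (a b b' : N) : wedge a (b + b') = wedge a b + wedge a b' := by
  rw [wedge_swap, wedge_add_left, neg_add, ← wedge_swap, ← wedge_swap]

theorem wedge_self (a : N) : wedge a a = 0 :=
  (exteriorPower.ιMulti ℤ (M := N) 2).map_eq_zero_of_eq ![a, a] (i := 0) (j := 1) rfl (by decide)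

theorem wedge_neg_right (a b : N) : wedge a (-b) = -wedge a b := by
  rw [eq_neg_iff_add_eq_zero, ← wedge_add_right, neg_add_cancel, wedge_swap, neg_eq_zero,
    ← add_right_cancel_iff (a := wedge 0 a), ← wedge_add_left, zero_add, zero_add]

variable (K : Submodule ℤ (⋀[ℤ]^2 N))

theorem qPow_mul (x y : ⋀[ℤ]^2 N) : qPow K x * qPow K y = qPow K (x + y) := by
  simp [qPow, AddMonoidAlgebra.single_mul_single]

theorem qPow_neg_eq_of_mem {x : ⋀[ℤ]^2 N} (hx : x ∈ K) : qPow K (-x) = qPow K x := by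
  rw [qPow, qPow, Submodule.Quotient.mk_neg, (Submodule.Quotient.mk_eq_zero K).2 hx, neg_zero]

/-- The factor of a trivalent vertex with two outgoing slopes `a` and `b`. -/
def vertexWeight (ω : LinearMap.BilinForm ℤ N) (a b : N) :
    AddMonoidAlgebra ℤ ((⋀[ℤ]^2 N) ⧸ K) :=
  if 0 < ω a b then qPow K (wedge a b) - qPow K (-wedge a b)
  else if ω a b < 0 then qPow K (-wedge a b) - qPow K (wedge a b) else 0

variable {K} {ω : LinearMap.BilinForm ℤ N}

theorem vertexWeight_of_neg {a b a' b' : N} (h1 : ω a' b' = -ω a b)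
    (h2 : wedge a' b' = -wedge a b) : vertexWeight K ω a' b' = vertexWeight K ω a b := by
  unfold vertexWeight
  rw [h1, h2, neg_neg]
  rcases lt_trichotomy (ω a b) 0 with h | h | h
  · rw [if_pos (by omega), if_neg (by omega), if_pos h]
  · simp [h]
  · rw [if_neg (by omega), if_pos (by omega), if_pos h]

theorem vertexWeight_swap (hω : ω.IsAlt) (a b : N) :
    vertexWeight K ω b a = vertexWeight K ω a b :=
  vertexWeight_of_neg (hω.neg_eq a b).symm (wedge_swap b a)

theorem vertexWeight_neg_add (hω : ω.IsAlt) (a b : N) :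
    vertexWeight K ω a (-(a + b)) = vertexWeight K ω a b :=
  vertexWeight_of_neg (by rw [map_neg, map_add, hω.self_eq_zero, zero_add])
    (by rw [wedge_neg_right, wedge_add_right, wedge_self, zero_add])

variable [Fintype E] [DecidableEq E]

/-- The marked points, which are the ends of slope zero. -/
def marks (deg : E → N) : Finset E := by
  classical exact Finset.univ.filter fun e => deg e = 0

theorem mem_marks {deg : E → N} {e : E} : e ∈ marks deg ↔ deg e = 0 := by simp [marks]

variable (K) in
open Classical in
/-- The factor of a node with the two sets of descendants `A` and `B`: the value `|φ_i(δ_i)|` for a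
marked point `i`, and the factor of the vertex otherwise. The value on sets that are not disjoint is
irrelevant and taken to be zero. -/
def nodeWeight (deg : E → N) (ω : LinearMap.BilinForm ℤ N) (φ : E → Module.Dual ℤ N)
    (A B : Finset E) : AddMonoidAlgebra ℤ ((⋀[ℤ]^2 N) ⧸ K) :=
  if ¬ Disjoint A B then 0
  else if ∃ i ∈ marks deg, A = {i} then ((|∑ i ∈ A, φ i (degSum deg B)| : ℤ) : _)
  else if ∃ i ∈ marks deg, B = {i} then ((|∑ i ∈ B, φ i (degSum deg A)| : ℤ) : _)
  else vertexWeight K ω (degSum deg A) (degSum deg B)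

variable {deg : E → N} {φ : E → Module.Dual ℤ N} {e₀ : E}

theorem degSum_sdiff_marks (A : Finset E) : degSum deg (A \ marks deg) = degSum deg A :=
  Finset.sum_subset Finset.sdiff_subset fun e he he' => by
    have : e ∈ marks deg := by simpa [he] using he'
    exact mem_marks.1 this

theorem degSum_union {A B : Finset E} (h : Disjoint A B) :
    degSum deg (A ∪ B) = degSum deg A + degSum deg B := Finset.sum_union h

theorem dual_degSum (ψ : Module.Dual ℤ N) (A : Finset E) :
    ψ (degSum deg A) = ∑ e ∈ A, ψ (deg e) := map_sum _ _ _

theorem dual_degSum_sdiff (ψ : Module.Dual ℤ N) (A : Finset E) :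
    ψ (degSum deg A) = ∑ e ∈ A \ marks deg, ψ (deg e) := by
  rw [← degSum_sdiff_marks, dual_degSum]

theorem blockSum_pairing {A B : Finset E} (hA : Disjoint A (marks deg)) :
    blockSum (fun e f => (pairing deg ω φ e f : ℝ)) A B = ω (degSum deg A) (degSum deg B) := by
  unfold blockSum
  rw [degSum, map_sum, LinearMap.sum_apply, Int.cast_sum]
  refine Finset.sum_congr rfl fun e he => ?_
  rw [dual_degSum, Int.cast_sum]
  refine Finset.sum_congr rfl fun f _ => ?_
  have h0 : deg e ≠ 0 := fun h => Finset.disjoint_left.1 hA he (mem_marks.2 h)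
  simp [pairing, h0]

theorem nodeWeight_mark_left {i : E} (hi : i ∈ marks deg) {B : Finset E} (hB : i ∉ B) :
    nodeWeight K deg ω φ {i} B = ((|φ i (degSum deg B)| : ℤ) : _) := by
  rw [nodeWeight, if_neg (not_not.2 (Finset.disjoint_singleton_left.2 hB)), if_pos ⟨i, hi, rfl⟩,
    Finset.sum_singleton]

theorem nodeWeight_mark_right {i : E} (hi : i ∈ marks deg) {B : Finset E} (hB : i ∉ B) :
    nodeWeight K deg ω φ B {i} = ((|φ i (degSum deg B)| : ℤ) : _) := by
  rw [nodeWeight, if_neg (not_not.2 (Finset.disjoint_singleton_right.2 hB))]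
  split_ifs with h h'
  · obtain ⟨j, hj, rfl⟩ := h
    have h1 : degSum deg {i} = 0 := by simp [degSum, mem_marks.1 hi]
    have h2 : degSum deg {j} = 0 := by simp [degSum, mem_marks.1 hj]
    rw [h1, h2]
    simp
  · rw [Finset.sum_singleton]
  · exact absurd ⟨i, hi, rfl⟩ h'

theorem nodeWeight_of_not_mark {A B : Finset E} (hd : Disjoint A B) (hA : ∀ i ∈ marks deg, A ≠ {i})
    (hB : ∀ i ∈ marks deg, B ≠ {i}) :
    nodeWeight K deg ω φ A B = vertexWeight K ω (degSum deg A) (degSum deg B) := by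
  rw [nodeWeight, if_neg (not_not.2 hd), if_neg, if_neg]
  · rintro ⟨i, hi, h⟩
    exact hB i hi h
  · rintro ⟨i, hi, h⟩
    exact hA i hi h

theorem perturbSum_swap (v : E → ℚ) (A B : Finset E) : perturbSum v B A = -perturbSum v A B := by
  simp [perturbSum]

/-- The node weights of the enumerative problem form a weight system. If the pairing of two blocks
vanishes, the sign given by the perturbation is arbitrary, but then the bivector belongs to `K` and
both sides of the formula for the vertex factor are zero. -/
theorem isWeightSystem (hω : ω.IsAlt) {top : Finset E} {v : E → ℚ}
    (hv : ∀ A B : Finset E, A.Nonempty → B.Nonempty → Disjoint A B → perturbSum v A B ≠ 0)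
    (hK : ∀ A B : Finset E, A ⊆ top → B ⊆ top → Disjoint A B → Disjoint A (marks deg) →
      Disjoint B (marks deg) → A.Nonempty → B.Nonempty → ω (degSum deg A) (degSum deg B) = 0 →
      wedge (degSum deg A) (degSum deg B) ∈ K) :
    IsWeightSystem top (marks deg) (fun e f => (pairing deg ω φ e f : ℝ)) (fun i e => φ i (deg e))
      (fun A B => qPow K (wedge (degSum deg A) (degSum deg B)))
      (lexPos (fun e f => (pairing deg ω φ e f : ℝ)) v) (nodeWeight K deg ω φ) where
  mark_right := by
    intro e f hf
    simp [pairing, mem_marks.1 hf]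
  anti := by
    intro e he f hf
    rw [mem_marks] at he hf
    simp only [pairing, he, hf, if_false]
    rw [← hω.neg_eq (deg f) (deg e)]
    push_cast
    ring
  mark_left := by
    intro i hi e
    simp [pairing, mem_marks.1 hi]
  cocycle := by
    intro X Z Z' Y h1 h2 h3
    have e1 : Y \ Z = (Z' \ Z) ∪ (Y \ Z') := by
      ext e
      simp only [Finset.mem_sdiff, Finset.mem_union]
      have h4 : e ∈ Z → e ∈ Z' := fun h => h2.1 h
      have h5 : e ∈ Z' → e ∈ Y := fun h => h3.1 h
      tauto
    have e2 : Z' \ X = (Z \ X) ∪ (Z' \ Z) := by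
      ext e
      simp only [Finset.mem_sdiff, Finset.mem_union]
      have h4 : e ∈ X → e ∈ Z := fun h => h1.1 h
      have h5 : e ∈ Z → e ∈ Z' := fun h => h2.1 h
      tauto
    have d1 : Disjoint (Z' \ Z) (Y \ Z') := Finset.disjoint_left.2 fun e h4 h5 =>
      (Finset.mem_sdiff.1 h5).2 (Finset.mem_sdiff.1 h4).1
    have d2 : Disjoint (Z \ X) (Z' \ Z) := Finset.disjoint_left.2 fun e h4 h5 =>
      (Finset.mem_sdiff.1 h5).2 (Finset.mem_sdiff.1 h4).1
    rw [qPow_mul, qPow_mul, e1, e2, degSum_union d1, degSum_union d2, wedge_add_right,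
      wedge_add_left]
    congr 1
    abel
  k_mark_left := by
    intro i hi B hB
    rw [nodeWeight_mark_left hi hB, dual_degSum_sdiff]
  k_mark_right := by
    intro i hi B hB
    rw [nodeWeight_mark_right hi hB, dual_degSum_sdiff]
  k_marks := by
    intro A B hA hB _ _ _
    have h1 : ∀ C ⊆ marks deg, degSum deg C = 0 := fun C hC =>
      Finset.sum_eq_zero fun e he => mem_marks.1 (hC he)
    simp [nodeWeight, h1 A hA, h1 B hB, vertexWeight]
  k_split := by
    intro A B hA hB hd hA' hB'
    have hne : ∀ C : Finset E, (C \ marks deg).Nonempty → ∀ i ∈ marks deg, C ≠ {i} := by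
      rintro C ⟨e, he⟩ i hi rfl
      obtain ⟨h1, h2⟩ := Finset.mem_sdiff.1 he
      exact h2 (Finset.mem_singleton.1 h1 ▸ hi)
    rw [nodeWeight_of_not_mark hd (hne A hA') (hne B hB')]
    have hdd : Disjoint (A \ marks deg) (B \ marks deg) := hd.mono Finset.sdiff_subset Finset.sdiff_subset
    have hp := hv _ _ hA' hB' hdd
    have hs := perturbSum_swap v (A \ marks deg) (B \ marks deg)
    have ha : ω (degSum deg B) (degSum deg A) = -ω (degSum deg A) (degSum deg B) :=
      (hω.neg_eq _ _).symm
    have hw := wedge_swap (degSum deg B) (degSum deg A)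
    simp only [lexPos, blockSum_pairing Finset.sdiff_disjoint, degSum_sdiff_marks]
    rw [ha, hw, hs, Int.cast_neg, neg_pos, neg_eq_zero, neg_pos, vertexWeight]
    rcases lt_trichotomy (ω (degSum deg A) (degSum deg B)) 0 with h | h | h
    · have h' : (ω (degSum deg A) (degSum deg B) : ℝ) < 0 := by exact_mod_cast h
      rw [if_neg h.not_gt, if_pos h]
      simp [ind, h', h'.not_gt, h'.ne]
    · have hm := hK _ _ (Finset.sdiff_subset.trans hA) (Finset.sdiff_subset.trans hB) hdd
        Finset.sdiff_disjoint Finset.sdiff_disjoint hA' hB' (by rwa [degSum_sdiff_marks, degSum_sdiff_marks])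
      rw [degSum_sdiff_marks, degSum_sdiff_marks] at hm
      rw [qPow_neg_eq_of_mem K hm, sub_self, mul_zero, h]
      simp
    · have h' : (0 : ℝ) < (ω (degSum deg A) (degSum deg B) : ℝ) := by exact_mod_cast h
      rw [if_pos h]
      simp [ind, h', h'.not_gt, h'.ne']

/-- If a node has nonzero weight, then its time is determined by the moments. -/
theorem nodeWeight_ne_zero (hω : ω.IsAlt) (A B : Finset E) (h : nodeWeight K deg ω φ A B ≠ 0) :
    blockSum (fun e f => (pairing deg ω φ e f : ℝ)) (levelSet (marks deg) A B) (A ∪ B) ≠ 0 := by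
  have hd : Disjoint A B := by
    by_contra hd
    exact h (if_pos hd)
  have hsingle : ∀ i ∈ marks deg, ∀ C : Finset E,
      blockSum (fun e f => (pairing deg ω φ e f : ℝ)) {i} C = φ i (degSum deg C) := by
    intro i hi C
    rw [blockSum, Finset.sum_singleton, dual_degSum, Int.cast_sum]
    exact Finset.sum_congr rfl fun f _ => by simp [pairing, mem_marks.1 hi]
  have hz : ∀ i ∈ marks deg, degSum deg {i} = 0 := fun i hi => by simp [degSum, mem_marks.1 hi]
  unfold levelSet
  split_ifs with h1 h2
  · obtain ⟨i, hi, rfl⟩ := h1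
    rw [nodeWeight_mark_left hi (Finset.disjoint_singleton_left.1 hd)] at h
    rw [hsingle i hi, degSum_union hd, hz i hi, zero_add]
    intro h0
    rw [Int.cast_eq_zero] at h0
    exact h (by simp [h0])
  · obtain ⟨i, hi, rfl⟩ := h2
    rw [nodeWeight_mark_right hi (Finset.disjoint_singleton_right.1 hd)] at h
    rw [hsingle i hi, degSum_union hd, hz i hi, add_zero]
    intro h0
    rw [Int.cast_eq_zero] at h0
    exact h (by simp [h0])
  · rw [nodeWeight_of_not_mark hd (fun i hi h' => h1 ⟨i, hi, h'⟩) (fun i hi h' => h2 ⟨i, hi, h'⟩)] at h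
    rw [blockSum_pairing Finset.sdiff_disjoint, degSum_sdiff_marks, degSum_union hd, map_add,
      hω.self_eq_zero, zero_add]
    intro h0
    rw [Int.cast_eq_zero] at h0
    exact h (by simp [vertexWeight, h0])

end Weights


/-! ### The multiplicity of a trivalent curve -/

section Multiplicity

variable {N E : Type*} [AddCommGroup N] [Fintype E] [DecidableEq E]

/-- The multiplicity `∏ᵢ |φᵢ(δᵢ)| · B_Γ` of a solution, the product being over the marked points. -/
def solutionMult (deg : E → N) (ω : LinearMap.BilinForm ℤ N) (φ : E → Module.Dual ℤ N)
    (K : Submodule ℤ (⋀[ℤ]^2 N)) (Γ : Curve deg) : AddMonoidAlgebra ℤ ((⋀[ℤ]^2 N) ⧸ K) :=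
  (∏ i ∈ marks deg, |φ i (Γ.slopeAtMark i)|) • Γ.refinedMult ω K

open Classical in
/-- The contribution of a vertex to the multiplicity of a solution. -/
def localMult (deg : E → N) (ω : LinearMap.BilinForm ℤ N) (φ : E → Module.Dual ℤ N)
    (K : Submodule ℤ (⋀[ℤ]^2 N)) (Γ : Curve deg) (v : Γ.V) :
    AddMonoidAlgebra ℤ ((⋀[ℤ]^2 N) ⧸ K) :=
  if ∃ i ∈ marks deg, Γ.endVertex i = v then
    ((∏ i ∈ marks deg with Γ.endVertex i = v, |φ i (Γ.slopeAtMark i)| : ℤ) : _)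
  else Γ.vertexFactor ω K v

variable {deg : E → N} {ω : LinearMap.BilinForm ℤ N} {φ : E → Module.Dual ℤ N}
  {K : Submodule ℤ (⋀[ℤ]^2 N)} {e₀ : E}

theorem prod_localMult (Γ : Curve deg) :
    ∏ v, localMult deg ω φ K Γ v = solutionMult deg ω φ K Γ := by
  classical
  have h1 : {v : Γ.V | ∀ e, deg e = 0 → Γ.endVertex e ≠ v} =
      ↑(Finset.univ.filter fun v : Γ.V => ¬ ∃ i ∈ marks deg, Γ.endVertex i = v) := by
    ext v
    simp [mem_marks]
  have h2 : ∏ v ∈ Finset.univ.filter (fun v : Γ.V => ∃ i ∈ marks deg, Γ.endVertex i = v),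
      ∏ i ∈ marks deg with Γ.endVertex i = v, |φ i (Γ.slopeAtMark i)| =
      ∏ i ∈ marks deg, |φ i (Γ.slopeAtMark i)| :=
    Finset.prod_fiberwise_of_maps_to (fun i hi => Finset.mem_filter.2 ⟨Finset.mem_univ _, i, hi, rfl⟩) _
  unfold localMult
  rw [Finset.prod_ite, solutionMult, Curve.refinedMult, h1, finprod_mem_coe_finset, ← h2,
    zsmul_eq_mul, Int.cast_prod]

variable [Module.Free ℤ N]

/-- The factor of a trivalent vertex can be computed from any two of the three outgoing edges. -/
theorem Curve.vertexWeight_out (hω : ω.IsAlt) (Γ : Curve deg) {par : Γ.V → Γ.V} {rank : Γ.V → ℕ}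
    (h : IsPar Γ.graph (Γ.endVertex e₀) par rank) {v : Γ.V} {x y : Γ.V ⊕ E} (hxy : x ≠ y)
    (hd : ∀ z, z ∈ down Γ.endVertex e₀ par v ↔ z = x ∨ z = y) {f g : Γ.FlagAt v} (hfg : f ≠ g) :
    vertexWeight K ω (Γ.out f) (Γ.out g) = vertexWeight K ω
      (degSum deg (pointCluster Γ.endVertex e₀ par x))
      (degSum deg (pointCluster Γ.endVertex e₀ par y)) := by
  classical
  obtain ⟨F, -, hn, hs⟩ := (Γ.exists_flagEquiv h).2.2 v
  have hsum : degSum deg (cluster Γ.endVertex e₀ par v) =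
      degSum deg (pointCluster Γ.endVertex e₀ par x) +
        degSum deg (pointCluster Γ.endVertex e₀ par y) := by
    rw [h.degSum_cluster, show down Γ.endVertex e₀ par v = {x, y} by ext z; simp [hd],
      Finset.sum_pair hxy]
  rw [hsum] at hn
  obtain ⟨o, rfl⟩ := F.surjective f
  obtain ⟨o', rfl⟩ := F.surjective g
  have hoo : o ≠ o' := fun h' => hfg (by rw [h'])
  rcases o with _ | ⟨z, hz⟩ <;> rcases o' with _ | ⟨z', hz'⟩
  · exact absurd rfl hoo
  · rw [hn, hs]
    rcases (hd z').1 hz' with rfl | rfl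
    · rw [vertexWeight_swap hω, vertexWeight_neg_add hω]
    · rw [vertexWeight_swap hω, add_comm, vertexWeight_neg_add hω, vertexWeight_swap hω]
  · rw [hn, hs]
    rcases (hd z).1 hz with rfl | rfl
    · rw [vertexWeight_neg_add hω]
    · rw [add_comm, vertexWeight_neg_add hω, vertexWeight_swap hω]
  · rw [hs, hs]
    rcases (hd z).1 hz with rfl | rfl <;> rcases (hd z').1 hz' with rfl | rfl
    · exact absurd rfl hoo
    · rfl
    · exact vertexWeight_swap hω _ _
    · exact absurd rfl hoo

/-- At a trivalent vertex with a marked point, the slope is the one of the other edge above the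
vertex, up to sign. -/
theorem Curve.abs_slopeAtMark (Γ : Curve deg) {par : Γ.V → Γ.V} {rank : Γ.V → ℕ}
    (h : IsPar Γ.graph (Γ.endVertex e₀) par rank) {v : Γ.V} {i : E} {y : Γ.V ⊕ E}
    (hi : i ∈ marks deg) (hv : Γ.endVertex i = v) (hxy : .inr i ≠ y)
    (hd : ∀ z, z ∈ down Γ.endVertex e₀ par v ↔ z = .inr i ∨ z = y) (ψ : Module.Dual ℤ N) :
    |ψ (Γ.slopeAtMark i)| = |ψ (degSum deg (pointCluster Γ.endVertex e₀ par y))| := by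
  classical
  subst hv
  obtain ⟨F, hF, hn, hs⟩ := (Γ.exists_flagEquiv h).2.2 (Γ.endVertex i)
  have hz : degSum deg (pointCluster Γ.endVertex e₀ par (.inr i)) = 0 := by
    simp [degSum, pointCluster, mem_marks.1 hi]
  have hsum : degSum deg (cluster Γ.endVertex e₀ par (Γ.endVertex i)) =
        degSum deg (pointCluster Γ.endVertex e₀ par y) := by
    rw [h.degSum_cluster, show down Γ.endVertex e₀ par (Γ.endVertex i) = {.inr i, y} by
      ext z; simp [hd], Finset.sum_pair hxy, hz, zero_add]
  rw [hsum] at hn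
  have hne := (Γ.exists_flag_ne_end i).choose_spec
  unfold Curve.slopeAtMark
  obtain ⟨o, ho⟩ := F.surjective (Γ.exists_flag_ne_end i).choose
  rw [← ho] at hne ⊢
  rcases o with _ | ⟨z, hz'⟩
  · rw [hn, map_neg, abs_neg]
  · rw [hs]
    rcases (hd z).1 hz' with rfl | rfl
    · exact absurd (hF i rfl hz') hne
    · rfl

theorem nodeWeight_pointCluster (hω : ω.IsAlt) (h0 : deg e₀ ≠ 0) (Γ : Curve deg)
    {par : Γ.V → Γ.V} {rank : Γ.V → ℕ} (h : IsPar Γ.graph (Γ.endVertex e₀) par rank) {v : Γ.V}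
    {x y : Γ.V ⊕ E} (hxy : x ≠ y) (hd : ∀ z, z ∈ down Γ.endVertex e₀ par v ↔ z = x ∨ z = y) :
    nodeWeight K deg ω φ (pointCluster Γ.endVertex e₀ par x) (pointCluster Γ.endVertex e₀ par y) =
      localMult deg ω φ K Γ v := by
  classical
  have h2 := Γ.two_le_card_down h
  have hdis := h.pairwiseDisjoint_down v ((hd x).2 (.inl rfl)) ((hd y).2 (.inr rfl)) hxy
  have hmark : ∀ i ∈ marks deg, ∀ z : Γ.V ⊕ E, pointCluster Γ.endVertex e₀ par z = {i} → z = .inr i := by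
    rintro i - (w | e) hz
    · have := h.two_le_card_cluster h2 w
      rw [show cluster Γ.endVertex e₀ par w = {i} from hz, Finset.card_singleton] at this
      omega
    · rw [Finset.singleton_injective hz]
  have hdown : ∀ i ∈ marks deg, Γ.endVertex i = v ↔ (.inr i) ∈ down Γ.endVertex e₀ par v := by
    intro i hi
    rw [mem_down]
    refine ⟨fun hv => ⟨by simp, ?_, hv⟩, fun hv => hv.2.2⟩
    rintro ⟨⟩
    exact h0 (mem_marks.1 hi)
  -- the case of a vertex carrying a mark
  have key : ∀ i ∈ marks deg, ∀ y : Γ.V ⊕ E, .inr i ≠ y →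
      (∀ z, z ∈ down Γ.endVertex e₀ par v ↔ z = .inr i ∨ z = y) →
      localMult deg ω φ K Γ v = ((|φ i (degSum deg (pointCluster Γ.endVertex e₀ par y))| : ℤ) : _) := by
    intro i hi y hxy hd
    have hiv : Γ.endVertex i = v := (hdown i hi).2 ((hd _).2 (.inl rfl))
    rw [localMult, if_pos ⟨i, hi, hiv⟩]
    congr 1
    by_cases hy : ∃ j ∈ marks deg, y = .inr j
    · obtain ⟨j, hj, rfl⟩ := hy
      have hz : degSum deg (pointCluster Γ.endVertex e₀ par (.inr j)) = 0 := by
        simp [degSum, pointCluster, mem_marks.1 hj]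
      rw [Finset.prod_eq_zero (i := i) (Finset.mem_filter.2 ⟨hi, hiv⟩), hz, map_zero, abs_zero]
      rw [Γ.abs_slopeAtMark h hi hiv hxy hd, hz, map_zero, abs_zero]
    · rw [Finset.prod_eq_single i, Γ.abs_slopeAtMark h hi hiv hxy hd]
      · intro j hj hji
        obtain ⟨hj, hjv⟩ := Finset.mem_filter.1 hj
        rcases (hd _).1 ((hdown j hj).1 hjv) with h3 | h3
        · exact absurd (Sum.inr_injective h3) hji
        · exact absurd ⟨j, hj, h3.symm⟩ hy
      · intro h3
        exact absurd (Finset.mem_filter.2 ⟨hi, hiv⟩) h3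
  by_cases hx : ∃ i ∈ marks deg, pointCluster Γ.endVertex e₀ par x = {i}
  · obtain ⟨i, hi, hix⟩ := hx
    obtain rfl := hmark i hi x hix
    rw [hix, nodeWeight_mark_left hi (Finset.disjoint_singleton_left.1 (hix ▸ hdis)), key i hi y hxy hd]
  by_cases hy : ∃ i ∈ marks deg, pointCluster Γ.endVertex e₀ par y = {i}
  · obtain ⟨i, hi, hiy⟩ := hy
    obtain rfl := hmark i hi y hiy
    rw [hiy, nodeWeight_mark_right hi (Finset.disjoint_singleton_right.1 (hiy ▸ hdis)),
      key i hi x hxy.symm fun z => (hd z).trans or_comm]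
  rw [nodeWeight_of_not_mark hdis (fun i hi h' => hx ⟨i, hi, h'⟩) (fun i hi h' => hy ⟨i, hi, h'⟩),
    localMult, if_neg]
  · exact (Γ.vertexWeight_out hω h hxy hd (Γ.exists_flag_ne v).choose_spec.choose_spec).symm
  · rintro ⟨i, hi, hiv⟩
    rcases (hd _).1 ((hdown i hi).1 hiv) with rfl | rfl
    · exact hx ⟨i, hi, rfl⟩
    · exact hy ⟨i, hi, rfl⟩

end Multiplicity


/-! ### The count of the solutions -/

section Count

variable {N E : Type*} [AddCommGroup N] [Fintype E] [DecidableEq E]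

theorem BTree.nondegenerate_of_coeff_ne_zero {R : Type*} [CommRing R]
    {k : Finset E → Finset E → R} : ∀ {T : BTree E}, T.coeff k ≠ 0 → T.Nondegenerate k
  | leaf _, _ => trivial
  | node _ _, h => ⟨left_ne_zero_of_mul h,
      nondegenerate_of_coeff_ne_zero (left_ne_zero_of_mul (right_ne_zero_of_mul h)),
      nondegenerate_of_coeff_ne_zero (right_ne_zero_of_mul (right_ne_zero_of_mul h))⟩

variable {deg : E → N} {ω : LinearMap.BilinForm ℤ N} {φ : E → Module.Dual ℤ N}
  {K : Submodule ℤ (⋀[ℤ]^2 N)} {e₀ : E}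

/-- The laminar family of a curve with the root `e₀`. -/
def Curve.family (Γ : Curve deg) (e₀ : E) : Finset (Finset E) :=
  clusters Γ.endVertex e₀ (exists_isPar Γ.isTree (Γ.endVertex e₀)).choose

theorem Curve.family_eq (Γ : Curve deg) {par : Γ.V → Γ.V} {rank : Γ.V → ℕ}
    (h : IsPar Γ.graph (Γ.endVertex e₀) par rank) : Γ.family e₀ = clusters Γ.endVertex e₀ par := by
  obtain ⟨rank', h'⟩ := (exists_isPar Γ.isTree (Γ.endVertex e₀)).choose_spec
  rw [Curve.family, funext (h'.unique h)]

theorem Curve.sameType_iff {Γ Γ' : Curve deg} :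
    Curve.SameType Γ Γ' ↔ Γ.family e₀ = Γ'.family e₀ := by
  obtain ⟨par, rank, h⟩ := exists_isPar Γ.isTree (Γ.endVertex e₀)
  obtain ⟨par', rank', h'⟩ := exists_isPar Γ'.isTree (Γ'.endVertex e₀)
  rw [Γ.family_eq h, Γ'.family_eq h']
  exact ⟨Curve.clusters_eq_of_sameType h h', Curve.sameType_of_clusters_eq h h'⟩

/-- A curve has at most `|E| - 2` vertices, with equality only for the trivalent ones. -/
theorem Curve.card_family (Γ : Curve deg) : (Γ.family e₀).card + 2 ≤ Fintype.card E ∧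
    ((Γ.family e₀).card + 2 = Fintype.card E ↔ Γ.IsTrivalent) := by
  obtain ⟨par, rank, h⟩ := exists_isPar Γ.isTree (Γ.endVertex e₀)
  have h2 := Γ.two_le_card_down h
  rw [Γ.family_eq h, h.card_clusters h2]
  refine ⟨(h.card_le_and_eq_iff h2).1, (h.card_le_and_eq_iff h2).2.trans ?_⟩
  exact forall_congr' fun v => (Γ.isTrivalentAt_iff h v).symm

variable [Module.Free ℤ N]

/-- The binary tree of a trivalent solution; its root weight is the multiplicity. -/
theorem Curve.exists_tree (hω : ω.IsAlt) (h0 : deg e₀ ≠ 0) {pick : Finset E → E}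
    (hpick : IsPick (marks deg) pick) {c : E → ℝ} {y : ℝ ⊗[ℤ] N} {Γ : Curve deg}
    (hΓ : Γ ∈ solutions deg ω φ e₀ c y) (ht : Γ.IsTrivalent) :
    ∃ T ∈ canonicalTrees pick (Finset.univ.erase e₀), T.nodes = Γ.family e₀ ∧
      T.rootWeight (nodeWeight K deg ω φ) (marks deg) (fun e f => (pairing deg ω φ e f : ℝ))
        (fun e => c e - endForm deg ω φ e y) = solutionMult deg ω φ K Γ := by
  obtain ⟨par, rank, h⟩ := exists_isPar Γ.isTree (Γ.endVertex e₀)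
  obtain ⟨T, hT1, hT2, hT3, hT4⟩ := h.exists_canonicalTree (κ := localMult deg ω φ K Γ)
    (fun v => (Γ.isTrivalentAt_iff h v).1 (ht v)) hpick.mem
    (fun v x y hxy hd => nodeWeight_pointCluster hω h0 Γ h hxy hd)
  rw [prod_localMult] at hT4
  refine ⟨T, (mem_canonicalTrees _ _ _).2 ⟨hT1, hT2⟩, by rw [hT3, Γ.family_eq h], ?_⟩
  rw [← hT4]
  by_cases hn : T.Nondegenerate (nodeWeight K deg ω φ)
  · obtain ⟨l, -, hl1, -, hl2⟩ := Curve.exists_lengths_of_mem_solutions h hΓ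
    refine BTree.rootWeight_of_rootAllPos ((BTree.rootAllPos_iff_of_isLengths (c := l)
      (fun e f hf => by simp [pairing, mem_marks.1 hf]) (fun e he f hf => ?_)
      (nodeWeight_ne_zero hω) hT1 hn fun e he => ?_).1.2 fun A hA hA' => ?_)
    · rw [mem_marks] at he hf
      simp only [pairing, he, hf, if_false]
      rw [← hω.neg_eq (deg f) (deg e)]
      push_cast
      ring
    · rw [hT3]
      rw [hT2] at he
      exact hl2 e (Finset.ne_of_mem_erase he)
    · rw [hT3] at hA
      rw [hT2] at hA'
      exact hl1 A hA hA'
  · rw [BTree.rootWeight_of_not_nondegenerate hn]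
    by_contra h3
    exact hn (BTree.nondegenerate_of_coeff_ne_zero (Ne.symm h3))

/-- Each tree without nodes of weight zero either has a negative length or comes from a solution. A
tree with nonnegative lengths defines a solution in which the edges of length zero are contracted;
this solution is trivalent as the constraints are generic, hence no edge is contracted. -/
theorem exists_solution_of_tree (hω : ω.IsAlt) (h0 : deg e₀ ≠ 0) (hsum : ∑ e, deg e = 0)
    {c : E → ℝ} {y : ℝ ⊗[ℤ] N} (hy : endForm deg ω φ e₀ y = c e₀)
    (hm : ∑ e ∈ Finset.univ.erase e₀ \ marks deg, (c e - endForm deg ω φ e y) = 0)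
    (hcard : 1 < (Finset.univ.erase e₀ \ marks deg).card)
    (hgen : Curve.IsGenericFibre (solutions deg ω φ e₀ c y)) {pick : Finset E → E} {T : BTree E}
    (hT : T ∈ canonicalTrees pick (Finset.univ.erase e₀))
    (hn : T.Nondegenerate (nodeWeight K deg ω φ)) :
    T.RootSomeNeg (marks deg) (fun e f => (pairing deg ω φ e f : ℝ))
      (fun e => c e - endForm deg ω φ e y) ∨
    T.RootAllPos (marks deg) (fun e f => (pairing deg ω φ e f : ℝ))
      (fun e => c e - endForm deg ω φ e y) ∧
    ∃ Γ ∈ solutions deg ω φ e₀ c y, Γ.family e₀ = T.nodes := by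
  classical
  obtain ⟨hT1, hT2⟩ := (mem_canonicalTrees _ _ _).1 hT
  have hr : ∀ e, ∀ f ∈ marks deg, (pairing deg ω φ e f : ℝ) = 0 :=
    fun e f hf => by simp [pairing, mem_marks.1 hf]
  have ha : ∀ e ∉ marks deg, ∀ f ∉ marks deg,
      (pairing deg ω φ e f : ℝ) = -(pairing deg ω φ f e : ℝ) := by
    intro e he f hf
    rw [mem_marks] at he hf
    simp only [pairing, he, hf, if_false]
    rw [← hω.neg_eq (deg f) (deg e)]
    push_cast
    ring
  have hcard' : 1 < (Finset.univ.erase e₀).card :=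
    hcard.trans_le (Finset.card_le_card Finset.sdiff_subset)
  obtain ⟨l, hl⟩ := BTree.exists_isLengths hr ha (nodeWeight_ne_zero hω) hT1 hn (by rw [hT2]; exact hm)
    (fun i _ hi => by
      rw [hT2] at hi
      rw [hi, Finset.card_singleton] at hcard'
      omega)
  obtain ⟨hpos, hneg⟩ := BTree.rootAllPos_iff_of_isLengths hr ha (nodeWeight_ne_zero hω) hT1 hn hl
  rw [hpos, hneg]
  by_cases hex : ∃ A ∈ T.nodes, A ≠ T.leaves ∧ l A < 0
  · exact .inl hex
  right
  push Not at hex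
  -- the nodes at which the curve really branches
  set 𝓛 := T.nodes.filter fun A => A = Finset.univ.erase e₀ ∨ l A ≠ 0 with h𝓛
  have hroot : Finset.univ.erase e₀ ∈ T.nodes := by
    rcases T.eq_leaf_or_mem_nodes with ⟨e, rfl⟩ | h
    · rw [← hT2, BTree.leaves, Finset.card_singleton] at hcard'
      omega
    · rwa [hT2] at h
  have hlam : IsLaminar e₀ 𝓛 :=
    { root := Finset.mem_filter.2 ⟨hroot, .inl rfl⟩
      notMem := fun A hA h => by
        have := BTree.subset_leaves_of_mem_nodes (Finset.mem_filter.1 hA).1 h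
        rw [hT2] at this
        exact Finset.notMem_erase _ _ this
      two_le := fun A hA => BTree.two_le_card_of_mem_nodes hT1 (Finset.mem_filter.1 hA).1
      laminar := fun A hA B hB => BTree.laminar_nodes hT1 (Finset.mem_filter.1 hA).1
        (Finset.mem_filter.1 hB).1 }
  obtain ⟨Γ, hΓ, par, rank, h, hcl⟩ := hlam.exists_mem_solutions (φ := φ) hω h0 hsum (l := l)
    (fun A hA hA' => by
      obtain ⟨h1, h2⟩ := Finset.mem_filter.1 hA
      exact lt_of_le_of_ne (hex A h1 (by rwa [hT2])) (h2.resolve_left hA').symm) hy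
    (fun e he => by
      refine (hl e (by rw [hT2]; exact Finset.mem_erase.2 ⟨he, Finset.mem_univ _⟩)).trans ?_
      refine lengthSum_eq_of_subset _ (Finset.filter_subset _ _) fun A hA hA' _ => ?_
      by_contra h3
      exact hA' (Finset.mem_filter.2 ⟨hA, .inr h3⟩))
  have hfam : Γ.family e₀ = 𝓛 := (Γ.family_eq h).trans hcl
  have hEq : 𝓛 = T.nodes := by
    refine Finset.eq_of_subset_of_card_le (Finset.filter_subset _ _) ?_
    have h1 := (Γ.card_family (e₀ := e₀)).2.2 (hgen Γ hΓ).1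
    have h2 := BTree.card_nodes hT1
    rw [hT2, Finset.card_erase_of_mem (Finset.mem_univ _), Finset.card_univ] at h2
    rw [hfam] at h1
    omega
  refine ⟨fun A hA hA' => ?_, Γ, hΓ, hfam.trans hEq⟩
  have h1 := hA
  rw [← hEq] at h1
  exact lt_of_le_of_ne (hex A hA hA') ((Finset.mem_filter.1 h1).2.resolve_left (by rwa [← hT2])).symm

/-- For generic constraints, the solutions are counted by the tree sum, hence by the resolvent sum
of the unmarked ends and one factor for each marked point. The constraints do not occur in the
result. -/
theorem count_solutions (hω : ω.IsAlt) (h0 : deg e₀ ≠ 0) (hsum : ∑ e, deg e = 0) {v : E → ℚ}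
    (hv : ∀ A B : Finset E, A.Nonempty → B.Nonempty → Disjoint A B → perturbSum v A B ≠ 0)
    (hK : ∀ A B : Finset E, A ⊆ Finset.univ.erase e₀ → B ⊆ Finset.univ.erase e₀ → Disjoint A B →
      Disjoint A (marks deg) → Disjoint B (marks deg) → A.Nonempty → B.Nonempty →
      ω (degSum deg A) (degSum deg B) = 0 → wedge (degSum deg A) (degSum deg B) ∈ K)
    {c : E → ℝ} {y : ℝ ⊗[ℤ] N} (hy : endForm deg ω φ e₀ y = c e₀)
    (hm : ∑ e ∈ Finset.univ.erase e₀ \ marks deg, (c e - endForm deg ω φ e y) = 0)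
    (hcard : 1 < (Finset.univ.erase e₀ \ marks deg).card)
    (hgen : Curve.IsGenericFibre (solutions deg ω φ e₀ c y)) :
    (Curve.classes (solutions deg ω φ e₀ c y)).Finite ∧
    Curve.count (solutions deg ω φ e₀ c y) (solutionMult deg ω φ K) =
      flowSum (fun X Z Y => qPow K (wedge (degSum deg (Z \ X)) (degSum deg (Y \ Z))))
        (finalState _ (lexPos (fun e f => (pairing deg ω φ e f : ℝ)) v)) ∅
        (Finset.univ.erase e₀ \ marks deg)
        (fun Z => ind _ (lexPos (fun e f => (pairing deg ω φ e f : ℝ)) v Z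
          ((Finset.univ.erase e₀ \ marks deg) \ Z))) *
      ∏ i ∈ Finset.univ.erase e₀ ∩ marks deg,
        (markFactor (fun i e => φ i (deg e)) (Finset.univ.erase e₀ \ marks deg) i
          (∑ e ∈ Finset.univ.erase e₀ \ marks deg, φ i (deg e) < 0) :
            AddMonoidAlgebra ℤ ((⋀[ℤ]^2 N) ⧸ K)) := by
  classical
  have : Nonempty E := ⟨e₀⟩
  obtain ⟨pick, hpick⟩ := exists_isPick (marks deg)
  set W : BTree E → AddMonoidAlgebra ℤ ((⋀[ℤ]^2 N) ⧸ K) := fun T =>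
    T.rootWeight (nodeWeight K deg ω φ) (marks deg) (fun e f => (pairing deg ω φ e f : ℝ))
      (fun e => c e - endForm deg ω φ e y) with hW
  have htree := fun (Γ : Curve deg) (hΓ : Γ ∈ solutions deg ω φ e₀ c y) =>
    Curve.exists_tree (K := K) hω h0 hpick hΓ (hgen Γ hΓ).1
  have hout : ∀ q ∈ Curve.classes (solutions deg ω φ e₀ c y),
      Quotient.out q ∈ solutions deg ω φ e₀ c y := by
    rintro q ⟨Γ, hΓ, rfl⟩
    exact (Curve.Isom.symm (Quotient.mk_out (s := Curve.setoid deg) Γ)).mem_solutions hΓ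
  have hg : ∀ q : Curve.Moduli deg, ∃ T : BTree E, q ∈ Curve.classes (solutions deg ω φ e₀ c y) →
      T ∈ canonicalTrees pick (Finset.univ.erase e₀) ∧ T.nodes = (Quotient.out q).family e₀ ∧
      W T = solutionMult deg ω φ K (Quotient.out q) := by
    intro q
    by_cases hq : q ∈ Curve.classes (solutions deg ω φ e₀ c y)
    · obtain ⟨T, hT⟩ := htree _ (hout q hq)
      exact ⟨T, fun _ => hT⟩
    · exact ⟨.leaf e₀, fun h => absurd h hq⟩
  choose g hg using hg
  have hinj : Set.InjOn g (Curve.classes (solutions deg ω φ e₀ c y)) := by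
    intro q hq q' hq' hqq
    have h1 : (Quotient.out q).family e₀ = (Quotient.out q').family e₀ := by
      rw [← (hg q hq).2.1, hqq, (hg q' hq').2.1]
    have h2 := (hgen _ (hout q hq)).2 _ (hout q' hq') (Curve.sameType_iff.2 h1)
    rw [← Quotient.out_eq (s := Curve.setoid deg) q, ← Quotient.out_eq (s := Curve.setoid deg) q']
    exact Quotient.sound (s := Curve.setoid deg) h2
  have hmaps : Set.MapsTo g (Curve.classes (solutions deg ω φ e₀ c y))
      ↑(canonicalTrees pick (Finset.univ.erase e₀)) := fun q hq => (hg q hq).1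
  refine ⟨Set.Finite.of_injOn hmaps hinj (Finset.finite_toSet _), ?_⟩
  have hsystem := isWeightSystem (φ := φ) hω hv hK
  rw [← sum_rootWeight_eq_of_regular hv hsystem (fun e f => ⟨_, rfl⟩) (nodeWeight_ne_zero hω) hpick
    subset_rfl hcard hm (fun T hT hn => (exists_solution_of_tree hω h0 hsum hy hm hcard hgen hT hn).symm.imp
      And.left id)]
  rw [Curve.count, ← finsum_mem_coe_finset, finsum_mem_congr rfl
    (fun q hq => (hg q hq).2.2.symm), ← finsum_mem_image (f := W) hinj]
  refine finsum_mem_inter_support_eq _ _ _ (Set.ext fun T => ?_)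
  simp only [Set.mem_inter_iff, Function.mem_support]
  refine and_congr_left fun hT0 => ⟨?_, fun hT => ?_⟩
  · rintro ⟨q, hq, rfl⟩
    exact hmaps hq
  · have hn : T.Nondegenerate (nodeWeight K deg ω φ) := by
      by_contra hn
      exact hT0 (BTree.rootWeight_of_not_nondegenerate hn)
    rcases exists_solution_of_tree hω h0 hsum hy hm hcard hgen hT hn with h3 | ⟨-, Γ, hΓ, hfam⟩
    · exact absurd (BTree.rootWeight_of_rootSomeNeg h3) hT0
    · have hq : Quotient.mk (Curve.setoid deg) Γ ∈ Curve.classes (solutions deg ω φ e₀ c y) :=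
        ⟨Γ, hΓ, rfl⟩
      refine ⟨_, hq, ?_⟩
      obtain ⟨h4, h5, -⟩ := hg _ hq
      obtain ⟨h6, h7⟩ := (mem_canonicalTrees _ _ _).1 h4
      obtain ⟨h8, h9⟩ := (mem_canonicalTrees _ _ _).1 hT
      refine BTree.eq_of_nodes_eq h6 h8 (h7.trans h9.symm) ?_
      rw [h5, ← hfam]
      obtain ⟨f, hf, -⟩ := Quotient.mk_out (s := Curve.setoid deg) Γ
      exact Curve.sameType_iff.1 ⟨f, hf⟩

end Count


/-! ### Genericity of the constraints -/

section Genericity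

variable {N E : Type*} [AddCommGroup N] [Module.Free ℤ N] [Fintype E] [DecidableEq E]
  {deg : E → N} {ω : LinearMap.BilinForm ℤ N} {φ : E → Module.Dual ℤ N} {e₀ : E}

/-- The linear map from the lengths on a family of sets to the moments. -/
def lengthMap (Λ : E → E → ℝ) (𝓛 : Finset (Finset E)) : (𝓛 → ℝ) →ₗ[ℝ] (E → ℝ) :=
  (Matrix.of fun (e : E) (A : 𝓛) => if e ∈ A.1 then ∑ f ∈ A.1, Λ e f else 0).mulVecLin

theorem lengthMap_apply (Λ : E → E → ℝ) (𝓛 : Finset (Finset E)) (l : Finset E → ℝ) (e : E) :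
    lengthMap Λ 𝓛 (fun A => l A.1) e = lengthSum Λ 𝓛 l e := by
  rw [lengthSum, Finset.sum_filter, ← Finset.sum_coe_sort 𝓛]
  simp only [lengthMap, Matrix.mulVecLin_apply, Matrix.mulVec, dotProduct, Matrix.of_apply]
  refine Finset.sum_congr rfl fun A _ => ?_
  split_ifs
  · exact mul_comm _ _
  · exact zero_mul _

/-- The exceptional subspaces are the proper ones among the preimages of the ranges of the maps
`lengthMap`. Outside of them, the type of a solution has a map of rank at least `|E| - 2`. As it has
at most `|E| - 2` vertices, it is trivalent, and its map is injective. -/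
theorem holdsGenerically_solutions {W : Type*} [AddCommGroup W] [Module ℝ W]
    (C : W →ₗ[ℝ] (E → ℝ)) (Y : W →ₗ[ℝ] (ℝ ⊗[ℤ] N))
    (hsurj : ∀ m : E → ℝ, ∑ e ∈ Finset.univ.erase e₀ \ marks deg, m e = 0 →
      ∃ w, ∀ e ≠ e₀, C w e - endForm deg ω φ e (Y w) = m e) :
    HoldsGenerically fun w => Curve.IsGenericFibre (solutions deg ω φ e₀ (C w) (Y w)) := by
  classical
  let Λ : E → E → ℝ := fun e f => pairing deg ω φ e f
  let M : W →ₗ[ℝ] (E → ℝ) := LinearMap.pi fun e =>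
    if e = e₀ then 0 else LinearMap.proj e ∘ₗ C - endForm deg ω φ e ∘ₗ Y
  have hM : ∀ w, ∀ e ≠ e₀, M w e = C w e - endForm deg ω φ e (Y w) := fun w e he => by
    simp [M, he]
  have hM0 : ∀ w, M w e₀ = 0 := fun w => by simp [M]
  -- the constraints for which some lengths on the family `𝓛` produce the given moments
  let U : Finset (Finset E) → Submodule ℝ W := fun 𝓛 => (LinearMap.range (lengthMap Λ 𝓛)).comap M
  -- the families of moments that occur have codimension at most two
  have hrank : ∀ 𝓛, U 𝓛 = ⊤ →
      Fintype.card E ≤ Module.finrank ℝ (LinearMap.range (lengthMap Λ 𝓛)) + 2 := by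
    intro 𝓛 h
    let σ : (E → ℝ) →ₗ[ℝ] ℝ × ℝ := (LinearMap.proj e₀).prod
      (∑ e ∈ Finset.univ.erase e₀ \ marks deg, LinearMap.proj e)
    have h1 := σ.finrank_range_add_finrank_ker
    have h2 := Submodule.finrank_le (LinearMap.range σ)
    rw [Module.finrank_prod, Module.finrank_self] at h2
    rw [Module.finrank_fintype_fun_eq_card] at h1
    have h3 : LinearMap.ker σ ≤ LinearMap.range (lengthMap Λ 𝓛) := by
      intro m hm
      have hm0 : m e₀ = 0 := congrArg Prod.fst (LinearMap.mem_ker.1 hm)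
      have hm1 := congrArg Prod.snd (LinearMap.mem_ker.1 hm)
      obtain ⟨w, hw⟩ := hsurj m (by simpa [σ] using hm1)
      have h4 : w ∈ U 𝓛 := h ▸ Submodule.mem_top
      have h5 : M w = m := by
        ext e
        by_cases he : e = e₀
        · rw [he, hM0, hm0]
        · rw [hM w e he, hw e he]
      exact h5 ▸ h4
    have h4 := Submodule.finrank_mono h3
    omega
  refine ⟨{U' | U' ≠ ⊤ ∧ ∃ 𝓛, U' = U 𝓛}, (Set.finite_range U).subset ?_, fun U' h => h.1, ?_⟩
  · rintro U' ⟨-, 𝓛, rfl⟩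
    exact ⟨𝓛, rfl⟩
  intro w hw Γ hΓ
  have hw' : ∀ 𝓛, w ∈ U 𝓛 → U 𝓛 = ⊤ := by
    intro 𝓛 h
    by_contra hne
    exact hw _ ⟨hne, 𝓛, rfl⟩ h
  have hlengths : ∀ Γ ∈ solutions deg ω φ e₀ (C w) (Y w), ∀ l : Finset E → ℝ,
      (∀ e ≠ e₀, C w e - endForm deg ω φ e (Y w) = lengthSum Λ (Γ.family e₀) l e) →
      lengthMap Λ (Γ.family e₀) (fun A => l A.1) = M w := by
    intro Γ _ l hl
    ext e
    rw [lengthMap_apply]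
    by_cases he : e = e₀
    · subst he
      obtain ⟨par, rank, h⟩ := exists_isPar Γ.isTree (Γ.endVertex e)
      rw [hM0, lengthSum, Finset.filter_false_of_mem, Finset.sum_empty]
      intro A hA
      rw [Γ.family_eq h] at hA
      exact (h.isLaminar (Γ.two_le_card_down h)).notMem A hA
    · rw [hM w e he, hl e he]
  obtain ⟨par, rank, h⟩ := exists_isPar Γ.isTree (Γ.endVertex e₀)
  have hfam := Γ.family_eq h
  obtain ⟨l, hl1, -, hl2, hl3⟩ := Curve.exists_lengths_of_mem_solutions h hΓ
  rw [← hfam] at hl3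
  have hl4 := hlengths Γ hΓ l hl3
  have h3 := hrank _ (hw' (Γ.family e₀) ⟨_, hl4⟩)
  have h4 := (lengthMap Λ (Γ.family e₀)).finrank_range_add_finrank_ker
  rw [Module.finrank_fintype_fun_eq_card, Fintype.card_coe] at h4
  obtain ⟨h5, h6⟩ := Γ.card_family (e₀ := e₀)
  refine ⟨h6.1 (by omega), fun Γ' hΓ' hs => ?_⟩
  have hker : LinearMap.ker (lengthMap Λ (Γ.family e₀)) = ⊥ :=
    Submodule.finrank_eq_zero.1 (by omega)
  obtain ⟨par', rank', h'⟩ := exists_isPar Γ'.isTree (Γ'.endVertex e₀)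
  have hfam' := Γ'.family_eq h'
  obtain ⟨l', hl1', -, hl2', hl3'⟩ := Curve.exists_lengths_of_mem_solutions h' hΓ'
  rw [← hfam'] at hl3'
  have hl4' := hlengths Γ' hΓ' l' hl3'
  have hff := Curve.sameType_iff (e₀ := e₀).1 hs
  rw [← hff] at hl4'
  have hll := LinearMap.ker_eq_bot.1 hker (hl4.trans hl4'.symm)
  have hll' : ∀ A ∈ Γ.family e₀, l A = l' A := fun A hA => congrFun hll ⟨A, hA⟩
  refine Curve.isom_of_lengths_eq h h' hs (l := l) hl1 (fun v hv => ?_) hl2 fun v => ?_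
  · rw [← hl1' v hv]
    refine hll' _ ?_
    rw [hff, hfam']
    exact mem_clusters.2 ⟨v, rfl⟩
  · rw [hl2' v]
    congr 1
    refine Finset.sum_congr rfl fun A hA => ?_
    rw [hll' A]
    rw [hff, hfam']
    exact (Finset.mem_filter.1 hA).1

end Genericity

/-! ### Bivectors of `K_ω` -/

section KerSpan

variable {N I : Type*} [AddCommGroup N] [Module.Free ℤ N] [Fintype I] [DecidableEq I]

/-- The bivector of two disjoint blocks occurs at a vertex of some curve of degree `Δ`, namely the
one with the two blocks immediately above a trivalent vertex. -/
theorem wedge_degSum_mem_kerSpan {Δ : I → N} (hcard : 3 ≤ Fintype.card I) (hsum : ∑ e, Δ e = 0)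
    (ω : LinearMap.BilinForm ℤ N) (e₀ : I) {A B : Finset I} (hA : A ⊆ Finset.univ.erase e₀)
    (hB : B ⊆ Finset.univ.erase e₀) (hd : Disjoint A B) (hA' : A.Nonempty) (hB' : B.Nonempty)
    (h : ω (degSum Δ A) (degSum Δ B) = 0) : wedge (degSum Δ A) (degSum Δ B) ∈ kerSpan Δ ω := by
  classical
  set 𝓛 : Finset (Finset I) :=
    ({Finset.univ.erase e₀, A ∪ B, A, B} : Finset (Finset I)).filter fun C => 2 ≤ C.card with h𝓛
  have hU : A ∪ B ⊆ Finset.univ.erase e₀ := Finset.union_subset hA hB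
  have hsub : ∀ C ∈ 𝓛, C ⊆ Finset.univ.erase e₀ := by
    intro C hC
    simp only [h𝓛, Finset.mem_filter, Finset.mem_insert, Finset.mem_singleton] at hC
    rcases hC.1 with rfl | rfl | rfl | rfl
    exacts [subset_rfl, hU, hA, hB]
  have hlam : IsLaminar e₀ 𝓛 :=
    { root := by
        refine Finset.mem_filter.2 ⟨by simp, ?_⟩
        rw [Finset.card_erase_of_mem (Finset.mem_univ _), Finset.card_univ]
        omega
      notMem := fun C hC he => Finset.notMem_erase _ _ (hsub C hC he)
      two_le := fun C hC => (Finset.mem_filter.1 hC).2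
      laminar := by
        intro C hC C' hC'
        have h1 := hsub C hC
        have h2 := hsub C' hC'
        have h3 : A ⊆ A ∪ B := Finset.subset_union_left
        have h4 : B ⊆ A ∪ B := Finset.subset_union_right
        have hd' := hd.symm
        simp only [h𝓛, Finset.mem_filter, Finset.mem_insert, Finset.mem_singleton] at hC hC'
        rcases hC.1 with rfl | rfl | rfl | rfl <;> rcases hC'.1 with rfl | rfl | rfl | rfl <;>
          simp_all }
  obtain ⟨Γ, par, rank, hp, hcl, -⟩ := hlam.exists_curve Δ hsum (fun _ => 1)
    (fun _ _ _ => one_pos) 0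
  have hpoint : ∀ C : Finset I, C ∈ ({Finset.univ.erase e₀, A ∪ B, A, B} : Finset (Finset I)) →
      C ⊆ Finset.univ.erase e₀ → C.Nonempty → ∃ x : Γ.V ⊕ I, x ≠ .inr e₀ ∧
        pointCluster Γ.endVertex e₀ par x = C := by
    intro C hC hCs hC'
    by_cases h2 : 2 ≤ C.card
    · obtain ⟨v, hv⟩ := mem_clusters.1 (hcl.symm ▸ Finset.mem_filter.2 ⟨hC, h2⟩ :
        C ∈ clusters Γ.endVertex e₀ par)
      exact ⟨.inl v, by simp, hv⟩
    · obtain ⟨e, rfl⟩ := Finset.card_eq_one.1 (show C.card = 1 by have := hC'.card_pos; omega)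
      refine ⟨.inr e, ?_, rfl⟩
      rintro ⟨⟩
      exact Finset.notMem_erase _ _ (hCs (Finset.mem_singleton_self e₀))
  obtain ⟨x, hx, hxA⟩ := hpoint A (by simp) hA hA'
  obtain ⟨y, hy, hyB⟩ := hpoint B (by simp) hB hB'
  have hv : A ∪ B ∈ clusters Γ.endVertex e₀ par := by
    rw [hcl]
    refine Finset.mem_filter.2 ⟨by simp, ?_⟩
    rw [Finset.card_union_of_disjoint hd]
    have := hA'.card_pos
    have := hB'.card_pos
    omega
  obtain ⟨v, hv⟩ := mem_clusters.1 hv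
  obtain ⟨hxy, hdown⟩ := hp.down_eq_pair (Γ.two_le_card_down hp) (v := v) hx hy
    (by rwa [hxA, hyB]) (by rw [hxA, hyB, hv])
  have htri : Γ.IsTrivalentAt v := by
    rw [Γ.isTrivalentAt_iff hp, show down Γ.endVertex e₀ par v = {x, y} by ext z; simp [hdown],
      Finset.card_pair hxy]
  obtain ⟨F, -, -, hF⟩ := (Γ.exists_flagEquiv hp).2.2 v
  have h1 := hF ⟨x, (hdown x).2 (.inl rfl)⟩
  have h2 := hF ⟨y, (hdown y).2 (.inr rfl)⟩
  simp only [hxA] at h1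
  simp only [hyB] at h2
  refine Submodule.subset_span ⟨Γ, v, F (some ⟨x, (hdown x).2 (.inl rfl)⟩),
    F (some ⟨y, (hdown y).2 (.inr rfl)⟩), htri, fun hne => hxy ?_, ?_, ?_⟩
  · have := F.injective hne
    simpa using this
  · rw [h1, h2, h]
  · rw [h1, h2]

end KerSpan

/-! ### Functoriality of the resolvent sums -/

section Map

variable {E I R : Type*} [DecidableEq E] [DecidableEq I] [CommRing R]

theorem flowSum_map (i : I ↪ E) {Q e : Finset I → Finset I → Finset I → R}
    {Q' e' : Finset E → Finset E → Finset E → R}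
    (hQ : ∀ X Z Y, Q' (X.map i) (Z.map i) (Y.map i) = Q X Z Y)
    (he : ∀ X Y Z, e' (X.map i) (Y.map i) (Z.map i) = e X Y Z) (X Y : Finset I)
    {ε : Finset I → R} {ε' : Finset E → R} (hε : ∀ Z, ε' (Z.map i) = ε Z) :
    flowSum Q' e' (X.map i) (Y.map i) ε' = flowSum Q e X Y ε := by
  induction hn : (Y \ X).card using Nat.strong_induction_on generalizing X Y ε ε' with
  | _ n ih =>
    have hcard : (Y.map i \ X.map i).card = (Y \ X).card := by
      rw [← Finset.map_sdiff, Finset.card_map]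
    by_cases h1 : (Y \ X).card ≤ 1
    · rw [flowSum_of_card_le_one _ _ h1, flowSum_of_card_le_one _ _ (hcard ▸ h1)]
    · rw [flowSum_of_one_lt_card _ _ (by omega), flowSum_of_one_lt_card _ _ (by omega)]
      symm
      refine Finset.sum_bij (fun Z _ => Z.map i) (fun Z hZ => ?_) (fun Z _ Z' _ h => ?_)
        (fun Z' hZ' => ?_) fun Z hZ => ?_
      · rw [Finset.mem_Ioo] at hZ ⊢
        exact ⟨Finset.map_ssubset_map.2 hZ.1, Finset.map_ssubset_map.2 hZ.2⟩
      · exact Finset.map_injective i h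
      · rw [Finset.mem_Ioo] at hZ'
        obtain ⟨Z, -, rfl⟩ := Finset.subset_map_iff.1 hZ'.2.subset
        exact ⟨Z, Finset.mem_Ioo.2 ⟨Finset.map_ssubset_map.1 hZ'.1, Finset.map_ssubset_map.1 hZ'.2⟩, rfl⟩
      · have h2 := card_sdiff_lt_of_mem_Ioo hZ
        rw [hQ, he, hε, ih _ (hn ▸ h2.1) X Z hε rfl, ih _ (hn ▸ h2.2) Z Y (he X Y) rfl]

theorem lexPos_map (i : I ↪ E) {Λ : I → I → ℝ} {Λ' : E → E → ℝ} (hΛ : ∀ a b, Λ' (i a) (i b) = Λ a b)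
    (v : E → ℚ) (A B : Finset I) :
    lexPos Λ' v (A.map i) (B.map i) ↔ lexPos Λ (fun a => v (i a)) A B := by
  simp only [lexPos, blockSum, perturbSum, Finset.sum_map, Finset.card_map, hΛ]

end Map


/-! ### The line `D` and the moment of the end `e₀` -/

section Line

variable {N : Type*} [AddCommGroup N]

theorem mem_lineD {n δ : N} {x h : ℝ ⊗[ℤ] N} : Submodule.Quotient.mk h ∈ lineD n δ x ↔
    ∃ t s : ℝ, h = x + t • toReal δ + s • toReal n := by
  rw [lineD, AffineSubspace.mem_mk', vsub_eq_sub, Submodule.mem_span_singleton]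
  refine exists_congr fun t => ?_
  rw [← Submodule.Quotient.mk_smul, ← Submodule.Quotient.mk_sub, eq_comm, Submodule.Quotient.eq,
    Submodule.mem_span_singleton]
  refine exists_congr fun s => ?_
  rw [eq_comm, sub_sub, sub_eq_iff_eq_add, add_comm (s • _)]

/-- The point of the line through `x` with slope `δ` at which the end of slope `n` has the moment
`μ`. -/
def basePoint (ω : LinearMap.BilinForm ℤ N) (n δ : N) : ℝ × (ℝ ⊗[ℤ] N) →ₗ[ℝ] (ℝ ⊗[ℤ] N) :=
  LinearMap.snd _ _ _ + (LinearMap.toSpanSingleton ℝ _ (toReal δ)) ∘ₗ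
    ((ω n δ : ℝ)⁻¹ • (LinearMap.fst _ _ _ - formReal ω (toReal n) ∘ₗ LinearMap.snd _ _ _))

variable {ω : LinearMap.BilinForm ℤ N} {n δ : N}

theorem basePoint_apply (μ : ℝ) (x : ℝ ⊗[ℤ] N) : basePoint ω n δ (μ, x) =
    x + ((ω n δ : ℝ)⁻¹ * (μ - formReal ω (toReal n) x)) • toReal δ := rfl

theorem formReal_basePoint (hδ : ω n δ ≠ 0) (μ : ℝ) (x : ℝ ⊗[ℤ] N) :
    formReal ω (toReal n) (basePoint ω n δ (μ, x)) = μ := by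
  have : (ω n δ : ℝ) ≠ 0 := by exact_mod_cast hδ
  rw [basePoint_apply, map_add, map_smul, formReal_toReal, smul_eq_mul]
  field_simp
  ring

/-- The condition `h(e₀) ∈ D` and the moment `μ` of `e₀` determine the affine line spanned by the
end `e₀`. -/
theorem mem_lineD_and_moment_iff (hω : ω.IsAlt) (hδ : ω n δ ≠ 0) {μ : ℝ} {x h : ℝ ⊗[ℤ] N} :
    (formReal ω (toReal n) h = μ ∧ Submodule.Quotient.mk h ∈ lineD n δ x) ↔
      ∃ s : ℝ, h = basePoint ω n δ (μ, x) + s • toReal n := by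
  have h0 : (ω n δ : ℝ) ≠ 0 := by exact_mod_cast hδ
  have hnn : formReal ω (toReal n) (toReal n) = 0 := by simp [hω.self_eq_zero]
  rw [mem_lineD]
  constructor
  · rintro ⟨h1, t, s, rfl⟩
    refine ⟨s, ?_⟩
    have h2 : (ω n δ : ℝ)⁻¹ * (μ - formReal ω (toReal n) x) = t := by
      rw [← h1, map_add, map_add, map_smul, map_smul, hnn, formReal_toReal, smul_zero, add_zero,
        add_sub_cancel_left, smul_eq_mul, mul_comm t, inv_mul_cancel_left₀ h0]
    rw [basePoint_apply, h2]
  · rintro ⟨s, rfl⟩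
    refine ⟨?_, _, s, rfl⟩
    rw [map_add, map_smul, hnn, smul_zero, add_zero, formReal_basePoint hδ]

end Line

/-! ### The two enumerative problems -/

section Problems

variable {N I : Type*} [AddCommGroup N] [Fintype I] {Δ : I → N} {ω : LinearMap.BilinForm ℤ N} {e₀ : I}
  {δ : N}

/-- The moments of the unmarked ends other than `e₀`, with respect to a base point on the line of
`e₀`, have the sum zero. -/
theorem sum_endForm_eq_zero {E : Type*} [Fintype E] [DecidableEq E] {deg : E → N}
    {φ : E → Module.Dual ℤ N} {e₀ : E} (h0 : deg e₀ ≠ 0) (hsum : ∑ e, deg e = 0) {c : E → ℝ}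
    {y : ℝ ⊗[ℤ] N} (hy : endForm deg ω φ e₀ y = c e₀) (hc : ∑ e ∈ Finset.univ \ marks deg, c e = 0) :
    ∑ e ∈ Finset.univ.erase e₀ \ marks deg, (c e - endForm deg ω φ e y) = 0 := by
  have h1 : ∑ e ∈ Finset.univ \ marks deg, (c e - endForm deg ω φ e y) = 0 := by
    rw [Finset.sum_sub_distrib, hc, zero_sub, neg_eq_zero]
    have h2 : ∀ e ∈ Finset.univ \ marks deg, endForm deg ω φ e y =
        (formReal ω).flip y (toReal (deg e)) := fun e he => by
      have h3 : deg e ≠ 0 := fun h => (Finset.mem_sdiff.1 he).2 (mem_marks.2 h)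
      simp [endForm, h3]
    rw [Finset.sum_congr rfl h2, ← map_sum, ← toReal_sum]
    change (formReal ω).flip y (toReal (degSum deg (Finset.univ \ marks deg))) = 0
    rw [degSum_sdiff_marks, degSum, hsum, toReal_zero, map_zero]
  have h2 : e₀ ∈ Finset.univ \ marks deg := by simp [mem_marks, h0]
  rw [← Finset.add_sum_erase _ _ h2, hy, sub_self, zero_add] at h1
  rw [← h1]
  refine Finset.sum_congr ?_ fun _ _ => rfl
  ext e
  simp only [Finset.mem_sdiff, Finset.mem_erase]
  tauto

/-- The prescribed moments, as a linear function of the constraints of the `ω`-problem. -/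
def omegaConstraint (I : Type*) [Fintype I] (N : Type*) [AddCommGroup N] :
    (momentSpace I × (ℝ ⊗[ℤ] N)) →ₗ[ℝ] (I → ℝ) :=
  (momentSpace I).subtype ∘ₗ LinearMap.fst _ _ _

/-- The prescribed moments of the ends and values on the marked points, as a linear function of the
constraints of the problem with marked points. -/
def markedConstraint (I : Type*) [Fintype I] (N : Type*) [AddCommGroup N] (p : ℕ) :
    (momentSpace I × (ℝ ⊗[ℤ] N) × (Fin p → ℝ)) →ₗ[ℝ] (I ⊕ Fin p → ℝ) :=
  LinearMap.pi (Sum.elim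
    (fun e => LinearMap.proj e ∘ₗ (momentSpace I).subtype ∘ₗ LinearMap.fst _ _ _)
    fun i => LinearMap.proj i ∘ₗ LinearMap.snd _ _ _ ∘ₗ LinearMap.snd _ _ _)

/-- The base point on the line of the end `e₀`, as a linear function of the constraints. -/
def omegaBase (ω : LinearMap.BilinForm ℤ N) (Δ : I → N) (e₀ : I) (δ : N) :
    (momentSpace I × (ℝ ⊗[ℤ] N)) →ₗ[ℝ] (ℝ ⊗[ℤ] N) :=
  basePoint ω (Δ e₀) δ ∘ₗ
    ((LinearMap.proj e₀ ∘ₗ (momentSpace I).subtype ∘ₗ LinearMap.fst _ _ _).prod (LinearMap.snd _ _ _))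

/-- The base point on the line of the end `e₀`, for the problem with marked points. -/
def markedBase (ω : LinearMap.BilinForm ℤ N) (Δ : I → N) (e₀ : I) (δ : N) (p : ℕ) :
    (momentSpace I × (ℝ ⊗[ℤ] N) × (Fin p → ℝ)) →ₗ[ℝ] (ℝ ⊗[ℤ] N) :=
  omegaBase ω Δ e₀ δ ∘ₗ ((LinearMap.fst _ _ _).prod (LinearMap.fst _ _ _ ∘ₗ LinearMap.snd _ _ _))

theorem omegaSolutions_eq (hω : ω.IsAlt) (hΔ : ∀ e, Δ e ≠ 0) (hδ : ω (Δ e₀) δ ≠ 0)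
    (φ : I → Module.Dual ℤ N) (c : momentSpace I × (ℝ ⊗[ℤ] N)) :
    omegaSolutions Δ ω e₀ δ c =
      solutions Δ ω φ e₀ (omegaConstraint I N c) (omegaBase ω Δ e₀ δ c) := by
  have h1 : ∀ (Γ : Curve Δ) e, endForm Δ ω φ e (Γ.h (Γ.endVertex e)) = Γ.moment ω e := fun Γ e => by
    simp [endForm, hΔ e, Curve.moment]
  ext Γ
  change ((∀ e, Γ.moment ω e = c.1.1 e) ∧ _) ↔ ((∀ e, endForm Δ ω φ e _ = c.1.1 e) ∧
    ∃ s : ℝ, Γ.h (Γ.endVertex e₀) = basePoint ω (Δ e₀) δ (c.1.1 e₀, c.2) + s • toReal (Δ e₀))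
  simp only [h1]
  refine and_congr_right fun h2 => ?_
  rw [← mem_lineD_and_moment_iff hω hδ, and_iff_right]
  exact h2 e₀

theorem markedSolutions_eq (hω : ω.IsAlt) (hΔ : ∀ e, Δ e ≠ 0) (hδ : ω (Δ e₀) δ ≠ 0) {p : ℕ}
    (φ : Fin p → Module.Dual ℤ N) (c : momentSpace I × (ℝ ⊗[ℤ] N) × (Fin p → ℝ)) :
    markedSolutions Δ ω e₀ φ δ c =
      solutions (markedDegree Δ p) ω (Sum.elim (fun _ => 0) φ) (.inl e₀) (markedConstraint I N p c)
        (markedBase ω Δ e₀ δ p c) := by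
  have h1 : ∀ (Γ : Curve (markedDegree Δ p)) e, endForm (markedDegree Δ p) ω
      (Sum.elim (fun _ => 0) φ) (.inl e) (Γ.h (Γ.endVertex (.inl e))) = Γ.moment ω (.inl e) :=
    fun Γ e => by simp [endForm, markedDegree, hΔ e, Curve.moment]
  have h2 : ∀ (Γ : Curve (markedDegree Δ p)) i, endForm (markedDegree Δ p) ω
      (Sum.elim (fun _ => 0) φ) (.inr i) (Γ.h (Γ.endVertex (.inr i))) =
        dualReal (φ i) (Γ.h (Γ.endVertex (.inr i))) :=
    fun Γ i => by simp [endForm, markedDegree]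
  ext Γ
  change ((∀ e, Γ.moment ω (.inl e) = c.1.1 e) ∧ _ ∧ _) ↔ ((∀ e, endForm _ ω _ e _ =
      markedConstraint I N p c e) ∧ ∃ s : ℝ, Γ.h (Γ.endVertex (.inl e₀)) =
        basePoint ω (Δ e₀) δ (c.1.1 e₀, c.2.1) + s • toReal (Δ e₀))
  rw [Sum.forall]
  simp only [h1, h2]
  rw [← mem_lineD_and_moment_iff hω hδ]
  constructor
  · rintro ⟨h3, h4, h5⟩
    exact ⟨⟨h3, h5⟩, h3 e₀, h4⟩
  · rintro ⟨⟨h3, h5⟩, -, h4⟩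
    exact ⟨h3, h4, h5⟩

variable [DecidableEq I]

theorem marks_eq_empty (hΔ : ∀ e, Δ e ≠ 0) : marks Δ = ∅ := by
  ext e
  simp [mem_marks, hΔ e]

theorem solutionMult_eq_refinedMult (hΔ : ∀ e, Δ e ≠ 0) (φ : I → Module.Dual ℤ N)
    (K : Submodule ℤ (⋀[ℤ]^2 N)) : solutionMult Δ ω φ K = Curve.refinedMult ω K := by
  funext Γ
  rw [solutionMult, marks_eq_empty hΔ, Finset.prod_empty, one_smul]

theorem marks_markedDegree (hΔ : ∀ e, Δ e ≠ 0) (p : ℕ) :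
    marks (markedDegree Δ p) = Finset.univ.map Function.Embedding.inr := by
  ext e
  rcases e with e | i <;> simp [mem_marks, markedDegree, hΔ]

theorem solutionMult_eq_markedMult (hΔ : ∀ e, Δ e ≠ 0) {p : ℕ} (φ : Fin p → Module.Dual ℤ N) :
    solutionMult (markedDegree Δ p) ω (Sum.elim (fun _ => 0) φ) (kerSpan Δ ω) =
      markedMult Δ ω φ := by
  funext Γ
  rw [solutionMult, marks_markedDegree hΔ, Finset.prod_map]
  rfl

theorem degSum_markedDegree {p : ℕ} (A : Finset I) :
    degSum (markedDegree Δ p) (A.map Function.Embedding.inl) = degSum Δ A := by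
  rw [degSum, Finset.sum_map]
  rfl

theorem erase_sdiff_marks (hΔ : ∀ e, Δ e ≠ 0) (p : ℕ) :
    Finset.univ.erase (.inl e₀) \ marks (markedDegree Δ p) =
      (Finset.univ.erase e₀).map Function.Embedding.inl := by
  ext e
  rcases e with e | i <;> simp [mem_marks, markedDegree, hΔ]

theorem erase_inter_marks (hΔ : ∀ e, Δ e ≠ 0) (p : ℕ) :
    Finset.univ.erase (.inl e₀) ∩ marks (markedDegree Δ p) =
      Finset.univ.map Function.Embedding.inr := by
  ext e
  rcases e with e | i <;> simp [mem_marks, markedDegree, hΔ]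

theorem pairing_markedDegree (hΔ : ∀ e, Δ e ≠ 0) {p : ℕ} (φ : I ⊕ Fin p → Module.Dual ℤ N)
    (φ' : I → Module.Dual ℤ N) (e f : I) :
    pairing (markedDegree Δ p) ω φ (.inl e) (.inl f) = pairing Δ ω φ' e f := by
  simp [pairing, markedDegree, hΔ]

/-- The factor of a marked point for the state at `-∞` is the intersection index. The values
`φ(n_e)` for `e ≠ e₀` have the sum `-φ(n_{e₀})`, so subtracting this sum when it is negative supplies
the term of `e₀` when it is positive. -/
theorem markFactor_eq_intersectionIndex (hsum : ∑ e, Δ e = 0) (φ : Module.Dual ℤ N) :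
    markFactor (fun _ e => φ (Δ e)) (Finset.univ.erase e₀) e₀
      (∑ e ∈ Finset.univ.erase e₀, φ (Δ e) < 0) = intersectionIndex φ Δ := by
  have h1 : ∑ e ∈ Finset.univ.erase e₀, φ (Δ e) = -φ (Δ e₀) := by
    rw [eq_neg_iff_add_eq_zero, add_comm, Finset.add_sum_erase _ (fun e => φ (Δ e)) (Finset.mem_univ _),
      ← map_sum, hsum, map_zero]
  have h2 : intersectionIndex φ Δ = ∑ e, max (φ (Δ e)) 0 := by
    rw [intersectionIndex, Finset.sum_filter]
    refine Finset.sum_congr rfl fun e _ => ?_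
    split_ifs with h
    · rw [max_eq_left h.le]
    · rw [max_eq_right (not_lt.1 h)]
  rw [h2, ← Finset.add_sum_erase _ _ (Finset.mem_univ e₀), markFactor, h1, neg_lt_zero]
  split_ifs with h
  · rw [max_eq_left h.le]; ring
  · rw [max_eq_right (not_lt.1 h)]; ring

end Problems


/-! ### The invariants -/

section Invariants

variable {N I : Type*} [AddCommGroup N] [Module.Free ℤ N] [Module.Finite ℤ N]
  [Fintype I] [DecidableEq I]
  {Δ : I → N} {ω : LinearMap.BilinForm ℤ N} {e₀ : I}

/-- The common value of the counts. The weights `v` break the ties between the blocks whose pairing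
vanishes. -/
def omegaInvariant (Δ : I → N) (ω : LinearMap.BilinForm ℤ N) (e₀ : I) (v : I → ℚ) :
    RefinedRing Δ ω :=
  flowSum (fun X Z Y => qPow (kerSpan Δ ω) (wedge (degSum Δ (Z \ X)) (degSum Δ (Y \ Z))))
    (finalState _ (lexPos (fun e f => (pairing Δ ω 0 e f : ℝ)) v)) ∅ (Finset.univ.erase e₀)
    fun Z => ind _ (lexPos (fun e f => (pairing Δ ω 0 e f : ℝ)) v Z (Finset.univ.erase e₀ \ Z))

theorem one_lt_card_erase (hcard : 3 ≤ Fintype.card I) : 1 < (Finset.univ.erase e₀).card := by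
  rw [Finset.card_erase_of_mem (Finset.mem_univ _), Finset.card_univ]
  omega

/-- The family `m` with the value at `e₀` replaced by `0`. -/
def offRoot (e₀ : I) {m : I → ℝ} (hm : ∑ e ∈ Finset.univ.erase e₀, m e = 0) : momentSpace I :=
  ⟨Function.update m e₀ 0, by
    change ∑ e, Function.update m e₀ 0 e = 0
    rw [Finset.sum_update_of_mem (Finset.mem_univ _), zero_add, Finset.sdiff_singleton_eq_erase, hm]⟩

theorem offRoot_self {m : I → ℝ} (hm : ∑ e ∈ Finset.univ.erase e₀, m e = 0) :
    (offRoot e₀ hm).1 e₀ = 0 := Function.update_self ..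

theorem offRoot_of_ne {m : I → ℝ} (hm : ∑ e ∈ Finset.univ.erase e₀, m e = 0) {e : I}
    (he : e ≠ e₀) : (offRoot e₀ hm).1 e = m e := Function.update_of_ne he ..

theorem omegaBase_eq_zero {δ : N} {c : momentSpace I × (ℝ ⊗[ℤ] N)} (h1 : c.1.1 e₀ = 0)
    (h2 : c.2 = 0) : omegaBase ω Δ e₀ δ c = 0 := by
  change basePoint ω (Δ e₀) δ (c.1.1 e₀, c.2) = 0
  rw [h1, h2]
  exact map_zero (basePoint ω (Δ e₀) δ)

theorem isOmegaInvariant (hcard : 3 ≤ Fintype.card I) (hΔ : ∀ e, Δ e ≠ 0) (hsum : ∑ e, Δ e = 0)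
    (hω : ω.IsAlt) (e₀ : I) {v : I → ℚ}
    (hv : ∀ A B : Finset I, A.Nonempty → B.Nonempty → Disjoint A B → perturbSum v A B ≠ 0) :
    IsOmegaInvariant Δ ω e₀ (omegaInvariant Δ ω e₀ v) := by
  intro δ hδ
  have hm0 := marks_eq_empty hΔ
  simp only [omegaSolutions_eq hω hΔ hδ 0]
  refine ⟨holdsGenerically_solutions (omegaConstraint I N) (omegaBase ω Δ e₀ δ) fun m hm => ?_,
    fun c hc => ?_⟩
  · rw [hm0, Finset.sdiff_empty] at hm
    refine ⟨(offRoot e₀ hm, 0), fun e he => ?_⟩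
    rw [omegaBase_eq_zero (offRoot_self hm) rfl, map_zero, sub_zero]
    exact offRoot_of_ne hm he
  · have hy : endForm Δ ω 0 e₀ (omegaBase ω Δ e₀ δ c) = omegaConstraint I N c e₀ := by
      rw [endForm, if_neg (hΔ e₀)]
      exact formReal_basePoint hδ _ _
    have h := count_solutions (K := kerSpan Δ ω) hω (hΔ e₀) hsum hv
      (fun A B hA hB hd _ _ hA' hB' h => wedge_degSum_mem_kerSpan hcard hsum ω e₀ hA hB hd hA' hB' h)
      hy (sum_endForm_eq_zero (hΔ e₀) hsum hy (by rw [hm0, Finset.sdiff_empty]; exact c.1.2))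
      (by rw [hm0, Finset.sdiff_empty]; exact one_lt_card_erase hcard) hc
    rw [solutionMult_eq_refinedMult hΔ, hm0, Finset.sdiff_empty, Finset.inter_empty,
      Finset.prod_empty, mul_one] at h
    exact h

theorem isMarkedInvariant (hcard : 3 ≤ Fintype.card I) (hΔ : ∀ e, Δ e ≠ 0) (hsum : ∑ e, Δ e = 0)
    (hω : ω.IsAlt) (e₀ : I) {p : ℕ} (φ : Fin p → Module.Dual ℤ N) {v : I ⊕ Fin p → ℚ}
    (hv : ∀ A B : Finset (I ⊕ Fin p), A.Nonempty → B.Nonempty → Disjoint A B →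
      perturbSum v A B ≠ 0) :
    IsMarkedInvariant Δ ω e₀ φ ((∏ i, intersectionIndex (φ i) Δ) •
      omegaInvariant Δ ω e₀ fun e => v (.inl e)) := by
  intro δ hδ
  have hS := erase_sdiff_marks (e₀ := e₀) hΔ p
  simp only [markedSolutions_eq hω hΔ hδ]
  refine ⟨holdsGenerically_solutions (markedConstraint I N p) (markedBase ω Δ e₀ δ p)
    fun m hm => ?_, fun c hc => ?_⟩
  · rw [hS, Finset.sum_map] at hm
    refine ⟨(offRoot e₀ hm, 0, fun i => m (.inr i)), fun e he => ?_⟩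
    have h0 : markedBase ω Δ e₀ δ p (offRoot e₀ hm, 0, fun i => m (.inr i)) = 0 :=
      omegaBase_eq_zero (c := (offRoot e₀ hm, 0)) (offRoot_self hm) rfl
    rw [h0, map_zero, sub_zero]
    rcases e with e | i
    · exact offRoot_of_ne hm fun h => he (congrArg _ h)
    · rfl
  · have hroot : markedDegree Δ p (.inl e₀) ≠ 0 := hΔ e₀
    have hsum' : ∑ e, markedDegree Δ p e = 0 := by
      simp [Fintype.sum_sum_type, markedDegree, hsum]
    have hy : endForm (markedDegree Δ p) ω (Sum.elim (fun _ => 0) φ) (.inl e₀)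
        (markedBase ω Δ e₀ δ p c) = markedConstraint I N p c (.inl e₀) := by
      rw [endForm, if_neg hroot]
      exact formReal_basePoint hδ _ _
    have hmarks : Finset.univ \ marks (markedDegree Δ p) =
        Finset.univ.map Function.Embedding.inl := by
      ext e
      rcases e with e | i <;> simp [mem_marks, markedDegree, hΔ]
    have hsub : ∀ A : Finset (I ⊕ Fin p), A ⊆ Finset.univ.erase (.inl e₀) →
        Disjoint A (marks (markedDegree Δ p)) →
        ∃ A' ⊆ Finset.univ.erase e₀, A = A'.map Function.Embedding.inl := fun A hA hd => by
      rw [← Finset.subset_map_iff, ← hS]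
      exact Finset.subset_sdiff.2 ⟨hA, hd⟩
    have h := count_solutions (K := kerSpan Δ ω) hω hroot hsum' hv
      (fun A B hA hB hd hA1 hB1 hA' hB' h => by
        obtain ⟨A, hA₀, rfl⟩ := hsub A hA hA1
        obtain ⟨B, hB₀, rfl⟩ := hsub B hB hB1
        rw [degSum_markedDegree, degSum_markedDegree] at h ⊢
        exact wedge_degSum_mem_kerSpan hcard hsum ω e₀ hA₀ hB₀ ((Finset.disjoint_map _).1 hd)
          (Finset.map_nonempty.1 hA') (Finset.map_nonempty.1 hB') h)
      hy (sum_endForm_eq_zero hroot hsum' hy (by rw [hmarks, Finset.sum_map]; exact c.1.2))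
      (by rw [hS, Finset.card_map]; exact one_lt_card_erase hcard) hc
    refine ⟨h.1, ?_⟩
    rw [← solutionMult_eq_markedMult hΔ, h.2, hS, erase_inter_marks hΔ, Finset.prod_map,
      zsmul_eq_mul, Int.cast_prod, mul_comm]
    congr 1
    · refine Finset.prod_congr rfl fun i _ => congrArg _ ?_
      rw [← markFactor_eq_intersectionIndex (e₀ := e₀) hsum]
      simp only [markFactor, Finset.sum_map]
      rfl
    · have hpair : ∀ e f : I, (pairing (markedDegree Δ p) ω (Sum.elim (fun _ => 0) φ)
          (Function.Embedding.inl e) (Function.Embedding.inl f) : ℝ) = pairing Δ ω 0 e f :=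
        fun e f => by
          rw [Function.Embedding.inl_apply, Function.Embedding.inl_apply,
            pairing_markedDegree hΔ _ 0 e f]
      have hlex : ∀ A B : Finset I, lexPos (fun e f => (pairing (markedDegree Δ p) ω
          (Sum.elim (fun _ => 0) φ) e f : ℝ)) v (A.map Function.Embedding.inl)
            (B.map Function.Embedding.inl) ↔
          lexPos (fun e f => (pairing Δ ω 0 e f : ℝ)) (fun e => v (.inl e)) A B :=
        fun A B => lexPos_map Function.Embedding.inl hpair v A B
      rw [omegaInvariant, ← Finset.map_empty Function.Embedding.inl]
      refine flowSum_map _ (fun X Z Y => ?_) (fun X Y Z => ?_) _ _ fun Z => ?_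
      · rw [← Finset.map_sdiff, ← Finset.map_sdiff, degSum_markedDegree, degSum_markedDegree]
      · rw [finalState, finalState, ← Finset.map_sdiff, ← Finset.map_sdiff, hlex]
      · rw [← Finset.map_sdiff, hlex]

end Invariants

end Tropical9
end

theorem mainTheorem9 {N : Type*} [AddCommGroup N] [Module.Free ℤ N] [Module.Finite ℤ N]
    {I : Type*} [Fintype I] (Δ : I → N) (hcard : 3 ≤ Fintype.card I)
    (hΔ : ∀ e, Δ e ≠ 0) (hsum : ∑ e, Δ e = 0)
    (ω : LinearMap.BilinForm ℤ N) (hω : ω.IsAlt) (hωΔ : ∀ e, ω (Δ e) ≠ 0) (e₀ : I)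
    {p : ℕ} (φ : Fin p → Module.Dual ℤ N) (hφ : ∀ i, φ i ≠ 0) :
    ∃ B : Tropical9.RefinedRing Δ ω, Tropical9.IsOmegaInvariant Δ ω e₀ B ∧
      Tropical9.IsMarkedInvariant Δ ω e₀ φ
        ((∏ i, Tropical9.intersectionIndex (φ i) Δ) • B) := by
  classical
  obtain ⟨v, hv⟩ := Tropical9.exists_separating_weights (I ⊕ Fin p)
  refine ⟨_, Tropical9.isOmegaInvariant hcard hΔ hsum hω e₀ fun A B hA hB hd => ?_,
    Tropical9.isMarkedInvariant hcard hΔ hsum hω e₀ φ hv⟩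
  have h := hv (A.map Function.Embedding.inl) (B.map Function.Embedding.inl) (hA.map) (hB.map)
    ((Finset.disjoint_map _).2 hd)
  simpa only [Tropical9.perturbSum, Finset.sum_map, Finset.card_map, Function.Embedding.inl_apply] using h
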